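/- Let $d\ge 1$, let $\mathcal V=B(0,V_0)\subset\mathbb R^d$ be the centered ball of unit volume, let $\chi\in(0,1)$ and $K(x,v)=1+\chi\,\mathrm{sign}(x\cdot v)$. Consider the linear run-and-tumble operator $$\mathcal L f=-v\cdot\nabla_x f+\int_{\mathcal V}\{K(x,v')f(x,v')-K(x,v)f(x,v)\}\,dv',\qquad (x,v)\in\mathbb R^d\times\mathcal V .$$ For $\gamma>0$ let $m(x)=e^{\gamma\langle x\rangle}$, $\langle x\rangle=(1+|x|^2)^{1/2}$, $\|f\|_{L^p(m)}=\|mf\|_{L^p(\mathbb R^d\times\mathcal V)}$, and let $X=L^1(m)\cap L^2(m)$ with $\|f\|_X^2=\|f\|_{L^1(m)}^2+\|f\|_{L^2(m)}^2$. Fix a radially symmetric $\phi\in C_c^\infty(\mathbb R^d)$ with $\mathbf 1_{B(0,1)}\le\phi\le\mathbf 1_{B(0,2)}$. Put $\phi_\lambda(z)=\phi(z/\lambda)$, where for a scalar $s\ge0$ the value $\phi(s)$ means the value of $\phi$ at any point of norm $s$. For $\delta>0$, a regularized sign at scale $\delta$ is a nondecreasing odd function $\zeta_\delta\in C^\infty(\mathbb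 R)$ with $\zeta_\delta(s)=1$ for $s\ge\delta$. For $R>1$ and $\delta_1,\delta_2,\delta_3\in(0,1)$ define $$\mathcal B_1f=-v\cdot\nabla_xf-Kf+(1-\phi_R)\int_{\mathcal V}K(x,v')f(x,v')\,dv',$$ $$\mathcal A f=\int_{\mathcal V}K_{R,\delta_i}(x,v')f(x,v')\,dv',\qquad \mathcal B=\mathcal L-\mathcal A,$$ $$K_{R,\delta_i}(x,v)=(\phi_R-\phi_{\delta_2})(x)\,\bigl(1-\phi_{\delta_1}(V_0-|v|)-\phi_{\delta_1}(v)\bigr)\,\bigl(1+\chi\zeta_{\delta_3}(x\cdot v)\bigr).$$ All operators are understood in the sense of distributions on $\mathbb R^d\times\mathcal V$. There is $\gamma^*>0$ such that for every $\gamma\in(0,\gamma^*)$ there are $a^*<0$ and $R_0>1$ with the following two properties. (1) There is $C\ge1$ such that for every $R\ge R_0$ the operator $\mathcal B_1$, with domain $\{f\in L^1(m):\mathcal B_1f\in L^1(m)\}$, generates a strongly continuous semigroup $S_{\mathcal B_1}$ on $L^1(m)$, and $\|S_{\mathcal B_1}(t)\|_{L^1(m)\to L^1(m)}\le Ce^{a^*t}$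 for all $t\ge0$. (2) With the same $a^*$: for every $R\ge R_0$, every sufficiently small $\delta_1>0$ (depending on $R$), every sufficiently small $\delta_2>0$ (depending on $R,\delta_1$), every sufficiently small $\delta_3>0$ (depending on $R,\delta_1,\delta_2$) and every regularized sign $\zeta_{\delta_3}$ at scale $\delta_3$, the operator $\mathcal B$, with domain $\{f\in X:\mathcal Bf\in X\}$, generates a strongly continuous semigroup $S_{\mathcal B}$ on $X$, and for every $a>a^*$ there is $C_a>0$ such that $$\|S_{\mathcal B}(t)\|_{X\to X}\le C_a\,e^{at}\qquad\text{for all } t\ge0 .$$ -/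

import Mathlib

open MeasureTheory Set Filter Topology
open scoped ENNReal NNReal ContDiff

noncomputable section

namespace RunTumble

/-- Euclidean space of dimension `d`. -/
abbrev E (d : ℕ) : Type := EuclideanSpace ℝ (Fin d)

/-- The measure `dx dv` on the phase space `ℝ^d × 𝒱`, where `𝒱 = B(0, V₀)`. -/
def phaseMeasure (d : ℕ) (V₀ : ℝ) : Measure (E d × E d) :=
  (volume : Measure (E d)).prod ((volume : Measure (E d)).restrict (Metric.ball 0 V₀))

/-- The exponential weight `m(x) = exp(γ ⟨x⟩)` with `⟨x⟩ = (1 + |x|²)^{1/2}`. -/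
def weight {d : ℕ} (γ : ℝ) (x : E d) : ℝ := Real.exp (γ * √(1 + ‖x‖ ^ 2))

/-- The measure `m^p dx dv`, so that `‖f‖_{L^p(m)} = ‖m f‖_{L^p}` is the norm
of `f` in `L^p (m^p dx dv)`. -/
def weightedMeasure (d : ℕ) (V₀ γ : ℝ) (p : ℕ) : Measure (E d × E d) :=
  (phaseMeasure d V₀).withDensity (fun z => ENNReal.ofReal (weight γ z.1 ^ p))

/-- The weighted space `L^1(m)`. -/
abbrev L1m (d : ℕ) (V₀ γ : ℝ) : Type := Lp ℝ 1 (weightedMeasure d V₀ γ 1)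

/-- The weighted space `L^2(m)`. -/
abbrev L2m (d : ℕ) (V₀ γ : ℝ) : Type := Lp ℝ 2 (weightedMeasure d V₀ γ 2)

theorem phaseMeasure_ac (d : ℕ) (V₀ γ : ℝ) (p : ℕ) :
    phaseMeasure d V₀ ≪ weightedMeasure d V₀ γ p := by
  refine withDensity_absolutelyContinuous' ?_ (ae_of_all _ fun z => ?_)
  · unfold weight
    fun_prop
  · simpa [weight] using pow_pos (Real.exp_pos _) p

/-- The Banach space `X = L^1(m) ∩ L^2(m)`, with the norm
`‖f‖_X² = ‖f‖_{L^1(m)}² + ‖f‖_{L^2(m)}²`. An element is a pair of classes of functions, in `L^1(m)`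
and in `L^2(m)`, which are equal almost everywhere. -/
def X (d : ℕ) (V₀ γ : ℝ) : Submodule ℝ (WithLp 2 (L1m d V₀ γ × L2m d V₀ γ)) where
  carrier := {u | ∀ᵐ z ∂phaseMeasure d V₀, u.fst z = u.snd z}
  zero_mem' := by
    have h1 := (phaseMeasure_ac d V₀ γ 1).ae_le
      (Lp.coeFn_zero ℝ 1 (weightedMeasure d V₀ γ 1))
    have h2 := (phaseMeasure_ac d V₀ γ 2).ae_le
      (Lp.coeFn_zero ℝ 2 (weightedMeasure d V₀ γ 2))
    filter_upwards [h1, h2] with z a b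
    exact a.trans b.symm
  add_mem' := by
    intro u w hu hw
    have h1 := (phaseMeasure_ac d V₀ γ 1).ae_le (Lp.coeFn_add u.fst w.fst)
    have h2 := (phaseMeasure_ac d V₀ γ 2).ae_le (Lp.coeFn_add u.snd w.snd)
    filter_upwards [hu, hw, h1, h2] with z a b c e
    rw [WithLp.add_fst, WithLp.add_snd, c, e, Pi.add_apply, Pi.add_apply, a, b]
  smul_mem' := by
    intro r u hu
    have h1 := (phaseMeasure_ac d V₀ γ 1).ae_le (Lp.coeFn_smul r u.fst)
    have h2 := (phaseMeasure_ac d V₀ γ 2).ae_le (Lp.coeFn_smul r u.snd)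
    filter_upwards [hu, h1, h2] with z a c e
    rw [WithLp.smul_fst, WithLp.smul_snd, c, e, Pi.smul_apply, Pi.smul_apply, a]

/-- The turning kernel `K(x, v) = 1 + χ sign(x · v)`. -/
def turningKernel {d : ℕ} (χ : ℝ) (x v : E d) : ℝ := 1 + χ * Real.sign (inner ℝ x v)

/-- Test functions: smooth, with compact support contained in the open set `ℝ^d × B(0, V₀)`. -/
structure IsTestFunction {d : ℕ} (V₀ : ℝ) (η : E d × E d → ℝ) : Prop where
  smooth : ContDiff ℝ ∞ η
  compact : HasCompactSupport η
  support : tsupport η ⊆ univ ×ˢ Metric.ball 0 V₀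

/-- `h = ℒ f = - v · ∇ₓ f + ∫_𝒱 {K(x, v') f(x, v') - K(x, v) f(x, v)} dv'` in the sense of
distributions. -/
def IsL {d : ℕ} (V₀ χ : ℝ) (f h : E d × E d → ℝ) : Prop :=
  ∀ η : E d × E d → ℝ, IsTestFunction V₀ η →
    ∫ z, h z * η z ∂phaseMeasure d V₀ =
      (∫ z, f z * fderiv ℝ η z (z.2, 0) ∂phaseMeasure d V₀) +
      ∫ z, (∫ v' in Metric.ball 0 V₀,
          (turningKernel χ z.1 v' * f (z.1, v') - turningKernel χ z.1 z.2 * f z)) * η z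
        ∂phaseMeasure d V₀

/-- The averaging operator `f ↦ ∫_𝒱 κ(x, v') f(x, v') dv'`. -/
def average {d : ℕ} (V₀ : ℝ) (κ : E d → E d → ℝ) (f : E d × E d → ℝ) (z : E d × E d) : ℝ :=
  ∫ v' in Metric.ball 0 V₀, κ z.1 v' * f (z.1, v')

/-- `ϕ` is the radial profile, `φ(x) = ϕ(|x|)`, of a radially symmetric smooth function `φ` on `ℝ^d`
with `1_{B(0,1)} ≤ φ ≤ 1_{B(0,2)}`. -/
structure IsCutoffProfile (d : ℕ) (ϕ : ℝ → ℝ) : Prop where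
  smooth : ContDiff ℝ ∞ (fun x : E d => ϕ ‖x‖)
  lower : ∀ x : E d, (Metric.ball (0 : E d) 1).indicator (fun _ => (1 : ℝ)) x ≤ ϕ ‖x‖
  upper : ∀ x : E d, ϕ ‖x‖ ≤ (Metric.ball (0 : E d) 2).indicator (fun _ => (1 : ℝ)) x

/-- The truncation `φ_r(x) = φ(x / r)`, for `r > 0`. -/
def cutoff {d : ℕ} (ϕ : ℝ → ℝ) (r : ℝ) (x : E d) : ℝ := ϕ (‖x‖ / r)

/-- The velocity truncation `ψ_δ(v) = 1 - φ_δ(V₀ - |v|) - φ_δ(v)`, for `|v| < V₀`. -/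
def velocityCutoff {d : ℕ} (V₀ : ℝ) (ϕ : ℝ → ℝ) (δ : ℝ) (v : E d) : ℝ :=
  1 - ϕ ((V₀ - ‖v‖) / δ) - cutoff ϕ δ v

/-- `ζ` is a regularized sign function at scale `δ`. -/
structure IsRegularizedSign (δ : ℝ) (ζ : ℝ → ℝ) : Prop where
  smooth : ContDiff ℝ ∞ ζ
  odd : ∀ s, ζ (-s) = -ζ s
  mono : Monotone ζ
  eq_one : ∀ s, δ ≤ s → ζ s = 1

/-- The truncated and regularized kernel
`K_{R,δᵢ}(x, v) = (φ_R - φ_{δ₂})(x) ψ_{δ₁}(v) (1 + χ ζ(x · v))`. -/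
def truncatedKernel {d : ℕ} (V₀ χ : ℝ) (ϕ : ℝ → ℝ) (R δ₁ δ₂ : ℝ) (ζ : ℝ → ℝ) (x v : E d) : ℝ :=
  (cutoff ϕ R x - cutoff ϕ δ₂ x) * velocityCutoff V₀ ϕ δ₁ v * (1 + χ * ζ (inner ℝ x v))

/-- `g = ℬ₁ f` in the sense of distributions, where
`ℬ₁ f = - v · ∇ₓ f - K f + (1 - φ_R) ∫_𝒱 K(x, v') f(x, v') dv'`, that is, `ℒ = 𝒜₁ + ℬ₁` with `𝒜₁`
the averaging operator of kernel `φ_R K`. -/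
def IsB₁ {d : ℕ} (V₀ χ : ℝ) (ϕ : ℝ → ℝ) (R : ℝ) (f g : E d × E d → ℝ) : Prop :=
  IsL V₀ χ f (average V₀ (fun x v' => cutoff ϕ R x * turningKernel χ x v') f + g)

/-- `g = ℬ f` in the sense of distributions, where `ℒ = 𝒜 + ℬ` and `𝒜` is the averaging
operator with the truncated and regularized kernel. -/
def IsB {d : ℕ} (V₀ χ : ℝ) (ϕ : ℝ → ℝ) (R δ₁ δ₂ : ℝ) (ζ : ℝ → ℝ) (f g : E d × E d → ℝ) : Prop :=
  IsL V₀ χ f (average V₀ (truncatedKernel V₀ χ ϕ R δ₁ δ₂ ζ) f + g)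

/-- `S` is a strongly continuous semigroup of bounded operators on `Z`. Its infinitesimal generator
is the operator whose graph is the relation `G`. -/
structure IsSemigroupGeneratedBy {Z : Type*} [NormedAddCommGroup Z] [NormedSpace ℝ Z]
    (G : Z → Z → Prop) (S : ℝ≥0 → Z →L[ℝ] Z) : Prop where
  map_zero : S 0 = ContinuousLinearMap.id ℝ Z
  map_add : ∀ s t, S (s + t) = (S s).comp (S t)
  continuous : ∀ f, Continuous fun t => S t f
  generator : ∀ f g, G f g ↔
    Tendsto (fun t : ℝ≥0 => (t : ℝ)⁻¹ • (S t f - f)) (𝓝[>] 0) (𝓝 g)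

/-- `S = S_{ℬ₁}` is the semigroup on `L^1(m)` generated by `ℬ₁` with domain
`{f ∈ L^1(m) : ℬ₁ f ∈ L^1(m)}`. -/
def IsSB₁ (d : ℕ) (V₀ χ γ : ℝ) (ϕ : ℝ → ℝ) (R : ℝ)
    (S : ℝ≥0 → L1m d V₀ γ →L[ℝ] L1m d V₀ γ) : Prop :=
  IsSemigroupGeneratedBy (fun f g : L1m d V₀ γ => IsB₁ V₀ χ ϕ R f g) S

/-- `S = S_ℬ` is the semigroup on `X = L^1(m) ∩ L^2(m)` generated by `ℬ` with domain
`{f ∈ X : ℬ f ∈ X}`. -/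
def IsSB (d : ℕ) (V₀ χ γ : ℝ) (ϕ : ℝ → ℝ) (R δ₁ δ₂ : ℝ) (ζ : ℝ → ℝ)
    (S : ℝ≥0 → X d V₀ γ →L[ℝ] X d V₀ γ) : Prop :=
  IsSemigroupGeneratedBy
    (fun f g : X d V₀ γ => IsB V₀ χ ϕ R δ₁ δ₂ ζ f.1.fst g.1.fst) S

end RunTumble

end

/-! Subtracting `𝒜₁` or `𝒜` from `ℒ` leaves the same structure: the transport operator `-v·∇ₓ - K`
plus averaging against a remainder kernel `κ`, equal to `(1-φ_R)K` for `ℬ₁` and to `K - K_{R,δᵢ}`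
for `ℬ`.

Generation. The potential `Φ = χ|x·v|/|v|²` satisfies `v·∇ₓΦ = χ sign(x·v)`, so the transport part
has an explicit semigroup: translation along free trajectories times an exponential of increments of
`Φ`. For small `γ` it is a contraction on the weighted spaces, and averaging is bounded there, so
Duhamel's formula solved by a Neumann series gives the full semigroup. Its generator is the
distributional operator on its maximal domain (`isSemigroupGeneratedBy_free`,
`isSemigroupGeneratedBy_evol`, `exists_perturbation`, `isL_iff`). A generator determines its
semigroup (`IsSemigroupGeneratedBy.unique`), so it is enough to bound the one constructed.

Decay in `L¹(m)`. By duality one needs a weight `w` comparable to `m` with `(v·∇ₓ - K)w + |κ|∫w dv'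
≤ a* w`. Write `w = mθ` and `s = x·v/⟨x⟩`, so that `v·∇ₓm = γsm`. If `Kp = s`, then `(γs - K)(1 +
γp) = -K + γ²sp`: the first order term disappears. Moreover the velocity mean of `1 + γp` is `1 -
γχ/(1-χ²)·∫|s|dv`, strictly below `1` away from the origin; this gap is the confining effect of the
bias `χ`. It settles every point where `|κ| ≤ K` and `κ` vanishes for `|x| < R`. The kernel of `ℬ`
violates this only for `v` near `0` or the sphere, or for `x·v` near `0` (which includes `x` near
`0`). Two corrections of `θ` handle these sets: `N·1_Bd(v)` on the extreme velocities, cheap because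
their measure is small, and `-ε clip(x·v/2σ)`, which falls steeply along the flow in the strip
`|x·v| ≤ σ` (`super_of_isControlled`, `isLyapunov_lyapunovWeight`).

Decay in `L²(m)`. Averaging after transport for a time `s` spreads an `L¹` density into `L²` with
norm `s^(-d/2)` (`lintegral_velocity_average_sq_le`). In Duhamel's formula long lags are controlled
by this and the `L¹` decay, and short lags are absorbed (`norm_sndX_le_exp`). -/

noncomputable section

namespace RunTumble

/-! ## Strongly continuous semigroups -/

section Semigroup

variable {Z : Type*} [NormedAddCommGroup Z] [NormedSpace ℝ Z]

namespace IsSemigroupGeneratedBy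

variable {G : Z → Z → Prop} {S : ℝ≥0 → Z →L[ℝ] Z}

/-- Orbits are continuous, hence bounded on `[0, T]`; the uniform boundedness principle does the
rest. -/
theorem exists_bound [CompleteSpace Z] (h : IsSemigroupGeneratedBy G S) (T : ℝ≥0) :
    ∃ M : ℝ, 0 ≤ M ∧ ∀ t ≤ T, ‖S t‖ ≤ M := by
  obtain ⟨M, hM⟩ := banach_steinhaus (g := fun t : Icc (0 : ℝ≥0) T => S t) (fun f => by
    obtain ⟨C, hC⟩ := (isCompact_Icc (a := (0 : ℝ≥0)) (b := T)).exists_bound_of_continuousOn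
      (h.continuous f).continuousOn
    exact ⟨C, fun t => hC t t.2⟩)
  exact ⟨M, (norm_nonneg _).trans (hM ⟨0, by simp⟩), fun t ht => hM ⟨t, by simpa using ht⟩⟩

/-- The local operator bound upgrades strong continuity to joint continuity, needed for integrands
such as `s ↦ S (t - s) (B (u s))`. -/
theorem continuous_uncurry [CompleteSpace Z] (h : IsSemigroupGeneratedBy G S) :
    Continuous fun p : ℝ≥0 × Z => S p.1 p.2 := by
  rw [continuous_iff_continuousAt]
  rintro ⟨t₀, z₀⟩
  obtain ⟨M, hM0, hM⟩ := h.exists_bound (t₀ + 1)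
  have h1 : Tendsto (fun p : ℝ≥0 × Z => M * ‖p.2 - z₀‖ + ‖S p.1 z₀ - S t₀ z₀‖)
      (𝓝 (t₀, z₀)) (𝓝 0) := by
    have : Continuous fun p : ℝ≥0 × Z => M * ‖p.2 - z₀‖ + ‖S p.1 z₀ - S t₀ z₀‖ := by
      have h3 := (h.continuous z₀).comp (continuous_fst (X := ℝ≥0) (Y := Z))
      exact (by fun_prop : Continuous fun p : ℝ≥0 × Z => M * ‖p.2 - z₀‖).add
        (h3.sub continuous_const).norm
    simpa using this.tendsto (t₀, z₀)
  rw [ContinuousAt, tendsto_iff_norm_sub_tendsto_zero]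
  refine squeeze_zero' (Eventually.of_forall fun _ => norm_nonneg _) ?_ h1
  have h2 : ∀ᶠ p : ℝ≥0 × Z in 𝓝 (t₀, z₀), p.1 < t₀ + 1 :=
    continuous_fst.continuousAt.eventually_lt_const (by simp)
  filter_upwards [h2] with p hp
  have : S p.1 p.2 - S t₀ z₀ = S p.1 (p.2 - z₀) + (S p.1 z₀ - S t₀ z₀) := by
    rw [map_sub]; abel
  rw [this]
  refine (norm_add_le _ _).trans (add_le_add ?_ le_rfl)
  exact (S p.1).le_of_opNorm_le (hM _ hp.le) _

theorem map_add_apply (h : IsSemigroupGeneratedBy G S) (s t : ℝ≥0) (f : Z) :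
    S (s + t) f = S s (S t f) := by rw [h.map_add]; rfl

theorem generator_map (h : IsSemigroupGeneratedBy G S) {f g : Z} (hfg : G f g) (t : ℝ≥0) :
    G (S t f) (S t g) := by
  rw [h.generator] at hfg ⊢
  refine (((S t).continuous.tendsto g).comp hfg).congr fun s => ?_
  simp only [Function.comp, map_smul, map_sub, ← h.map_add_apply, add_comm]

/-- The orbit of `f`, extended to real times. -/
theorem continuous_orbit (h : IsSemigroupGeneratedBy G S) (f : Z) :
    Continuous fun s : ℝ => S s.toNNReal f :=
  (h.continuous f).comp continuous_real_toNNReal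

theorem tendsto_coe_nhdsGT : Tendsto (fun t : ℝ≥0 => (t : ℝ)) (𝓝[>] 0) (𝓝[>] 0) := by
  refine tendsto_nhdsWithin_iff.2 ⟨?_, ?_⟩
  · exact (NNReal.continuous_coe.tendsto 0).mono_left nhdsWithin_le_nhds
  · filter_upwards [self_mem_nhdsWithin] with t ht using by simpa using ht

theorem tendsto_toNNReal_nhdsGT : Tendsto Real.toNNReal (𝓝[>] 0) (𝓝[>] 0) := by
  refine tendsto_nhdsWithin_iff.2 ⟨?_, ?_⟩
  · have := (continuous_real_toNNReal.tendsto 0).mono_left (nhdsWithin_le_nhds (s := Ioi 0))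
    simpa using this
  · filter_upwards [self_mem_nhdsWithin] with t ht using by simpa using ht

/-- Applying `S t` shifts the window of integration by `t`, so the difference quotient is an average
of the orbit near `ε` minus one near `0`. -/
theorem generator_average [CompleteSpace Z] (h : IsSemigroupGeneratedBy G S) (f : Z) (ε : ℝ≥0) :
    G (∫ s in (0 : ℝ)..ε, S s.toNNReal f) (S ε f - f) := by
  rw [h.generator]
  have hc := h.continuous_orbit f
  have hd : ∀ a : ℝ, HasDerivAt (fun r => ∫ s in (0 : ℝ)..r, S s.toNNReal f) (S a.toNNReal f) a :=
    fun a => intervalIntegral.integral_hasDerivAt_right (hc.intervalIntegrable _ _)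
      (hc.stronglyMeasurableAtFilter _ _) hc.continuousAt
  have hslope : ∀ a : ℝ, Tendsto (fun t : ℝ≥0 => (t : ℝ)⁻¹ •
      ((∫ s in (0 : ℝ)..(a + t), S s.toNNReal f) - ∫ s in (0 : ℝ)..a, S s.toNNReal f))
      (𝓝[>] 0) (𝓝 (S a.toNNReal f)) := fun a =>
    ((hd a).tendsto_slope_zero_right).comp tendsto_coe_nhdsGT
  have h1 := (hslope ε).sub (hslope 0)
  simp only [Real.toNNReal_coe, Real.toNNReal_zero, h.map_zero, ContinuousLinearMap.id_apply] at h1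
  refine h1.congr fun t => ?_
  rw [← smul_sub]
  congr 1
  have h2 : S t (∫ s in (0 : ℝ)..ε, S s.toNNReal f)
      = ∫ s in (t : ℝ)..(ε + t), S s.toNNReal f := by
    rw [← ContinuousLinearMap.intervalIntegral_comp_comm _ (hc.intervalIntegrable _ _)]
    have := intervalIntegral.integral_comp_add_right (fun s : ℝ => S s.toNNReal f) (t : ℝ)
      (a := 0) (b := ε)
    rw [zero_add] at this
    rw [← this]
    refine intervalIntegral.integral_congr fun s hs => ?_
    rw [uIcc_of_le ε.coe_nonneg] at hs
    rw [← h.map_add_apply, Real.toNNReal_add hs.1 t.coe_nonneg, Real.toNNReal_coe, add_comm]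
  rw [h2]
  have hi := fun a b => hc.intervalIntegrable (μ := volume) a b
  rw [← intervalIntegral.integral_add_adjacent_intervals (hi 0 t) (hi t (ε + t))]
  simp only [intervalIntegral.integral_same, zero_add]
  abel

theorem domain_smul (h : IsSemigroupGeneratedBy G S) {f g : Z} (hfg : G f g) (c : ℝ) :
    G (c • f) (c • g) := by
  rw [h.generator] at hfg ⊢
  refine (hfg.const_smul c).congr fun t => ?_
  rw [map_smul, ← smul_sub, smul_comm]

theorem dense_domain [CompleteSpace Z] (h : IsSemigroupGeneratedBy G S) :
    Dense {f | ∃ g, G f g} := by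
  intro f
  have hc := h.continuous_orbit f
  have hd : HasDerivAt (fun r => ∫ s in (0 : ℝ)..r, S s.toNNReal f) (S (0 : ℝ).toNNReal f) 0 :=
    intervalIntegral.integral_hasDerivAt_right (hc.intervalIntegrable _ _)
      (hc.stronglyMeasurableAtFilter _ _) hc.continuousAt
  have h1 := hd.tendsto_slope_zero_right.comp tendsto_coe_nhdsGT
  simp only [Real.toNNReal_zero, h.map_zero, ContinuousLinearMap.id_apply] at h1
  refine mem_closure_of_tendsto h1 (Eventually.of_forall fun t => ?_)
  simp only [Function.comp, intervalIntegral.integral_same, zero_add, sub_zero]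
  exact ⟨_, h.domain_smul (h.generator_average f t) _⟩

/-- For `f` in the domain, `s ↦ S (t - s) (S' s f)` is constant on `[0, t]`; its endpoint values are
`S t f` and `S' t f`, and the domain is dense. -/
theorem unique [CompleteSpace Z] {S' : ℝ≥0 → Z →L[ℝ] Z} (h : IsSemigroupGeneratedBy G S)
    (h' : IsSemigroupGeneratedBy G S') : S = S' := by
  funext t
  obtain ⟨M, hM0, hM⟩ := h.exists_bound t
  have key : ∀ f ∈ {f | ∃ g, G f g}, S t f = S' t f := by
    rintro f ⟨g, hfg⟩
    have hcont : Continuous fun s : ℝ => S (t - s).toNNReal (S' s.toNNReal f) :=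
      h.continuous_uncurry.comp ((continuous_real_toNNReal.comp (by fun_prop)).prodMk
        (h'.continuous_orbit f))
    have hder : ∀ s ∈ Ico (0 : ℝ) t,
        HasDerivWithinAt (fun s : ℝ => S (t - s).toNNReal (S' s.toNNReal f)) 0 (Ici s) s := by
      intro s hs
      rw [← hasDerivWithinAt_Ioi_iff_Ici, hasDerivWithinAt_iff_tendsto_slope' (by simp)]
      -- `S' s f` stays in the common domain, so its difference quotients under `S` and `S'` share
      -- the limit `S' s g`; their difference tends to `0`, and only the right derivative is needed.
      have hG := h'.generator_map hfg s.toNNReal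
      have hlim := (((h'.generator _ _).1 hG).sub ((h.generator _ _).1 hG)).norm
      rw [sub_self, norm_zero] at hlim
      have hsub : Tendsto (fun r : ℝ => (r - s).toNNReal) (𝓝[>] s) (𝓝[>] 0) := by
        refine tendsto_toNNReal_nhdsGT.comp (tendsto_nhdsWithin_iff.2 ⟨?_, ?_⟩)
        · have : Continuous fun r : ℝ => r - s := by fun_prop
          simpa using (this.tendsto s).mono_left nhdsWithin_le_nhds
        · filter_upwards [self_mem_nhdsWithin] with r hr using by simpa using hr
      have hlim2 := ((hlim.comp hsub).const_mul M)
      rw [mul_zero] at hlim2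
      refine squeeze_zero_norm' ?_ hlim2
      have hlt : ∀ᶠ r : ℝ in 𝓝[>] s, r < (t : ℝ) :=
        nhdsWithin_le_nhds (gt_mem_nhds hs.2)
      filter_upwards [self_mem_nhdsWithin, hlt] with r hr hrt
      have hr' : s < r := hr
      have e1 : (t - s : ℝ).toNNReal = (t - r : ℝ).toNNReal + (r - s).toNNReal := by
        rw [← Real.toNNReal_add (by linarith) (by linarith)]; congr 1; ring
      have e2 : r.toNNReal = (r - s).toNNReal + s.toNNReal := by
        rw [← Real.toNNReal_add (by linarith) hs.1]; congr 1; ring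
      rw [slope_def_module, e1, e2, h.map_add_apply, h'.map_add_apply, ← map_sub, ← map_smul]
      simp only [Function.comp]
      refine ((S (t - r : ℝ).toNNReal).le_of_opNorm_le (hM _ ?_) _).trans (le_of_eq ?_)
      · rw [Real.toNNReal_le_iff_le_coe]; linarith [hs.1]
      · rw [← smul_sub, Real.coe_toNNReal _ (by linarith : 0 ≤ r - s)]
        congr 3
        abel
    have := constant_of_has_deriv_right_zero hcont.continuousOn hder t ⟨t.2, le_rfl⟩
    simpa [h.map_zero, h'.map_zero] using this.symm
  ext f
  exact congrFun (Continuous.ext_on h.dense_domain (S t).continuous (S' t).continuous key) f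

/-- Semigroups whose difference quotients differ by a bounded operator. -/
theorem of_perturbation (h : IsSemigroupGeneratedBy G S) {S' : ℝ≥0 → Z →L[ℝ] Z} (B : Z →L[ℝ] Z)
    (map_zero : S' 0 = ContinuousLinearMap.id ℝ Z)
    (map_add : ∀ s t, S' (s + t) = (S' s).comp (S' t))
    (continuous : ∀ f, Continuous fun t => S' t f)
    (hB : ∀ f, Tendsto (fun t : ℝ≥0 => (t : ℝ)⁻¹ • (S' t f - S t f)) (𝓝[>] 0) (𝓝 (B f))) :
    IsSemigroupGeneratedBy (fun f g => G f (g - B f)) S' := by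
  refine ⟨map_zero, map_add, continuous, fun f g => ?_⟩
  rw [h.generator]
  constructor
  · intro hl
    have := hl.add (hB f)
    rw [sub_add_cancel] at this
    refine this.congr fun t => ?_
    rw [← smul_add]; congr 1; abel
  · intro hl
    refine (hl.sub (hB f)).congr fun t => ?_
    rw [← smul_sub]; congr 1; abel

end IsSemigroupGeneratedBy

open BoundedContinuousFunction

/-! ## Bounded perturbations -/

section Perturbation

variable {G : Z → Z → Prop} {S : ℝ≥0 → Z →L[ℝ] Z}

theorem norm_exp_smul_le (h : ∀ t, ‖S t‖ ≤ 1) (t : ℝ≥0) (c : ℝ) (f : Z) :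
    ‖Real.exp c • S t f‖ ≤ Real.exp c * ‖f‖ := by
  rw [norm_smul, Real.norm_eq_abs, Real.abs_exp]
  have := (S t).le_of_opNorm_le (h t) f
  rw [one_mul] at this
  gcongr

/-- The orbit map, damped by `exp (- μ t)`. -/
def dampedOrbit (h : IsSemigroupGeneratedBy G S) (hS : ∀ t, ‖S t‖ ≤ 1) (μ : ℝ) (hμ : 0 < μ) :
    Z →L[ℝ] (ℝ≥0 →ᵇ Z) :=
  LinearMap.mkContinuous
    { toFun := fun f => BoundedContinuousFunction.ofNormedAddCommGroup
        (fun t => Real.exp (-μ * t) • S t f)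
        ((by fun_prop : Continuous fun t : ℝ≥0 => Real.exp (-μ * t)).smul (h.continuous f)) ‖f‖
        (fun t => (norm_exp_smul_le hS t _ f).trans (mul_le_of_le_one_left (norm_nonneg _)
          (Real.exp_le_one_iff.2 (by nlinarith [t.coe_nonneg]))))
      map_add' := fun f g => by ext t; simp
      map_smul' := fun c f => by ext t; simp [smul_comm c] }
    1 (fun f => by
      rw [one_mul]
      exact BoundedContinuousFunction.norm_ofNormedAddCommGroup_le _ (norm_nonneg _)
        (fun t => (norm_exp_smul_le hS t _ f).trans (mul_le_of_le_one_left (norm_nonneg _)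
          (Real.exp_le_one_iff.2 (by nlinarith [t.coe_nonneg])))))

theorem dampedOrbit_apply (h : IsSemigroupGeneratedBy G S) (hS : ∀ t, ‖S t‖ ≤ 1) (μ : ℝ)
    (hμ : 0 < μ) (f : Z) (t : ℝ≥0) :
    dampedOrbit h hS μ hμ f t = Real.exp (-μ * t) • S t f := rfl

theorem integral_exp_neg_le {μ : ℝ} (hμ : 0 < μ) (t : ℝ) :
    ∫ s in (0 : ℝ)..t, Real.exp (-μ * (t - s)) ≤ 1 / μ := by
  have hd : ∀ s ∈ uIcc 0 t, HasDerivAt (fun s => Real.exp (-μ * (t - s)) / μ)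
      (Real.exp (-μ * (t - s))) s := by
    intro s _
    have h1 : HasDerivAt (fun s => -μ * (t - s)) μ s := by
      simpa using ((hasDerivAt_id s).const_sub t).const_mul (-μ)
    have := h1.exp.div_const μ
    rwa [mul_div_assoc, div_self hμ.ne', mul_one] at this
  rw [intervalIntegral.integral_eq_sub_of_hasDerivAt hd
    (Continuous.intervalIntegrable (by fun_prop) _ _)]
  simp only [sub_self, mul_zero, Real.exp_zero]
  have := Real.exp_pos (-μ * (t - 0))
  have : 0 < Real.exp (-μ * (t - 0)) / μ := by positivity
  linarith

theorem norm_convolution_le (hS : ∀ t, ‖S t‖ ≤ 1) (B : Z →L[ℝ] Z)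
    {μ : ℝ} (hμ : 0 < μ) (u : ℝ≥0 →ᵇ Z) (t : ℝ≥0) :
    ‖∫ s in (0 : ℝ)..t, Real.exp (-μ * (t - s)) • S (t - s : ℝ).toNNReal (B (u s.toNNReal))‖
      ≤ ‖B‖ / μ * ‖u‖ := by
  have h1 : ‖∫ s in (0 : ℝ)..t, Real.exp (-μ * (t - s)) • S (t - s : ℝ).toNNReal (B (u s.toNNReal))‖
      ≤ ∫ s in (0 : ℝ)..t, Real.exp (-μ * (t - s)) * (‖B‖ * ‖u‖) := by
    refine intervalIntegral.norm_integral_le_of_norm_le t.2 (ae_of_all _ fun s _ => ?_)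
      (Continuous.intervalIntegrable (by fun_prop) _ _)
    refine (norm_exp_smul_le hS _ _ _).trans ?_
    gcongr
    exact (B.le_opNorm _).trans (by gcongr; exact u.norm_coe_le_norm _)
  refine h1.trans ?_
  rw [intervalIntegral.integral_mul_const]
  calc _ ≤ 1 / μ * (‖B‖ * ‖u‖) := by
        gcongr; exact integral_exp_neg_le hμ t
    _ = _ := by ring

variable [CompleteSpace Z]

theorem continuous_convolution_integrand (h : IsSemigroupGeneratedBy G S) (B : Z →L[ℝ] Z) (μ : ℝ)
    {u : ℝ≥0 → Z} (hu : Continuous u) :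
    Continuous fun p : ℝ × ℝ =>
      Real.exp (-μ * (p.1 - p.2)) • S (p.1 - p.2).toNNReal (B (u p.2.toNNReal)) := by
  refine Continuous.smul (by fun_prop) ?_
  exact h.continuous_uncurry.comp ((continuous_real_toNNReal.comp (by fun_prop)).prodMk
    (B.continuous.comp (hu.comp (continuous_real_toNNReal.comp continuous_snd))))

/-- Convolution with the damped semigroup. -/
def dampedConvolution (h : IsSemigroupGeneratedBy G S) (hS : ∀ t, ‖S t‖ ≤ 1) (B : Z →L[ℝ] Z)
    (μ : ℝ) (hμ : 0 < μ) : (ℝ≥0 →ᵇ Z) →L[ℝ] (ℝ≥0 →ᵇ Z) :=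
  LinearMap.mkContinuous
    { toFun := fun u => BoundedContinuousFunction.ofNormedAddCommGroup
        (fun t => ∫ s in (0 : ℝ)..t,
          Real.exp (-μ * (t - s)) • S (t - s : ℝ).toNNReal (B (u s.toNNReal)))
        (intervalIntegral.continuous_parametric_intervalIntegral_of_continuous
          (f := fun (t : ℝ≥0) (s : ℝ) =>
            Real.exp (-μ * (t - s)) • S (t - s : ℝ).toNNReal (B (u s.toNNReal)))
          ((continuous_convolution_integrand h B μ u.continuous).comp
            ((NNReal.continuous_coe.comp continuous_fst).prodMk continuous_snd))
          NNReal.continuous_coe)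
        (‖B‖ / μ * ‖u‖) (fun t => norm_convolution_le hS B hμ u t)
      map_add' := fun u w => by
        ext t
        have hc := fun u : ℝ≥0 →ᵇ Z => (continuous_convolution_integrand h B μ u.continuous).comp
          (Continuous.prodMk_right (t : ℝ))
        have := intervalIntegral.integral_add ((hc u).intervalIntegrable (μ := volume) 0 t)
          ((hc w).intervalIntegrable (μ := volume) 0 t)
        simp only [BoundedContinuousFunction.coe_ofNormedAddCommGroup,
          BoundedContinuousFunction.add_apply, _root_.map_add, smul_add]
        exact this
      map_smul' := fun c u => by
        ext t
        simp only [BoundedContinuousFunction.coe_ofNormedAddCommGroup,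
          BoundedContinuousFunction.coe_smul, _root_.map_smul, RingHom.id_apply, smul_comm _ c]
        exact intervalIntegral.integral_smul _ _ }
    (‖B‖ / μ) (fun u => BoundedContinuousFunction.norm_ofNormedAddCommGroup_le _
      (by positivity) (fun t => norm_convolution_le hS B hμ u t))

theorem dampedConvolution_apply (h : IsSemigroupGeneratedBy G S) (hS : ∀ t, ‖S t‖ ≤ 1)
    (B : Z →L[ℝ] Z) (μ : ℝ) (hμ : 0 < μ) (u : ℝ≥0 →ᵇ Z) (t : ℝ≥0) :
    dampedConvolution h hS B μ hμ u t = ∫ s in (0 : ℝ)..t,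
      Real.exp (-μ * (t - s)) • S (t - s : ℝ).toNNReal (B (u s.toNNReal)) := rfl

theorem norm_dampedConvolution_le (h : IsSemigroupGeneratedBy G S) (hS : ∀ t, ‖S t‖ ≤ 1)
    (B : Z →L[ℝ] Z) (μ : ℝ) (hμ : 0 < μ) : ‖dampedConvolution h hS B μ hμ‖ ≤ ‖B‖ / μ :=
  LinearMap.mkContinuous_norm_le _ (by positivity) _

/-- `u` solves the Duhamel equation with initial datum `f`. -/
def IsMild (S : ℝ≥0 → Z →L[ℝ] Z) (B : Z →L[ℝ] Z) (f : Z) (u : ℝ≥0 → Z) : Prop :=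
  ∀ t : ℝ≥0, u t = S t f + ∫ s in (0 : ℝ)..t, S (t - s : ℝ).toNNReal (B (u s.toNNReal))

/-- Multiplying Duhamel's equation by `exp (-μ t)` turns it into a linear equation on bounded
continuous functions whose convolution has norm at most `‖B‖ / μ`. -/
theorem isMild_iff_damped (h : IsSemigroupGeneratedBy G S) (hS : ∀ t, ‖S t‖ ≤ 1) (B : Z →L[ℝ] Z)
    (μ : ℝ) (hμ : 0 < μ) (f : Z) (u : ℝ≥0 →ᵇ Z) :
    IsMild S B f (fun t => Real.exp (μ * t) • u t) ↔
      (1 - dampedConvolution h hS B μ hμ) u = dampedOrbit h hS μ hμ f := by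
  have e : ∀ t : ℝ≥0, (Real.exp (μ * t) • u t = S t f + ∫ s in (0 : ℝ)..t,
        S (t - s : ℝ).toNNReal (B (Real.exp (μ * s.toNNReal) • u s.toNNReal))) ↔
      u t = dampedOrbit h hS μ hμ f t + dampedConvolution h hS B μ hμ u t := by
    intro t
    have h0 : Real.exp (-μ * t) ≠ 0 := (Real.exp_pos _).ne'
    rw [← smul_right_inj h0, smul_add, smul_smul, ← Real.exp_add, neg_mul, neg_add_cancel,
      Real.exp_zero, one_smul, dampedOrbit_apply, dampedConvolution_apply, neg_mul,
      ← intervalIntegral.integral_smul]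
    rw [intervalIntegral.integral_congr (g := fun s => Real.exp (-μ * (t - s)) •
      S (t - s : ℝ).toNNReal (B (u s.toNNReal)))]
    intro s hs
    rw [uIcc_of_le t.coe_nonneg] at hs
    simp only [_root_.map_smul, smul_smul, ← Real.exp_add, Real.coe_toNNReal _ hs.1]
    congr 2; ring
  simp only [IsMild, e]
  constructor
  · intro H
    ext t
    simp only [_root_.sub_apply, one_apply_eq_self,
      BoundedContinuousFunction.sub_apply]
    rw [H t]; abel
  · intro H t
    rw [← H]
    simp

/-- Bounded perturbation of a contraction semigroup. -/
theorem exists_perturbation (h : IsSemigroupGeneratedBy G S) (hS : ∀ t, ‖S t‖ ≤ 1)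
    (B : Z →L[ℝ] Z) : ∃ S' : ℝ≥0 → Z →L[ℝ] Z,
      IsSemigroupGeneratedBy (fun f g => G f (g - B f)) S' ∧
      (∀ f, IsMild S B f (fun t => S' t f)) ∧
      ∀ f, Tendsto (fun t : ℝ≥0 => (t : ℝ)⁻¹ • (S' t f - S t f)) (𝓝[>] 0) (𝓝 (B f)) := by
  -- Any `μ > ‖B‖` makes the convolution a strict contraction, so `1 - Λ` is inverted by a Neumann
  -- series on all of `[0, ∞)` at once.
  set μ : ℝ := ‖B‖ + 1 with hμdef
  have hμ : 0 < μ := by positivity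
  set Λ := dampedConvolution h hS B μ hμ with hΛ
  have hΛ1 : ‖Λ‖ < 1 := (norm_dampedConvolution_le h hS B μ hμ).trans_lt (by
    rw [div_lt_one hμ]; linarith)
  set U := Units.oneSub Λ hΛ1 with hU
  let y : Z →L[ℝ] (ℝ≥0 →ᵇ Z) := (↑U⁻¹ : (ℝ≥0 →ᵇ Z) →L[ℝ] (ℝ≥0 →ᵇ Z)).comp
    (dampedOrbit h hS μ hμ)
  have hUy : ∀ u, (↑U⁻¹ : (ℝ≥0 →ᵇ Z) →L[ℝ] (ℝ≥0 →ᵇ Z)) ((1 - Λ) u) = u := by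
    intro u
    have : (↑U⁻¹ : (ℝ≥0 →ᵇ Z) →L[ℝ] (ℝ≥0 →ᵇ Z)) * (1 - Λ) = 1 := U.inv_mul
    exact congrArg (fun A => A u) this
  have hyU : ∀ u, (1 - Λ) ((↑U⁻¹ : (ℝ≥0 →ᵇ Z) →L[ℝ] (ℝ≥0 →ᵇ Z)) u) = u := by
    intro u
    have : (1 - Λ) * (↑U⁻¹ : (ℝ≥0 →ᵇ Z) →L[ℝ] (ℝ≥0 →ᵇ Z)) = 1 := U.mul_inv
    exact congrArg (fun A => A u) this
  let S' : ℝ≥0 → Z →L[ℝ] Z := fun t =>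
    Real.exp (μ * t) • (BoundedContinuousFunction.evalCLM ℝ t).comp y
  have hS'a : ∀ t f, S' t f = Real.exp (μ * t) • y f t := fun t f => rfl
  have mild : ∀ f, IsMild S B f (fun t => S' t f) := fun f => by
    simp only [hS'a]
    exact (isMild_iff_damped h hS B μ hμ f (y f)).2 (hyU _)
  have uniq : ∀ f (u : ℝ≥0 →ᵇ Z), IsMild S B f (fun t => Real.exp (μ * t) • u t) →
      ∀ t : ℝ≥0, Real.exp (μ * t) • u t = S' t f := by
    intro f u hu t
    have h1 := (isMild_iff_damped h hS B μ hμ f u).1 hu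
    have : u = y f := by
      rw [← hUy u, h1]; rfl
    rw [this, hS'a]
  have hcont : ∀ f, Continuous fun t => S' t f := fun f => by
    simp only [hS'a]
    exact Continuous.smul (by fun_prop) (y f).continuous
  have hzero : S' 0 = ContinuousLinearMap.id ℝ Z := by
    ext f
    have := mild f 0
    simpa [h.map_zero] using this
  have hint : ∀ f (t : ℝ), Continuous fun s : ℝ => S (t - s).toNNReal (B (S' s.toNNReal f)) :=
    fun f t => by
      have := (continuous_convolution_integrand h B 0 (hcont f)).comp (Continuous.prodMk_right t)
      simpa [Function.comp_def] using this
  -- The shifted solution `r ↦ S' (r + t) f` solves Duhamel's equation with datum `S' t f`;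
  -- uniqueness identifies it.
  have hadd : ∀ s t, S' (s + t) = (S' s).comp (S' t) := by
    intro s t
    ext f
    let u : ℝ≥0 →ᵇ Z := BoundedContinuousFunction.ofNormedAddCommGroup
      (fun r => Real.exp (μ * t) • y f (r + t))
      (((y f).continuous.comp (by fun_prop : Continuous fun r : ℝ≥0 => r + t)).const_smul _)
      (Real.exp (μ * t) * ‖y f‖) (fun r => by
        rw [norm_smul, Real.norm_eq_abs, Real.abs_exp]
        gcongr
        exact (y f).norm_coe_le_norm _)
    have hu : ∀ r : ℝ≥0, Real.exp (μ * r) • u r = S' (r + t) f := fun r => by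
      rw [hS'a]
      change Real.exp (μ * r) • Real.exp (μ * t) • y f (r + t) = _
      rw [smul_smul, ← Real.exp_add]; congr 2; push_cast; ring
    rw [← hu s]
    refine uniq (S' t f) u ?_ s
    intro r
    simp only [hu]
    have h1 := mild f (r + t)
    have h2 := mild f t
    simp only at h1 h2
    rw [h1]
    push_cast
    rw [← intervalIntegral.integral_add_adjacent_intervals
      ((hint f (r + t)).intervalIntegrable 0 t) ((hint f (r + t)).intervalIntegrable t (r + t))]
    rw [← add_assoc]
    congr 1
    · rw [h2, _root_.map_add, h.map_add_apply]
      congr 1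
      rw [← ContinuousLinearMap.intervalIntegral_comp_comm _ ((hint f t).intervalIntegrable _ _)]
      refine intervalIntegral.integral_congr fun q hq => ?_
      rw [uIcc_of_le t.coe_nonneg] at hq
      rw [← h.map_add_apply]
      congr 2
      have : (r : ℝ) + t - q = r + (t - q) := by ring
      rw [this, Real.toNNReal_add r.coe_nonneg (by linarith [hq.2]), Real.toNNReal_coe]
    · have := intervalIntegral.integral_comp_add_right (a := 0) (b := r)
        (fun q : ℝ => S ((r : ℝ) + t - q).toNNReal (B (S' q.toNNReal f))) (t : ℝ)
      rw [zero_add] at this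
      rw [← this]
      refine intervalIntegral.integral_congr fun q hq => ?_
      rw [uIcc_of_le r.coe_nonneg] at hq
      rw [Real.toNNReal_add hq.1 t.coe_nonneg, Real.toNNReal_coe]
      congr 3
      ring
  -- The quotient is the mean over `[0, t]` of an integrand that is jointly continuous with value `B
  -- f` at the origin.
  have hdiff : ∀ f, Tendsto (fun t : ℝ≥0 => (t : ℝ)⁻¹ • (S' t f - S t f)) (𝓝[>] 0)
      (𝓝 (B f)) := by
    intro f
    have hF : Continuous fun p : ℝ × ℝ => S (p.1 - p.2).toNNReal (B (S' p.2.toNNReal f)) := by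
      simpa using continuous_convolution_integrand h B 0 (hcont f)
    rw [Metric.tendsto_nhds]
    intro ε hε
    have h1 := hF.tendsto ((0 : ℝ), (0 : ℝ))
    simp only [sub_self, Real.toNNReal_zero, h.map_zero, hzero,
      ContinuousLinearMap.id_apply] at h1
    obtain ⟨η, hη, hη2⟩ := Metric.tendsto_nhds_nhds.1 h1 (ε / 2) (by positivity)
    have hlt : ∀ᶠ t : ℝ≥0 in 𝓝[>] 0, (t : ℝ) < η :=
      nhdsWithin_le_nhds ((NNReal.continuous_coe.tendsto 0).eventually_lt_const (by simpa using hη))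
    filter_upwards [self_mem_nhdsWithin, hlt] with t ht htη
    have ht' : (0 : ℝ) < t := by simpa using ht
    have e1 := mild f t
    simp only at e1
    rw [e1, add_sub_cancel_left, dist_eq_norm]
    have e2 : B f = (t : ℝ)⁻¹ • ∫ _ in (0 : ℝ)..t, B f := by
      simp [smul_smul, inv_mul_cancel₀ ht'.ne']
    rw [e2, ← smul_sub, ← intervalIntegral.integral_sub ((hint f t).intervalIntegrable _ _)
      (by simp), norm_smul, norm_inv, Real.norm_eq_abs, abs_of_pos ht']
    have e3 := intervalIntegral.norm_integral_le_of_norm_le_const (a := 0) (b := (t : ℝ))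
      (C := ε / 2) (f := fun s => S (t - s : ℝ).toNNReal (B (S' s.toNNReal f)) - B f) (by
        intro s hs
        rw [uIoc_of_le ht'.le] at hs
        rw [← dist_eq_norm]
        refine (hη2 (x := ((t : ℝ), s)) ?_).le
        rw [Prod.dist_eq]
        simp only [dist_zero_right, Real.norm_eq_abs]
        rw [abs_of_pos ht', abs_of_pos hs.1]
        exact max_lt htη (hs.2.trans_lt htη))
    rw [sub_zero, abs_of_pos ht'] at e3
    calc _ ≤ (t : ℝ)⁻¹ * (ε / 2 * t) := by gcongr
      _ = ε / 2 := by field_simp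
      _ < ε := by linarith
  exact ⟨S', h.of_perturbation B hzero hadd hcont hdiff, mild, hdiff⟩

end Perturbation

end Semigroup

/-! ## Operators on `Lp` spaces induced by operators on functions -/

section LpOperators

variable {α : Type*} [MeasurableSpace α] {μ : Measure α} {q : ℝ≥0∞}

/-- `Op` acts on functions as a linear operator of norm at most `C` on `L^q`. -/
structure IsLpOp (Op : (α → ℝ) → α → ℝ) (C : ℝ) (q : ℝ≥0∞) (μ : Measure α) : Prop where
  nonneg : 0 ≤ C
  congr : ∀ f g, f =ᵐ[μ] g → Op f =ᵐ[μ] Op g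
  aesm : ∀ f, MemLp f q μ → AEStronglyMeasurable (Op f) μ
  bound : ∀ f, MemLp f q μ → eLpNorm (Op f) q μ ≤ ENNReal.ofReal C * eLpNorm f q μ
  add : ∀ f g, MemLp f q μ → MemLp g q μ → Op (f + g) =ᵐ[μ] Op f + Op g
  smul : ∀ (c : ℝ) f, MemLp f q μ → Op (c • f) =ᵐ[μ] c • Op f

variable {Op : (α → ℝ) → α → ℝ} {C : ℝ}

theorem IsLpOp.memLp (h : IsLpOp Op C q μ) {f : α → ℝ} (hf : MemLp f q μ) : MemLp (Op f) q μ :=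
  ⟨h.aesm f hf, (h.bound f hf).trans_lt (ENNReal.mul_lt_top ENNReal.ofReal_lt_top hf.2)⟩

/-- The bounded operator on `L^q` given by an operator on functions. -/
def opLp [Fact (1 ≤ q)] (h : IsLpOp Op C q μ) : Lp ℝ q μ →L[ℝ] Lp ℝ q μ :=
  LinearMap.mkContinuous
    { toFun := fun f => (h.memLp (Lp.memLp f)).toLp (Op f)
      map_add' := fun f g => by
        rw [← MemLp.toLp_add (h.memLp (Lp.memLp f)) (h.memLp (Lp.memLp g))]
        exact MemLp.toLp_congr _ _ ((h.congr _ _ (Lp.coeFn_add f g)).trans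
          (h.add _ _ (Lp.memLp f) (Lp.memLp g)))
      map_smul' := fun c f => by
        rw [RingHom.id_apply, ← MemLp.toLp_const_smul c (h.memLp (Lp.memLp f))]
        exact MemLp.toLp_congr _ _ ((h.congr _ _ (Lp.coeFn_smul c f)).trans
          (h.smul c _ (Lp.memLp f))) }
    C (fun f => by
      change ‖(h.memLp (Lp.memLp f)).toLp (Op f)‖ ≤ _
      rw [Lp.norm_toLp _ (h.memLp (Lp.memLp f)), Lp.norm_def]
      have := ENNReal.toReal_mono (ENNReal.mul_ne_top ENNReal.ofReal_ne_top (Lp.memLp f).2.ne)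
        (h.bound f (Lp.memLp f))
      rwa [ENNReal.toReal_mul, ENNReal.toReal_ofReal h.nonneg] at this)

theorem coeFn_opLp [Fact (1 ≤ q)] (h : IsLpOp Op C q μ) (f : Lp ℝ q μ) :
    opLp h f =ᵐ[μ] Op f :=
  MemLp.coeFn_toLp (h.memLp (Lp.memLp f))

theorem norm_opLp_le [Fact (1 ≤ q)] (h : IsLpOp Op C q μ) : ‖opLp h‖ ≤ C :=
  LinearMap.mkContinuous_norm_le _ h.nonneg _

/-- The exponent `q ∈ [1, ∞)` is the natural number `p`. -/
class IsNatExponent (q : ℝ≥0∞) (p : ℕ) : Prop where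
  eq : q = p
  one_le : 1 ≤ p

instance : IsNatExponent 1 1 := ⟨by simp, le_rfl⟩
instance : IsNatExponent 2 2 := ⟨by simp, by norm_num⟩

theorem eLpNorm_pow_eq_lintegral {p : ℕ} (hq : IsNatExponent q p) (F : α → ℝ) :
    eLpNorm F q μ ^ p = ∫⁻ z, ‖F z‖ₑ ^ p ∂μ := by
  have hp : p ≠ 0 := Nat.one_le_iff_ne_zero.1 hq.one_le
  rw [hq.eq, eLpNorm_eq_lintegral_rpow_enorm_toReal (by exact_mod_cast hp) (by simp)]
  simp only [ENNReal.toReal_natCast, ENNReal.rpow_natCast]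
  rw [← ENNReal.rpow_natCast, ← ENNReal.rpow_mul, one_div, inv_mul_cancel₀ (by exact_mod_cast hp),
    ENNReal.rpow_one]

/-- Dominated convergence for the `p`-th powers, followed by a `p`-th root. -/
theorem tendsto_eLpNorm_zero_of_dominated {p : ℕ} (hq : IsNatExponent q p) {ι : Type*}
    {l : Filter ι} [l.IsCountablyGenerated] (F : ι → α → ℝ) (b : α → ℝ)
    (hF : ∀ i, AEStronglyMeasurable (F i) μ) (hb : MemLp b q μ)
    (h : ∀ᶠ i in l, ∀ᵐ z ∂μ, |F i z| ≤ b z) (hl : ∀ᵐ z ∂μ, Tendsto (fun i => F i z) l (𝓝 0)) :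
    Tendsto (fun i => eLpNorm (F i) q μ) l (𝓝 0) := by
  have hp : p ≠ 0 := Nat.one_le_iff_ne_zero.1 hq.one_le
  have key : Tendsto (fun i => ∫⁻ z, ‖F i z‖ₑ ^ p ∂μ) l (𝓝 (∫⁻ _, 0 ∂μ)) := by
    refine tendsto_lintegral_filter_of_dominated_convergence' (fun z => ‖b z‖ₑ ^ p)
      (Eventually.of_forall fun i => (hF i).enorm.pow_const p) ?_ ?_ ?_
    · filter_upwards [h] with i hi
      filter_upwards [hi] with z hz
      gcongr
      rw [enorm_le_iff_norm_le, Real.norm_eq_abs]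
      exact hz.trans (le_abs_self _)
    · rw [← eLpNorm_pow_eq_lintegral hq]
      exact ENNReal.pow_ne_top hb.2.ne
    · filter_upwards [hl] with z hz
      have := ((continuous_enorm.tendsto (0 : ℝ)).comp hz)
      have := (ENNReal.continuous_pow p).tendsto _ |>.comp this
      simpa [hp, Function.comp_def] using this
  simp only [lintegral_zero, ← eLpNorm_pow_eq_lintegral hq] at key
  have h2 := (ENNReal.continuous_rpow_const (y := ((p : ℝ)⁻¹))).tendsto 0 |>.comp key
  have hp' : (p : ℝ) ≠ 0 := by exact_mod_cast hp
  rw [ENNReal.zero_rpow_of_pos (by positivity)] at h2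
  refine h2.congr fun i => ?_
  simp only [Function.comp]
  rw [← ENNReal.rpow_natCast, ← ENNReal.rpow_mul, mul_inv_cancel₀ hp', ENNReal.rpow_one]

end LpOperators

/-! ### The exponential weight under translations -/

section Weight

variable {d : ℕ} {γ : ℝ}

theorem weight_pos (x : E d) : 0 < weight γ x := Real.exp_pos _

theorem one_le_weight (hγ : 0 ≤ γ) (x : E d) : 1 ≤ weight γ x :=
  Real.one_le_exp (by positivity)

theorem continuous_weight : Continuous (weight γ : E d → ℝ) := by
  unfold weight; fun_prop

theorem one_le_japanese (x : E d) : 1 ≤ √(1 + ‖x‖ ^ 2) :=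
  Real.one_le_sqrt.2 (by nlinarith [sq_nonneg ‖x‖])

theorem norm_le_japanese (x : E d) : ‖x‖ ≤ √(1 + ‖x‖ ^ 2) :=
  Real.le_sqrt_of_sq_le (by linarith)

theorem japanese_add_le (x y : E d) : √(1 + ‖x + y‖ ^ 2) ≤ √(1 + ‖x‖ ^ 2) + ‖y‖ := by
  rw [Real.sqrt_le_left (by positivity)]
  have h1 := norm_add_le x y
  have h2 := norm_le_japanese x
  have h3 : √(1 + ‖x‖ ^ 2) ^ 2 = 1 + ‖x‖ ^ 2 := Real.sq_sqrt (by positivity)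
  have h4 : ‖x + y‖ ^ 2 ≤ (‖x‖ + ‖y‖) ^ 2 := by gcongr
  nlinarith [norm_nonneg y, norm_nonneg x]

/-- Since `⟨x⟩` is 1-Lipschitz, transport for a time `t` costs at most `exp (γ V₀ t)` in the
weighted norms. -/
theorem weight_add_le (hγ : 0 ≤ γ) (x y : E d) :
    weight γ (x + y) ≤ Real.exp (γ * ‖y‖) * weight γ x := by
  unfold weight
  rw [← Real.exp_add]
  refine Real.exp_le_exp.2 ?_
  nlinarith [japanese_add_le x y]

end Weight

/-! ## The weighted phase space, transport and averaging -/

section PhaseSpace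

variable {d : ℕ} {V₀ γ : ℝ} {q : ℝ≥0∞} {p : ℕ}

/-- The uniform measure on the velocity ball. -/
abbrev velMeasure (d : ℕ) (V₀ : ℝ) : Measure (E d) := volume.restrict (Metric.ball 0 V₀)

instance : IsFiniteMeasure (velMeasure d V₀) := ⟨by
  rw [Measure.restrict_apply_univ]; exact measure_ball_lt_top⟩

instance : IsLocallyFiniteMeasure (phaseMeasure d V₀) := by unfold phaseMeasure; infer_instance

instance : IsLocallyFiniteMeasure (weightedMeasure d V₀ γ p) :=
  IsLocallyFiniteMeasure.withDensity_ofReal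
    (f := fun z : E d × E d => weight γ z.1 ^ p) ((continuous_weight.comp continuous_fst).pow p)

theorem ae_weighted : ae (weightedMeasure d V₀ γ p) = ae (phaseMeasure d V₀) :=
  le_antisymm (withDensity_absolutelyContinuous _ _).ae_le (phaseMeasure_ac d V₀ γ p).ae_le

theorem aesm_weighted_iff {F : E d × E d → ℝ} :
    AEStronglyMeasurable F (weightedMeasure d V₀ γ p) ↔
      AEStronglyMeasurable F (phaseMeasure d V₀) :=
  ⟨fun h => h.mono_ac (phaseMeasure_ac d V₀ γ p),
    fun h => h.mono_ac (withDensity_absolutelyContinuous _ _)⟩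

theorem ae_velocity_lt : ∀ᵐ z ∂phaseMeasure d V₀, ‖z.2‖ < V₀ := by
  have : ∀ᵐ v ∂velMeasure d V₀, ‖v‖ < V₀ := by
    filter_upwards [ae_restrict_mem measurableSet_ball] with v hv using by simpa using hv
  exact Measure.quasiMeasurePreserving_snd.ae this

theorem measurable_weight_fst : Measurable fun z : E d × E d => weight γ z.1 :=
  (continuous_weight.comp continuous_fst).measurable

theorem eLpNorm_weighted (hq : IsNatExponent q p) (F : E d × E d → ℝ) :
    eLpNorm F q (weightedMeasure d V₀ γ p)
      = eLpNorm (fun z => weight γ z.1 * F z) q (phaseMeasure d V₀) := by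
  have hp : p ≠ 0 := Nat.one_le_iff_ne_zero.1 hq.one_le
  have h : eLpNorm F q (weightedMeasure d V₀ γ p) ^ p
      = eLpNorm (fun z => weight γ z.1 * F z) q (phaseMeasure d V₀) ^ p := by
    rw [eLpNorm_pow_eq_lintegral hq, eLpNorm_pow_eq_lintegral hq, weightedMeasure,
      lintegral_withDensity_eq_lintegral_mul_non_measurable _
        (measurable_weight_fst.pow_const p).ennreal_ofReal (by simp)]
    refine lintegral_congr fun z => ?_
    rw [Pi.mul_apply, enorm_mul, mul_pow, ENNReal.ofReal_pow (weight_pos _).le,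
      Real.enorm_of_nonneg (weight_pos z.1).le]
  exact (ENNReal.pow_right_strictMono hp).injective h

theorem memLp_weighted_iff (hq : IsNatExponent q p) {F : E d × E d → ℝ} :
    MemLp F q (weightedMeasure d V₀ γ p) ↔
      MemLp (fun z => weight γ z.1 * F z) q (phaseMeasure d V₀) := by
  rw [MemLp, MemLp, eLpNorm_weighted hq, aesm_weighted_iff]
  refine and_congr_left fun _ => ⟨fun h => ?_, fun h => ?_⟩
  · exact measurable_weight_fst.aestronglyMeasurable.mul h
  · refine (measurable_weight_fst (γ := γ).inv.aestronglyMeasurable.mul h).congr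
      (ae_of_all _ fun z => ?_)
    simp [(weight_pos (γ := γ) z.1).ne']

/-- The free flow `(x, v) ↦ (x + t v, v)`. -/
def flow (t : ℝ) (z : E d × E d) : E d × E d := (z.1 + t • z.2, z.2)

theorem flow_add (s t : ℝ) (z : E d × E d) : flow s (flow t z) = flow (s + t) z := by
  simp only [flow, Prod.mk.injEq, and_true]
  rw [add_smul]; abel

@[simp] theorem flow_zero (z : E d × E d) : flow 0 z = z := by simp [flow]

@[simp] theorem flow_snd (t : ℝ) (z : E d × E d) : (flow t z).2 = z.2 := rfl

theorem continuous_flow (t : ℝ) : Continuous (flow t : E d × E d → E d × E d) := by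
  unfold flow; fun_prop

/-- For each fixed velocity the flow translates the position; swapping the factors exhibits it as a
skew product over `v`. -/
theorem measurePreserving_flow (t : ℝ) :
    MeasurePreserving (flow t) (phaseMeasure d V₀) (phaseMeasure d V₀) := by
  have h1 : MeasurePreserving (fun z : E d × E d => (z.1, z.2 + t • z.1))
      ((velMeasure d V₀).prod volume) ((velMeasure d V₀).prod volume) := by
    refine MeasurePreserving.skew_product (g := fun v x => x + t • v) (MeasurePreserving.id _) ?_ ?_
    · exact (by fun_prop : Continuous fun z : E d × E d => z.2 + t • z.1).measurable
    · exact ae_of_all _ fun v => (measurePreserving_add_right volume (t • v)).map_eq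
  have h2 : MeasurePreserving Prod.swap ((volume : Measure (E d)).prod (velMeasure d V₀))
    ((velMeasure d V₀).prod volume) := Measure.measurePreserving_swap
  have h3 : MeasurePreserving Prod.swap ((velMeasure d V₀).prod (volume : Measure (E d)))
    (Measure.prod volume (velMeasure d V₀)) := Measure.measurePreserving_swap
  exact h3.comp (h1.comp h2)

/-- Weighted composition with the backward flow. -/
def transportOp (t : ℝ) (M : E d × E d → ℝ) (f : E d × E d → ℝ) (z : E d × E d) : ℝ :=
  M z * f (flow (-t) z)

theorem ae_flow {P : E d × E d → Prop} (t : ℝ) (h : ∀ᵐ z ∂phaseMeasure d V₀, P z) :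
    ∀ᵐ z ∂phaseMeasure d V₀, P (flow t z) :=
  (measurePreserving_flow t).quasiMeasurePreserving.ae h

theorem isLpOp_transport (hq : IsNatExponent q p) (hγ : 0 ≤ γ) {A : ℝ} (hA : 0 ≤ A) (t : ℝ)
    {M : E d × E d → ℝ} (hM : Measurable M) (hMA : ∀ z, ‖z.2‖ < V₀ → |M z| ≤ A) :
    IsLpOp (transportOp t M) (Real.exp (γ * (|t| * V₀)) * A) q (weightedMeasure d V₀ γ p) where
  nonneg := by positivity
  congr := fun f g h => by
    rw [EventuallyEq, ae_weighted] at h ⊢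
    filter_upwards [ae_flow (-t) h] with z hz
    simp only [transportOp, hz]
  aesm := fun f hf => by
    rw [aesm_weighted_iff]
    exact hM.aestronglyMeasurable.mul ((aesm_weighted_iff.1 hf.1).comp_measurePreserving
      (measurePreserving_flow (-t)))
  bound := fun f hf => by
    have h1 : AEStronglyMeasurable (fun z => weight γ z.1 * f z) (phaseMeasure d V₀) :=
      measurable_weight_fst.aestronglyMeasurable.mul (aesm_weighted_iff.1 hf.1)
    rw [eLpNorm_weighted hq, eLpNorm_weighted hq,
      ← eLpNorm_comp_measurePreserving h1 (measurePreserving_flow (-t))]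
    refine eLpNorm_le_mul_eLpNorm_of_ae_le_mul ?_ q
    filter_upwards [ae_velocity_lt] with z hz
    have h2 : weight γ z.1 ≤ Real.exp (γ * (|t| * V₀)) * weight γ (flow (-t) z).1 := by
      have := weight_add_le hγ (flow (-t) z).1 (t • z.2)
      have e : (flow (-t) z).1 + t • z.2 = z.1 := by simp [flow]
      rw [e] at this
      refine this.trans ?_
      have := weight_pos (γ := γ) (flow (-t) z).1
      gcongr
      rw [norm_smul, Real.norm_eq_abs]
      gcongr
    have h3 := weight_pos (γ := γ) z.1
    have h4 := weight_pos (γ := γ) (flow (-t) z).1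
    simp only [Real.norm_eq_abs, transportOp, Function.comp, abs_mul, abs_of_pos h3,
      abs_of_pos h4]
    calc weight γ z.1 * (|M z| * |f (flow (-t) z)|)
        ≤ (Real.exp (γ * (|t| * V₀)) * weight γ (flow (-t) z).1) * (A * |f (flow (-t) z)|) := by
          gcongr; exact hMA z hz
      _ = _ := by ring
  add := fun f g _ _ => ae_of_all _ fun z => by simp [transportOp, mul_add]
  smul := fun c f _ => ae_of_all _ fun z => by simp [transportOp, mul_left_comm]

variable (hV₀ : volume (Metric.ball (0 : E d) V₀) = 1)

include hV₀ in
theorem isProbabilityMeasure_velMeasure : IsProbabilityMeasure (velMeasure d V₀) :=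
  ⟨by rw [Measure.restrict_apply_univ, hV₀]⟩

theorem ae_memLp_fiber (hq : IsNatExponent q p) {f : E d × E d → ℝ}
    (hf : MemLp f q (weightedMeasure d V₀ γ p)) :
    ∀ᵐ x, MemLp (fun v => f (x, v)) q (velMeasure d V₀) := by
  have hp : p ≠ 0 := Nat.one_le_iff_ne_zero.1 hq.one_le
  rw [memLp_weighted_iff hq] at hf
  have h1 := hf.2
  have h2 : ∫⁻ z, ‖weight γ z.1 * f z‖ₑ ^ p ∂phaseMeasure d V₀ ≠ ⊤ := by
    rw [← eLpNorm_pow_eq_lintegral hq]; exact ENNReal.pow_ne_top h1.ne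
  rw [phaseMeasure, lintegral_prod _ (hf.1.enorm.pow_const p)] at h2
  have h3 := ae_lt_top' ((hf.1.enorm.pow_const p).lintegral_prod_right') h2
  filter_upwards [h3, hf.1.prodMk_left] with x hx hm
  have h4 : MemLp (fun v => weight γ x * f (x, v)) q (velMeasure d V₀) := by
    refine ⟨hm, ?_⟩
    rw [← eLpNorm_pow_eq_lintegral hq] at hx
    exact (ENNReal.pow_lt_top_iff.1 hx).resolve_right hp
  simpa [(weight_pos (γ := γ) x).ne'] using h4.const_mul (weight γ x)⁻¹

theorem ae_integrable_fiber (hq : IsNatExponent q p) {f : E d × E d → ℝ}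
    (hf : MemLp f q (weightedMeasure d V₀ γ p)) :
    ∀ᵐ x, Integrable (fun v => f (x, v)) (velMeasure d V₀) := by
  filter_upwards [ae_memLp_fiber hq hf] with x hx
  exact hx.integrable (by rw [hq.eq]; exact_mod_cast hq.one_le)

theorem ae_fst {P : E d → Prop} (h : ∀ᵐ x, P x) : ∀ᵐ z ∂phaseMeasure d V₀, P z.1 :=
  Measure.quasiMeasurePreserving_fst.ae h

theorem average_congr {κ : E d → E d → ℝ} {f g : E d × E d → ℝ} (h : f =ᵐ[phaseMeasure d V₀] g) :
    average V₀ κ f =ᵐ[phaseMeasure d V₀] average V₀ κ g := by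
  refine ae_fst (P := fun x => average V₀ κ f (x, 0) = average V₀ κ g (x, 0)) ?_
  filter_upwards [Measure.ae_ae_of_ae_prod h] with x hx
  refine integral_congr_ae ?_
  filter_upwards [hx] with v hv
  simp only [hv]

theorem aesm_average {κ : E d → E d → ℝ}
    (hκ : AEStronglyMeasurable (fun z : E d × E d => κ z.1 z.2) (phaseMeasure d V₀))
    {f : E d × E d → ℝ} (hf : AEStronglyMeasurable f (phaseMeasure d V₀)) :
    AEStronglyMeasurable (average V₀ κ f) (phaseMeasure d V₀) :=
  ((hκ.mul hf).integral_prod_right' (μ := volume) (ν := velMeasure d V₀)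
    ).comp_quasiMeasurePreserving
    Measure.quasiMeasurePreserving_fst

theorem ae_fiber_kernel {κ : E d → E d → ℝ} {A : ℝ}
    (hκ : AEStronglyMeasurable (fun z : E d × E d => κ z.1 z.2) (phaseMeasure d V₀))
    (hκA : ∀ x v, ‖v‖ < V₀ → |κ x v| ≤ A) :
    ∀ᵐ x, AEStronglyMeasurable (κ x) (velMeasure d V₀) ∧ ∀ᵐ v ∂velMeasure d V₀, ‖κ x v‖ ≤ A := by
  filter_upwards [hκ.prodMk_left] with x hx
  refine ⟨hx, ?_⟩
  filter_upwards [ae_restrict_mem measurableSet_ball] with v hv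
  exact hκA x v (by simpa using hv)

theorem ae_integrable_kernel_mul (hq : IsNatExponent q p) {κ : E d → E d → ℝ} {A : ℝ}
    (hκ : AEStronglyMeasurable (fun z : E d × E d => κ z.1 z.2) (phaseMeasure d V₀))
    (hκA : ∀ x v, ‖v‖ < V₀ → |κ x v| ≤ A) {f : E d × E d → ℝ}
    (hf : MemLp f q (weightedMeasure d V₀ γ p)) :
    ∀ᵐ x, Integrable (fun v => κ x v * f (x, v)) (velMeasure d V₀) := by
  filter_upwards [ae_integrable_fiber hq hf, ae_fiber_kernel hκ hκA] with x hx hk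
  exact hx.bdd_mul hk.1 hk.2

include hV₀ in
-- The velocity ball has unit volume, so on each fibre the `L¹` norm is below the `L^q` norm. The
-- weight depends on `x` alone and passes through the average.
theorem isLpOp_average (hq : IsNatExponent q p) {κ : E d → E d → ℝ} {A : ℝ} (hA : 0 ≤ A)
    (hκ : AEStronglyMeasurable (fun z : E d × E d => κ z.1 z.2) (phaseMeasure d V₀))
    (hκA : ∀ x v, ‖v‖ < V₀ → |κ x v| ≤ A) :
    IsLpOp (average V₀ κ) A q (weightedMeasure d V₀ γ p) where
  nonneg := hA
  congr := fun f g h => by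
    rw [EventuallyEq, ae_weighted] at h ⊢
    exact average_congr h
  aesm := fun f hf => by
    rw [aesm_weighted_iff]
    exact aesm_average hκ (aesm_weighted_iff.1 hf.1)
  bound := fun f hf => by
    have hp : p ≠ 0 := Nat.one_le_iff_ne_zero.1 hq.one_le
    have := isProbabilityMeasure_velMeasure hV₀
    rw [eLpNorm_weighted hq, eLpNorm_weighted hq]
    have hf' := (memLp_weighted_iff hq).1 hf
    refine (ENNReal.pow_right_strictMono hp).le_iff_le.1 ?_
    rw [mul_pow, eLpNorm_pow_eq_lintegral hq, eLpNorm_pow_eq_lintegral hq, phaseMeasure,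
      lintegral_prod _ (hf'.1.enorm.pow_const p), lintegral_prod _ (by
        have h1 := aesm_average hκ (aesm_weighted_iff.1 hf.1)
        exact ((measurable_weight_fst.aestronglyMeasurable.mul h1).enorm.pow_const p)),
      ← lintegral_const_mul' _ _ (ENNReal.pow_ne_top ENNReal.ofReal_ne_top)]
    refine lintegral_mono_ae ?_
    filter_upwards [hf'.1.prodMk_left] with x hx
    have e : ∀ v : E d, average V₀ κ f (x, v) = average V₀ κ f (x, 0) := fun _ => rfl
    simp only [e, lintegral_const, measure_univ, mul_one]
    rw [← eLpNorm_pow_eq_lintegral hq, ← mul_pow]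
    gcongr
    have h1 : eLpNorm (fun v => weight γ x * f (x, v)) 1 (velMeasure d V₀)
        ≤ eLpNorm (fun v => weight γ x * f (x, v)) q (velMeasure d V₀) :=
      eLpNorm_le_eLpNorm_of_exponent_le (by rw [hq.eq]; exact_mod_cast hq.one_le) hx
    refine le_trans ?_ (mul_le_mul_right h1 _)
    rw [eLpNorm_one_eq_lintegral_enorm, ← lintegral_const_mul' _ _ ENNReal.ofReal_ne_top]
    rw [average, ← integral_const_mul]
    refine (enorm_integral_le_lintegral_enorm _).trans (lintegral_mono_ae ?_)
    filter_upwards [ae_restrict_mem measurableSet_ball] with v hv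
    rw [mul_left_comm, enorm_mul]
    gcongr
    rw [← Real.enorm_of_nonneg hA, enorm_le_iff_norm_le, Real.norm_eq_abs, Real.norm_eq_abs,
      abs_of_nonneg hA]
    exact hκA x v (by simpa using hv)
  add := fun f g hf hg => by
    rw [EventuallyEq, ae_weighted]
    refine ae_fst (P := fun x => average V₀ κ (f + g) (x, 0)
      = (average V₀ κ f + average V₀ κ g) (x, 0)) ?_
    filter_upwards [ae_integrable_kernel_mul hq hκ hκA hf,
      ae_integrable_kernel_mul hq hκ hκA hg] with x h1 h2
    simp only [average, Pi.add_apply, mul_add]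
    exact integral_add h1 h2
  smul := fun c f _ => ae_of_all _ fun z => by
    simp only [average, Pi.smul_apply, smul_eq_mul, mul_left_comm _ c, integral_const_mul]

end PhaseSpace

/-! ### Criteria for strong continuity -/

section Orbits

variable {Z : Type*} [NormedAddCommGroup Z] [NormedSpace ℝ Z] {S : ℝ≥0 → Z →L[ℝ] Z}

/-- A locally bounded semigroup whose orbits are continuous at `0` is strongly continuous. -/
theorem continuous_orbit_of_tendsto_zero {a : ℝ} (ha : 0 ≤ a)
    (map_add : ∀ s t, S (s + t) = (S s).comp (S t))
    (bound : ∀ t, ‖S t‖ ≤ Real.exp (a * t)) (f : Z) (h : Tendsto (fun t => S t f) (𝓝 0) (𝓝 f)) :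
    Continuous fun t => S t f := by
  rw [continuous_iff_continuousAt]
  intro t₀
  rw [ContinuousAt, tendsto_iff_norm_sub_tendsto_zero]
  have hd : Tendsto (fun t : ℝ≥0 => nndist t t₀) (𝓝 t₀) (𝓝 0) := by
    have : Continuous fun t : ℝ≥0 => nndist t t₀ := by fun_prop
    simpa using this.tendsto t₀
  have h1 := ((tendsto_iff_norm_sub_tendsto_zero.1 (h.comp hd)).const_mul
    (Real.exp (a * (t₀ + 1 : ℝ≥0))))
  rw [mul_zero] at h1
  refine squeeze_zero' (Eventually.of_forall fun _ => norm_nonneg _) ?_ h1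
  have key : ∀ s r : ℝ≥0, s ≤ t₀ + 1 → ‖S (s + r) f - S s f‖
      ≤ Real.exp (a * (t₀ + 1 : ℝ≥0)) * ‖S r f - f‖ := by
    intro s r hs
    rw [map_add]
    simp only [ContinuousLinearMap.comp_apply]
    rw [← map_sub]
    refine (S s).le_of_opNorm_le ((bound s).trans (Real.exp_le_exp.2 ?_)) _
    exact mul_le_mul_of_nonneg_left (NNReal.coe_le_coe.2 hs) ha
  filter_upwards [gt_mem_nhds (show t₀ < t₀ + 1 by simp)] with t ht
  simp only [Function.comp]
  rcases le_total t t₀ with h2 | h2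
  · have e : t + nndist t t₀ = t₀ := by
      rw [NNReal.nndist_eq, tsub_eq_zero_of_le h2, max_eq_right zero_le, add_tsub_cancel_of_le h2]
    have := key t (nndist t t₀) ht.le
    rw [e] at this
    rwa [norm_sub_rev]
  · have e : t₀ + nndist t t₀ = t := by
      rw [NNReal.nndist_eq, tsub_eq_zero_of_le h2, max_eq_left zero_le, add_tsub_cancel_of_le h2]
    have := key t₀ (nndist t t₀) (by simp)
    rwa [e] at this

/-- Convergence to the identity extends from a dense set. -/
theorem tendsto_id_of_dense {ι : Type*} {l : Filter ι} {A : ι → Z →L[ℝ] Z} {M : ℝ} (hM : 0 ≤ M)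
    (bound : ∀ᶠ i in l, ‖A i‖ ≤ M) {D : Set Z} (hD : Dense D)
    (h : ∀ g ∈ D, Tendsto (fun i => A i g) l (𝓝 g)) (f : Z) :
    Tendsto (fun i => A i f) l (𝓝 f) := by
  rw [Metric.tendsto_nhds]
  intro ε hε
  obtain ⟨g, hg, hgf⟩ := Metric.mem_closure_iff.1 (hD f) (ε / (2 * (M + 1))) (by positivity)
  filter_upwards [bound, Metric.tendsto_nhds.1 (h g hg) (ε / 2) (by positivity)] with i h1 h2
  have h3 : dist (A i f) (A i g) ≤ M * dist f g := by
    rw [dist_eq_norm, dist_eq_norm, ← map_sub]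
    exact (A i).le_of_opNorm_le h1 _
  have h4 : (M + 1) * dist f g < ε / 2 := by
    rw [lt_div_iff₀ (by positivity)] at hgf
    linarith
  calc dist (A i f) f ≤ dist (A i f) (A i g) + dist (A i g) g + dist g f := dist_triangle4 _ _ _ _
    _ < ε := by rw [dist_comm g f]; linarith

end Orbits

/-! ## Damped free transport -/

section Damping

variable {d : ℕ} {V₀ γ χ : ℝ}

/-- The potential whose increments along the flow are the collision rates. -/
def collisionPotential (χ : ℝ) (z : E d × E d) : ℝ := χ * |inner ℝ z.1 z.2| / ‖z.2‖ ^ 2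

/-- Damping along the backward characteristics, with constant rate `c` and turning rate
`χ sign (x · v)`. -/
def damping (c χ t : ℝ) (z : E d × E d) : ℝ :=
  Real.exp (-c * t - collisionPotential χ z + collisionPotential χ (flow (-t) z))

theorem inner_flow (t : ℝ) (z : E d × E d) :
    inner ℝ (flow t z).1 (flow t z).2 = inner ℝ z.1 z.2 + t * ‖z.2‖ ^ 2 := by
  simp [flow, inner_add_left, inner_smul_left]

theorem collisionPotential_flow (χ t : ℝ) (z : E d × E d) :
    collisionPotential χ (flow t z) = χ * |inner ℝ z.1 z.2 + t * ‖z.2‖ ^ 2| / ‖z.2‖ ^ 2 := by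
  rw [collisionPotential, inner_flow, flow_snd]

/-- Along the flow `x·v` changes by `t|v|²`, which the denominator of the potential cancels. At `v =
0` division by zero makes the potential vanish, which is consistent. -/
theorem abs_collisionPotential_flow_sub_le (hχ : 0 ≤ χ) (t : ℝ) (z : E d × E d) :
    |collisionPotential χ (flow t z) - collisionPotential χ z| ≤ χ * |t| := by
  rw [collisionPotential_flow, collisionPotential]
  rcases eq_or_ne z.2 0 with h | h
  · simp only [h, norm_zero]; simp; positivity
  have h1 : 0 < ‖z.2‖ ^ 2 := by positivity
  rw [← sub_div, ← mul_sub, abs_div, abs_mul, abs_of_nonneg hχ, abs_of_pos h1, div_le_iff₀ h1,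
    mul_assoc]
  refine mul_le_mul_of_nonneg_left ?_ hχ
  have := abs_abs_sub_abs_le_abs_sub (inner ℝ z.1 z.2 + t * ‖z.2‖ ^ 2) (inner ℝ z.1 z.2)
  rwa [add_sub_cancel_left, abs_mul, abs_of_pos h1] at this

theorem damping_pos (c t : ℝ) (z : E d × E d) : 0 < damping c χ t z := Real.exp_pos _

theorem damping_le (hχ : 0 ≤ χ) (c : ℝ) {t : ℝ} (ht : 0 ≤ t) (z : E d × E d) :
    damping c χ t z ≤ Real.exp (-(c - χ) * t) := by
  have := (abs_le.1 (abs_collisionPotential_flow_sub_le hχ (-t) z)).2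
  rw [abs_neg, abs_of_nonneg ht] at this
  exact Real.exp_le_exp.2 (by linarith)

theorem le_damping (hχ : 0 ≤ χ) (c : ℝ) {t : ℝ} (ht : 0 ≤ t) (z : E d × E d) :
    Real.exp (-(c + χ) * t) ≤ damping c χ t z := by
  have := (abs_le.1 (abs_collisionPotential_flow_sub_le hχ (-t) z)).1
  rw [abs_neg, abs_of_nonneg ht] at this
  exact Real.exp_le_exp.2 (by linarith)

@[simp] theorem damping_zero (c : ℝ) (z : E d × E d) : damping c χ 0 z = 1 := by
  simp [damping]

/-- The potential increments telescope, which gives the cocycle identity behind the semigroup law.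
-/
theorem damping_add (c s t : ℝ) (z : E d × E d) :
    damping c χ (s + t) z = damping c χ s z * damping c χ t (flow (-s) z) := by
  rw [damping, damping, damping, ← Real.exp_add, flow_add]
  congr 1
  rw [show -t + -s = -(s + t) by ring]
  ring

theorem measurable_collisionPotential : Measurable (collisionPotential χ : E d × E d → ℝ) := by
  unfold collisionPotential
  fun_prop

theorem measurable_damping (c t : ℝ) : Measurable (damping c χ t : E d × E d → ℝ) := by
  unfold damping
  have h1 := measurable_collisionPotential (d := d) (χ := χ)
  have h2 := h1.comp (continuous_flow (d := d) (-t)).measurable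
  exact Real.measurable_exp.comp ((measurable_const.sub h1).add h2)

theorem continuous_damping (c : ℝ) (z : E d × E d) : Continuous fun t => damping c χ t z := by
  unfold damping
  simp only [collisionPotential_flow]
  fun_prop

end Damping

section Evolution

variable {d : ℕ} {V₀ γ χ : ℝ} (q : ℝ≥0∞) (p : ℕ) [hqp : IsNatExponent q p]

theorem isLpOp_damping (hγ : 0 ≤ γ) (hχ : 0 ≤ χ) (c : ℝ) (t : ℝ≥0) :
    IsLpOp (transportOp t (damping c χ t))
      (Real.exp (γ * (|(t : ℝ)| * V₀)) * Real.exp (-(c - χ) * t)) q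
      (weightedMeasure d V₀ γ p) :=
  isLpOp_transport hqp hγ (Real.exp_nonneg _) t (measurable_damping c t) fun z _ => by
    rw [abs_of_pos (damping_pos _ _ _)]
    exact damping_le hχ c t.coe_nonneg z

variable [Fact (1 ≤ q)]

/-- The semigroup of the transport operator `- v · ∇ₓ - c - χ sign (x · v)`. -/
def evol (hγ : 0 ≤ γ) (hχ : 0 ≤ χ) (c : ℝ) (t : ℝ≥0) :
    Lp ℝ q (weightedMeasure d V₀ γ p) →L[ℝ] Lp ℝ q (weightedMeasure d V₀ γ p) :=
  opLp (isLpOp_damping q p hγ hχ c t)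

variable (hγ : 0 ≤ γ) (hχ : 0 ≤ χ) (c : ℝ)

variable {q p}

theorem coeFn_evol (t : ℝ≥0) (f : Lp ℝ q (weightedMeasure d V₀ γ p)) :
    evol q p hγ hχ c t f =ᵐ[phaseMeasure d V₀] transportOp t (damping c χ t) f := by
  have := coeFn_opLp (isLpOp_damping q p (d := d) (V₀ := V₀) hγ hχ c t) f
  rwa [EventuallyEq, ae_weighted] at this

theorem norm_evol_le (t : ℝ≥0) :
    ‖evol (d := d) (V₀ := V₀) q p hγ hχ c t‖ ≤ Real.exp (-(c - χ - γ * V₀) * t) := by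
  refine (norm_opLp_le _).trans (le_of_eq ?_)
  rw [← Real.exp_add, abs_of_nonneg t.coe_nonneg]
  congr 1; ring

theorem evol_zero : evol (d := d) (V₀ := V₀) q p hγ hχ c 0 = ContinuousLinearMap.id ℝ _ := by
  ext1 f
  refine Lp.ext ?_
  rw [EventuallyEq, ae_weighted]
  filter_upwards [coeFn_evol hγ hχ c 0 f] with z hz
  rw [hz]
  simp [transportOp]

theorem evol_add (s t : ℝ≥0) : evol (d := d) (V₀ := V₀) q p hγ hχ c (s + t)
    = (evol q p hγ hχ c s).comp (evol q p hγ hχ c t) := by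
  ext1 f
  refine Lp.ext ?_
  rw [EventuallyEq, ae_weighted]
  filter_upwards [coeFn_evol hγ hχ c (s + t) f, coeFn_evol hγ hχ c s (evol q p hγ hχ c t f),
    ae_flow (-s) (coeFn_evol hγ hχ c t f)] with z h1 h2 h3
  rw [h1, ContinuousLinearMap.comp_apply, h2, transportOp, transportOp, h3, transportOp]
  push_cast
  rw [damping_add, flow_add, mul_assoc, show -(t : ℝ) + -s = -(s + t) by ring]

theorem tendsto_Lp_of_eLpNorm_sub {α ι : Type*} [MeasurableSpace α] {μ : Measure α} {l : Filter ι}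
    {F : ι → Lp ℝ q μ} {f : Lp ℝ q μ}
    (h : Tendsto (fun i => eLpNorm (fun z => F i z - f z) q μ) l (𝓝 0)) :
    Tendsto F l (𝓝 f) :=
  Lp.tendsto_Lp_iff_tendsto_eLpNorm' F f |>.2 h

theorem tendsto_evol_zero_of_compact {g : E d × E d → ℝ} (hg : Continuous g)
    (hgc : HasCompactSupport g) {f : Lp ℝ q (weightedMeasure d V₀ γ p)}
    (hfg : f =ᵐ[weightedMeasure d V₀ γ p] g) :
    Tendsto (fun t => evol q p hγ hχ c t f) (𝓝 0) (𝓝 f) := by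
  refine tendsto_Lp_of_eLpNorm_sub ?_
  have e : ∀ t : ℝ≥0, (fun z => evol q p hγ hχ c t f z - f z) =ᵐ[weightedMeasure d V₀ γ p]
      fun z => damping c χ t z * g (flow (-t) z) - g z := fun t => by
    rw [EventuallyEq, ae_weighted] at hfg ⊢
    filter_upwards [hfg, ae_flow (-t) hfg, coeFn_evol hγ hχ c t f] with z h1 h2 h3
    rw [h3, h1, transportOp, h2]
  refine (tendsto_congr fun t => eLpNorm_congr_ae (e t)).2 ?_
  obtain ⟨B, hB⟩ := hg.bounded_above_of_compact_support hgc
  have hB0 : 0 ≤ B := (norm_nonneg _).trans (hB 0)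
  -- This compact set contains the support of every translate of `g` at times in `[0, 1]`, hence
  -- carries an integrable dominating function.
  set K : Set (E d × E d) := (fun y : ℝ × (E d × E d) => flow y.1 y.2) '' (Icc 0 1 ×ˢ tsupport g)
    with hK
  have hflow2 : Continuous fun y : ℝ × (E d × E d) => flow y.1 y.2 := by unfold flow; fun_prop
  have hKc : IsCompact K := (isCompact_Icc.prod hgc).image hflow2
  set D : ℝ := Real.exp (|c - χ|) * B + B
  have hD : 0 ≤ D := by positivity
  refine tendsto_eLpNorm_zero_of_dominated hqp _ (K.indicator fun _ => D) (fun t => ?_) ?_ ?_ ?_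
  · exact (((measurable_damping c t).mul (hg.comp (continuous_flow _)).measurable).sub
      hg.measurable).aestronglyMeasurable
  · exact memLp_indicator_const _ hKc.measurableSet _ (Or.inr hKc.measure_lt_top.ne)
  · filter_upwards [gt_mem_nhds (show (0 : ℝ≥0) < 1 by simp)] with t ht
    refine ae_of_all _ fun z => ?_
    have ht' : (t : ℝ) ≤ 1 := by exact_mod_cast ht.le
    by_cases hz : z ∈ K
    · rw [indicator_of_mem hz]
      refine (abs_sub _ _).trans (add_le_add ?_ (hB z))
      rw [abs_mul, abs_of_pos (damping_pos _ _ _)]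
      refine mul_le_mul ?_ (hB _) (abs_nonneg _) (Real.exp_nonneg _)
      refine (damping_le hχ c t.coe_nonneg z).trans (Real.exp_le_exp.2 ?_)
      have := neg_abs_le (c - χ)
      nlinarith [t.coe_nonneg, abs_nonneg (c - χ)]
    · rw [indicator_of_notMem hz]
      have h1 : g z = 0 := by
        by_contra h
        exact hz ⟨(0, z), ⟨⟨by simp, subset_tsupport _ h⟩, by simp⟩⟩
      have h2 : g (flow (-t) z) = 0 := by
        by_contra h
        refine hz ⟨(t, flow (-t) z), ⟨⟨⟨t.coe_nonneg, ht'⟩, subset_tsupport _ h⟩, ?_⟩⟩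
        simp [flow_add]
      simp [h1, h2]
  · refine ae_of_all _ fun z => ?_
    have h1 : Continuous fun t : ℝ≥0 => damping c χ t z * g (flow (-t) z) - g z := by
      refine Continuous.sub (Continuous.mul ((continuous_damping c z).comp
        NNReal.continuous_coe) (hg.comp ?_)) continuous_const
      unfold flow
      fun_prop
    simpa using h1.tendsto 0

theorem tendsto_evol_zero (f : Lp ℝ q (weightedMeasure d V₀ γ p)) :
    Tendsto (fun t => evol q p hγ hχ c t f) (𝓝 0) (𝓝 f) := by
  have hq : q ≠ ⊤ := by rw [hqp.eq]; simp
  refine tendsto_id_of_dense (M := Real.exp |(c - χ - γ * V₀)|) (Real.exp_nonneg _) ?_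
    (Lp.dense_hasCompactSupport_contDiff hq) ?_ f
  · filter_upwards [gt_mem_nhds (show (0 : ℝ≥0) < 1 by simp)] with t ht
    refine (norm_evol_le hγ hχ c t).trans (Real.exp_le_exp.2 ?_)
    have ht' : (t : ℝ) ≤ 1 := by exact_mod_cast ht.le
    have := neg_abs_le (c - χ - γ * V₀)
    nlinarith [t.coe_nonneg, abs_nonneg (c - χ - γ * V₀)]
  · rintro f ⟨g, hfg, hgc, hg⟩
    exact tendsto_evol_zero_of_compact hγ hχ c hg.continuous hgc hfg

theorem continuous_evol (f : Lp ℝ q (weightedMeasure d V₀ γ p)) :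
    Continuous fun t => evol q p hγ hχ c t f := by
  refine continuous_orbit_of_tendsto_zero (a := |c - χ - γ * V₀|) (abs_nonneg _)
    (evol_add hγ hχ c) (fun t => ?_) f (tendsto_evol_zero hγ hχ c f)
  refine (norm_evol_le hγ hχ c t).trans (Real.exp_le_exp.2 ?_)
  have := neg_abs_le (c - χ - γ * V₀)
  nlinarith [t.coe_nonneg]

end Evolution

/-! ## Free transport in the sense of distributions -/

section TestFunctions

variable {d : ℕ} {V₀ γ : ℝ} {q : ℝ≥0∞} {p : ℕ} {η : E d × E d → ℝ}

/-- The derivative `v · ∇ₓ η` along the flow. -/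
def streamDeriv (η : E d × E d → ℝ) (z : E d × E d) : ℝ := fderiv ℝ η z (z.2, 0)

/-- The flow as a homeomorphism. -/
def flowHomeomorph (t : ℝ) : E d × E d ≃ₜ E d × E d where
  toFun := flow t
  invFun := flow (-t)
  left_inv z := by simp [flow_add]
  right_inv z := by simp [flow_add]
  continuous_toFun := continuous_flow t
  continuous_invFun := continuous_flow (-t)

theorem measurableEmbedding_flow (t : ℝ) :
    MeasurableEmbedding (flow t : E d × E d → E d × E d) :=
  (flowHomeomorph t).measurableEmbedding

theorem integral_flow (t : ℝ) (F : E d × E d → ℝ) :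
    ∫ z, F (flow t z) ∂phaseMeasure d V₀ = ∫ z, F z ∂phaseMeasure d V₀ :=
  (measurePreserving_flow t).integral_comp (measurableEmbedding_flow t) F

theorem IsTestFunction.comp_flow (h : IsTestFunction V₀ η) (t : ℝ) :
    IsTestFunction V₀ (fun z => η (flow t z)) where
  smooth := h.smooth.comp (by unfold flow; fun_prop)
  compact := h.compact.comp_isClosedEmbedding (flowHomeomorph t).isClosedEmbedding
  support := by
    refine (tsupport_comp_subset_preimage η (continuous_flow t)).trans fun z hz => ?_
    have := h.support hz
    exact ⟨mem_univ _, this.2⟩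

theorem hasDerivAt_flow (t : ℝ) (z : E d × E d) :
    HasDerivAt (fun s => flow s z) ((flow t z).2, (0 : E d)) t := by
  unfold flow
  have h1 : HasDerivAt (fun s : ℝ => z.1 + s • z.2) z.2 t := by
    simpa using ((hasDerivAt_id t).smul_const z.2).const_add z.1
  exact h1.prodMk (hasDerivAt_const t z.2)

theorem hasDerivAt_comp_flow (h : ContDiff ℝ ∞ η) (t : ℝ) (z : E d × E d) :
    HasDerivAt (fun s => η (flow s z)) (streamDeriv η (flow t z)) t :=
  ((h.differentiable (by simp)) (flow t z)).hasFDerivAt.comp_hasDerivAt t (hasDerivAt_flow t z)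

theorem streamDeriv_comp_flow (h : ContDiff ℝ ∞ η) (t : ℝ) (z : E d × E d) :
    streamDeriv (fun z => η (flow t z)) z = streamDeriv η (flow t z) := by
  have h1 := hasDerivAt_comp_flow (h.comp (by unfold flow; fun_prop :
    ContDiff ℝ ∞ (flow t : E d × E d → E d × E d))) 0 z
  simp only [flow_zero] at h1
  have h2 := (hasDerivAt_comp_flow h t z)
  have h3 : HasDerivAt (fun s => η (flow (s + t) z)) (streamDeriv η (flow t z)) 0 := by
    have := HasDerivAt.comp_add_const 0 t (f := fun s => η (flow s z))
      (f' := streamDeriv η (flow t z)) (by rwa [zero_add])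
    exact this
  refine h1.unique (h3.congr_of_eventuallyEq (Eventually.of_forall fun s => ?_))
  simp only [Function.comp, flow_add, add_comm]

theorem continuous_streamDeriv (h : ContDiff ℝ ∞ η) : Continuous (streamDeriv η) := by
  unfold streamDeriv
  exact (h.continuous_fderiv (by simp)).clm_apply (by fun_prop)

theorem tsupport_streamDeriv_subset : tsupport (streamDeriv η) ⊆ tsupport η := by
  refine (closure_mono fun z hz => ?_).trans (tsupport_fderiv_subset ℝ (f := η))
  rw [Function.mem_support] at hz ⊢
  intro h0
  exact hz (by rw [streamDeriv, h0]; rfl)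

theorem hasCompactSupport_streamDeriv (h : HasCompactSupport η) :
    HasCompactSupport (streamDeriv η) :=
  h.of_isClosed_subset (isClosed_tsupport _) tsupport_streamDeriv_subset

variable [hqp : IsNatExponent q p]

theorem memLp_phase (hγ : 0 ≤ γ) {f : E d × E d → ℝ}
    (hf : MemLp f q (weightedMeasure d V₀ γ p)) : MemLp f q (phaseMeasure d V₀) := by
  refine ((memLp_weighted_iff hqp).1 hf).mono (aesm_weighted_iff.1 hf.1) (ae_of_all _ fun z => ?_)
  rw [norm_mul, Real.norm_eq_abs (weight γ z.1), abs_of_pos (weight_pos _)]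
  exact le_mul_of_one_le_left (norm_nonneg _) (one_le_weight hγ _)

theorem locallyIntegrable_phase (hγ : 0 ≤ γ) {f : E d × E d → ℝ}
    (hf : MemLp f q (weightedMeasure d V₀ γ p)) : LocallyIntegrable f (phaseMeasure d V₀) :=
  (memLp_phase hγ hf).locallyIntegrable (by rw [hqp.eq]; exact_mod_cast hqp.one_le)

theorem integrable_mul_compact (hγ : 0 ≤ γ) {f : E d × E d → ℝ}
    (hf : MemLp f q (weightedMeasure d V₀ γ p)) (hη : Continuous η) (hc : HasCompactSupport η) :
    Integrable (fun z => f z * η z) (phaseMeasure d V₀) :=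
  (locallyIntegrable_phase hγ hf).integrable_smul_right_of_hasCompactSupport hη hc

theorem hasDerivAt_integral_flow (hγ : 0 ≤ γ) {f : E d × E d → ℝ}
    (hf : MemLp f q (weightedMeasure d V₀ γ p)) (h : IsTestFunction V₀ η) (t : ℝ) :
    HasDerivAt (fun s => ∫ z, f z * η (flow s z) ∂phaseMeasure d V₀)
      (∫ z, f z * streamDeriv η (flow t z) ∂phaseMeasure d V₀) t := by
  have hc := continuous_streamDeriv h.smooth
  obtain ⟨B, hB⟩ := hc.bounded_above_of_compact_support (hasCompactSupport_streamDeriv h.compact)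
  set K : Set (E d × E d) := (fun y : ℝ × (E d × E d) => flow (-y.1) y.2) ''
    (Metric.closedBall t 1 ×ˢ tsupport η) with hK
  have hflow2 : Continuous fun y : ℝ × (E d × E d) => flow (-y.1) y.2 := by unfold flow; fun_prop
  have hKc : IsCompact K := ((isCompact_closedBall t 1).prod h.compact).image hflow2
  have hi : IntegrableOn f K (phaseMeasure d V₀) :=
    (locallyIntegrable_phase hγ hf).integrableOn_isCompact hKc
  have hfm := aesm_weighted_iff.1 hf.1
  refine (hasDerivAt_integral_of_dominated_loc_of_deriv_le (𝕜 := ℝ)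
    (bound := K.indicator fun z => ‖f z‖ * B) (s := Metric.closedBall t 1)
    (F := fun s z => f z * η (flow s z)) (F' := fun s z => f z * streamDeriv η (flow s z))
    (Metric.closedBall_mem_nhds t one_pos) (Eventually.of_forall fun s => ?_) ?_ ?_ ?_ ?_ ?_).2
  · exact hfm.mul (h.comp_flow s).smooth.continuous.aestronglyMeasurable
  · exact integrable_mul_compact hγ hf (h.comp_flow t).smooth.continuous (h.comp_flow t).compact
  · exact hfm.mul (hc.comp (continuous_flow t)).aestronglyMeasurable
  · refine ae_of_all _ fun z s hs => ?_
    rw [norm_mul]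
    by_cases hz : z ∈ K
    · rw [indicator_of_mem hz]
      gcongr
      exact hB _
    · rw [indicator_of_notMem hz]
      have : streamDeriv η (flow s z) = 0 := by
        by_contra h0
        refine hz ⟨(s, flow s z), ⟨hs, tsupport_streamDeriv_subset (subset_tsupport _ h0)⟩, ?_⟩
        simp [flow_add]
      simp [this]
  · exact IntegrableOn.integrable_indicator (hi.norm.mul_const B) hKc.measurableSet
  · exact ae_of_all _ fun z s _ => (hasDerivAt_comp_flow h.smooth s z).const_mul _

theorem eq_zero_of_integral_test (hγ : 0 ≤ γ) {f : E d × E d → ℝ}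
    (hf : MemLp f q (weightedMeasure d V₀ γ p))
    (h : ∀ η, IsTestFunction V₀ η → ∫ z, f z * η z ∂phaseMeasure d V₀ = 0) :
    f =ᵐ[phaseMeasure d V₀] 0 := by
  have hU : IsOpen ((univ : Set (E d)) ×ˢ Metric.ball (0 : E d) V₀) :=
    isOpen_univ.prod Metric.isOpen_ball
  have := hU.ae_eq_zero_of_integral_contDiff_smul_eq_zero
    ((locallyIntegrable_phase hγ hf).locallyIntegrableOn _) (fun g g1 g2 g3 => by
      simpa [mul_comm] using h g ⟨g1, g2, g3⟩)
  filter_upwards [this, ae_velocity_lt] with z h1 h2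
  exact h1 ⟨mem_univ _, by simpa using h2⟩

variable [Fact (1 ≤ q)]

/-- Hölder's inequality on the compact support of `η`, together with `m ≥ 1`. -/
theorem exists_norm_integral_test_le (hγ : 0 ≤ γ) (hη : Continuous η) (hc : HasCompactSupport η) :
    ∃ C : ℝ, ∀ f : Lp ℝ q (weightedMeasure d V₀ γ p),
      ‖∫ z, f z * η z ∂phaseMeasure d V₀‖ ≤ C * ‖f‖ := by
  obtain ⟨B, hB⟩ := hη.bounded_above_of_compact_support hc
  have hB0 : 0 ≤ B := (norm_nonneg _).trans (hB 0)
  set ρ := (phaseMeasure d V₀).restrict (tsupport η) with hρ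
  have hfin : IsFiniteMeasure ρ := ⟨by
    rw [hρ, Measure.restrict_apply_univ]; exact hc.measure_lt_top⟩
  set c : ℝ≥0∞ := ρ univ ^ (1 / (1 : ℝ≥0∞).toReal - 1 / q.toReal) with hcdef
  have h1q : (1 : ℝ≥0∞) ≤ q := Fact.out
  have hcfin : c ≠ ⊤ := by
    refine ENNReal.rpow_ne_top_of_nonneg ?_ (measure_ne_top _ _)
    have hp := hqp.one_le
    rw [hqp.eq]
    simp only [ENNReal.toReal_one, ENNReal.toReal_natCast, sub_nonneg, one_div, inv_one]
    exact inv_le_one_of_one_le₀ (by exact_mod_cast hp)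
  refine ⟨B * c.toReal, fun f => ?_⟩
  have hf := memLp_phase hγ (Lp.memLp f)
  have h1 : eLpNorm f 1 ρ ≤ eLpNorm f q (weightedMeasure d V₀ γ p) * c := by
    refine (eLpNorm_le_eLpNorm_mul_rpow_measure_univ h1q hf.1.restrict).trans ?_
    refine mul_le_mul_left ?_ c
    refine (eLpNorm_mono_measure (f : E d × E d → ℝ) Measure.restrict_le_self).trans ?_
    rw [eLpNorm_weighted hqp]
    refine eLpNorm_mono fun z => ?_
    rw [norm_mul, Real.norm_eq_abs (weight γ z.1), abs_of_pos (weight_pos _)]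
    exact le_mul_of_one_le_left (norm_nonneg _) (one_le_weight hγ _)
  have h2 : ∫ z, ‖f z‖ ∂ρ ≤ ‖f‖ * c.toReal := by
    rw [integral_norm_eq_lintegral_enorm hf.1.restrict, ← eLpNorm_one_eq_lintegral_enorm,
      Lp.norm_def, ← ENNReal.toReal_mul]
    exact ENNReal.toReal_mono (ENNReal.mul_ne_top (Lp.memLp f).2.ne hcfin) h1
  have hint : Integrable f ρ := (locallyIntegrable_phase hγ (Lp.memLp f)).integrableOn_isCompact hc
  have h3 : ∫ z, f z * η z ∂phaseMeasure d V₀ = ∫ z, f z * η z ∂ρ := by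
    rw [hρ, setIntegral_eq_integral_of_forall_compl_eq_zero]
    intro z hz
    rw [image_eq_zero_of_notMem_tsupport hz, mul_zero]
  rw [h3]
  calc ‖∫ z, f z * η z ∂ρ‖ ≤ ∫ z, ‖f z‖ * B ∂ρ := by
        refine norm_integral_le_of_norm_le (hint.norm.mul_const B) (ae_of_all _ fun z => ?_)
        rw [norm_mul]
        gcongr
        exact hB z
    _ = (∫ z, ‖f z‖ ∂ρ) * B := integral_mul_const _ _
    _ ≤ (‖f‖ * c.toReal) * B := by gcongr
    _ = _ := by ring

theorem integral_test_congr {f g : E d × E d → ℝ} (h : f =ᵐ[weightedMeasure d V₀ γ p] g) :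
    ∫ z, f z * η z ∂phaseMeasure d V₀ = ∫ z, g z * η z ∂phaseMeasure d V₀ := by
  refine integral_congr_ae ?_
  rw [EventuallyEq, ae_weighted] at h
  filter_upwards [h] with z hz
  rw [hz]

/-- Integration against a continuous function with compact support. -/
def pairing (hγ : 0 ≤ γ) (hη : Continuous η) (hc : HasCompactSupport η) :
    Lp ℝ q (weightedMeasure d V₀ γ p) →L[ℝ] ℝ :=
  LinearMap.mkContinuousOfExistsBound
    { toFun := fun f => ∫ z, f z * η z ∂phaseMeasure d V₀
      map_add' := fun f g => by
        rw [integral_test_congr (Lp.coeFn_add f g), ← integral_add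
          (integrable_mul_compact hγ (Lp.memLp f) hη hc)
          (integrable_mul_compact hγ (Lp.memLp g) hη hc)]
        simp [add_mul]
      map_smul' := fun c f => by
        rw [integral_test_congr (Lp.coeFn_smul c f), RingHom.id_apply, smul_eq_mul,
          ← integral_const_mul]
        simp [mul_assoc] }
    (exists_norm_integral_test_le hγ hη hc)

theorem pairing_apply (hγ : 0 ≤ γ) (hη : Continuous η) (hc : HasCompactSupport η)
    (f : Lp ℝ q (weightedMeasure d V₀ γ p)) :
    pairing hγ hη hc f = ∫ z, f z * η z ∂phaseMeasure d V₀ := rfl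

theorem eq_of_forall_pairing (hγ : 0 ≤ γ) {f g : Lp ℝ q (weightedMeasure d V₀ γ p)}
    (h : ∀ η (hη : IsTestFunction V₀ η), pairing hγ hη.smooth.continuous hη.compact f
      = pairing hγ hη.smooth.continuous hη.compact g) : f = g := by
  rw [← sub_eq_zero]
  refine Lp.ext ?_
  rw [EventuallyEq, ae_weighted]
  have h0 := Lp.coeFn_zero ℝ q (weightedMeasure d V₀ γ p)
  rw [EventuallyEq, ae_weighted] at h0
  refine EventuallyEq.trans (eq_zero_of_integral_test hγ (Lp.memLp (f - g)) fun η hη => ?_)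
    (EventuallyEq.symm h0)
  have := h η hη
  rw [← sub_eq_zero, ← map_sub] at this
  exact this

/-- `h = - v · ∇ₓ f` in the sense of distributions. -/
def IsFreeTransport (V₀ : ℝ) (f h : E d × E d → ℝ) : Prop :=
  ∀ η : E d × E d → ℝ, IsTestFunction V₀ η →
    ∫ z, h z * η z ∂phaseMeasure d V₀ = ∫ z, f z * streamDeriv η z ∂phaseMeasure d V₀

/-- With both rates zero the damping factor is `1`, and invariance of the measure moves the flow
onto the test function. -/
theorem pairing_evol_free (hγ : 0 ≤ γ) (h : IsTestFunction V₀ η) (t : ℝ≥0)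
    (f : Lp ℝ q (weightedMeasure d V₀ γ p)) :
    pairing hγ h.smooth.continuous h.compact (evol q p hγ le_rfl 0 t f)
      = ∫ z, f z * η (flow t z) ∂phaseMeasure d V₀ := by
  rw [pairing_apply, ← integral_flow t]
  refine integral_congr_ae ?_
  filter_upwards [ae_flow t (coeFn_evol hγ le_rfl 0 t f)] with z hz
  rw [hz, transportOp, flow_add]
  simp [damping, collisionPotential]

/-- The generator is the weak derivative on its maximal domain because the flow preserves the class
of test functions: it never changes `v`, and `x` ranges over the whole space. -/
theorem isSemigroupGeneratedBy_free (hγ : 0 ≤ γ) :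
    IsSemigroupGeneratedBy (fun f g : Lp ℝ q (weightedMeasure d V₀ γ p) => IsFreeTransport V₀ f g)
      (evol q p hγ le_rfl 0) := by
  refine ⟨evol_zero hγ le_rfl 0, evol_add hγ le_rfl 0, continuous_evol hγ le_rfl 0, fun f g => ?_⟩
  constructor
  · intro hfg
    have hc : Continuous fun s : ℝ => evol q p hγ le_rfl 0 s.toNNReal g :=
      (continuous_evol hγ le_rfl 0 g).comp continuous_real_toNNReal
    -- Testing the weak equation on `η ∘ flow s` and integrating in `s` gives this strong identity;
    -- dividing by `t` yields the generator.
    have key : ∀ t : ℝ≥0, evol q p hγ le_rfl 0 t f - f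
        = ∫ s in (0 : ℝ)..t, evol q p hγ le_rfl 0 s.toNNReal g := by
      intro t
      refine eq_of_forall_pairing hγ fun η hη => ?_
      rw [← ContinuousLinearMap.intervalIntegral_comp_comm _ (hc.intervalIntegrable _ _), map_sub,
        pairing_evol_free hγ hη]
      have h1 : ∀ s ∈ uIcc (0 : ℝ) t, HasDerivAt
          (fun s => ∫ z, f z * η (flow s z) ∂phaseMeasure d V₀)
          (pairing hγ hη.smooth.continuous hη.compact (evol q p hγ le_rfl 0 s.toNNReal g)) s := by
        intro s hs
        rw [uIcc_of_le t.coe_nonneg] at hs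
        have h2 := hasDerivAt_integral_flow hγ (Lp.memLp f) hη s
        convert h2 using 1
        rw [pairing_evol_free hγ hη, Real.coe_toNNReal s hs.1, hfg _ (hη.comp_flow s)]
        simp only [streamDeriv_comp_flow hη.smooth]
      rw [intervalIntegral.integral_eq_sub_of_hasDerivAt h1
        (((ContinuousLinearMap.continuous _).comp hc).intervalIntegrable _ _)]
      simp [pairing_apply]
    have hd : HasDerivAt (fun r => ∫ s in (0 : ℝ)..r, evol q p hγ le_rfl 0 s.toNNReal g)
        (evol q p hγ le_rfl 0 (0 : ℝ).toNNReal g) 0 :=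
      intervalIntegral.integral_hasDerivAt_right (hc.intervalIntegrable _ _)
        (hc.stronglyMeasurableAtFilter _ _) hc.continuousAt
    have h1 := hd.tendsto_slope_zero_right.comp IsSemigroupGeneratedBy.tendsto_coe_nhdsGT
    simp only [Real.toNNReal_zero, evol_zero, ContinuousLinearMap.id_apply] at h1
    refine h1.congr fun t => ?_
    rw [key]
    simp
  · intro hl η hη
    have h1 := ((pairing hγ hη.smooth.continuous hη.compact).continuous.tendsto g).comp hl
    have h2 := (hasDerivAt_integral_flow hγ (Lp.memLp f) hη 0).tendsto_slope_zero_right.comp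
      IsSemigroupGeneratedBy.tendsto_coe_nhdsGT
    simp only [flow_zero] at h2
    refine tendsto_nhds_unique h1 (h2.congr fun t => ?_)
    simp only [Function.comp, map_smul, map_sub, pairing_evol_free hγ hη, zero_add]
    rfl

end TestFunctions

/-! ### Adding the turning rate to the transport operator -/

section Turning

variable {d : ℕ} {V₀ γ χ : ℝ} {q : ℝ≥0∞} {p : ℕ}

/-- For `x ≠ 0` the exceptional velocities form a proper subspace. -/
theorem ae_inner_ne_zero (hd : 1 ≤ d) : ∀ᵐ z ∂phaseMeasure d V₀, inner ℝ z.1 z.2 ≠ 0 := by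
  have hm : MeasurableSet {z : E d × E d | ¬ inner ℝ z.1 z.2 ≠ 0} := by
    simp only [not_not]
    exact (isClosed_eq (by fun_prop) continuous_const).measurableSet
  rw [ae_iff, phaseMeasure, Measure.measure_prod_null hm]
  have : Nontrivial (E d) := by
    have : Nonempty (Fin d) := ⟨⟨0, hd⟩⟩
    infer_instance
  filter_upwards [compl_mem_ae_iff.2 (measure_singleton (μ := volume) (0 : E d))] with x hx
  have hx' : x ≠ 0 := hx
  rw [Pi.zero_apply]
  refine measure_mono_null (fun v hv => ?_) (Measure.absolutelyContinuous_of_le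
    Measure.restrict_le_self (Measure.addHaar_submodule volume
      (LinearMap.ker (innerSL ℝ x).toLinearMap) ?_))
  · simpa using hv
  · intro h
    have : x ∈ LinearMap.ker (innerSL ℝ x).toLinearMap := by rw [h]; trivial
    exact hx' (by simpa using this)

theorem turningKernel_bounds (hχ : χ ∈ Ioo (0 : ℝ) 1) (x v : E d) :
    1 - χ ≤ turningKernel χ x v ∧ turningKernel χ x v ≤ 1 + χ := by
  unfold turningKernel
  rcases Real.sign_apply_eq (inner ℝ x v) with h | h | h <;> rw [h] <;>
    constructor <;> linarith [hχ.1]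

theorem measurable_sign : Measurable Real.sign := by
  unfold Real.sign
  exact Measurable.ite measurableSet_Iio measurable_const
    (Measurable.ite measurableSet_Ioi measurable_const measurable_const)

theorem measurable_turningKernel :
    Measurable fun z : E d × E d => turningKernel χ z.1 z.2 := by
  unfold turningKernel
  exact ((measurable_sign.comp (by fun_prop)).const_mul χ).const_add 1

/-- The difference quotient of the damping factor. -/
def dampingSlope (χ t : ℝ) (z : E d × E d) : ℝ := (damping 1 χ t z - 1) / t

/-- The factor lies between `exp (-(1 + χ) t)` and `1`, so the slope is at most `1 + χ ≤ 2`,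
uniformly in `t` and `z`. -/
theorem abs_dampingSlope_le (hχ : χ ∈ Ioo (0 : ℝ) 1) {t : ℝ} (ht : 0 ≤ t) (z : E d × E d) :
    |dampingSlope χ t z| ≤ 2 := by
  rcases ht.eq_or_lt with rfl | ht
  · simp [dampingSlope]
  rw [dampingSlope, abs_div, abs_of_pos ht, div_le_iff₀ ht, abs_le]
  have h1 := damping_le hχ.1.le 1 ht.le z
  have h2 := le_damping hχ.1.le 1 ht.le z
  have h3 : Real.exp (-(1 - χ) * t) ≤ 1 := Real.exp_le_one_iff.2 (by nlinarith [hχ.2])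
  have h4 := Real.add_one_le_exp (-(1 + χ) * t)
  constructor <;> nlinarith [hχ.2]

/-- For `t < |x·v|/|v|²` the backward trajectory has not met `x·v = 0`, and the damping is exactly
`exp (-K t)`. -/
theorem tendsto_dampingSlope {z : E d × E d} (hz : inner ℝ z.1 z.2 ≠ 0) :
    Tendsto (fun t : ℝ≥0 => dampingSlope χ t z) (𝓝[>] 0) (𝓝 (-turningKernel χ z.1 z.2)) := by
  set r := inner ℝ z.1 z.2 with hr
  have hv : z.2 ≠ 0 := fun h => hz (by rw [hr, h, inner_zero_right])
  have hn : 0 < ‖z.2‖ ^ 2 := by positivity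
  set K := turningKernel χ z.1 z.2 with hK
  have h1 : HasDerivAt (fun t : ℝ => Real.exp (-K * t)) (-K) 0 := by
    simpa using ((hasDerivAt_id (0 : ℝ)).const_mul (-K)).exp
  have h2 := h1.tendsto_slope_zero_right.comp IsSemigroupGeneratedBy.tendsto_coe_nhdsGT
  refine h2.congr' ?_
  have hlt : ∀ᶠ t : ℝ≥0 in 𝓝[>] 0, (t : ℝ) < |r| / ‖z.2‖ ^ 2 :=
    nhdsWithin_le_nhds ((NNReal.continuous_coe.tendsto 0).eventually_lt_const
      (by simp only [NNReal.coe_zero]; positivity))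
  filter_upwards [hlt] with t ht
  rw [lt_div_iff₀ hn] at ht
  have e : damping 1 χ t z = Real.exp (-K * t) := by
    rw [damping, collisionPotential_flow, collisionPotential, ← hr]
    congr 1
    have ht0 : 0 ≤ (t : ℝ) * ‖z.2‖ ^ 2 := by positivity
    rw [hK, turningKernel, ← hr]
    rcases lt_or_gt_of_ne hz with h | h
    · rw [abs_of_neg h] at ht ⊢
      rw [abs_of_neg (by linarith), Real.sign_of_neg h]
      field_simp
      ring
    · rw [abs_of_pos h] at ht ⊢
      rw [abs_of_pos (by linarith), Real.sign_of_pos h]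
      field_simp
      ring
  simp only [Function.comp, zero_add, dampingSlope, e, mul_zero, Real.exp_zero, smul_eq_mul]
  rw [div_eq_inv_mul]

variable [hqp : IsNatExponent q p]

theorem isLpOp_mul (hγ : 0 ≤ γ) {M : E d × E d → ℝ} (hM : Measurable M) {A : ℝ} (hA : 0 ≤ A)
    (hMA : ∀ z, |M z| ≤ A) : IsLpOp (transportOp 0 M) (Real.exp (γ * (|0| * V₀)) * A) q
      (weightedMeasure d V₀ γ p) :=
  isLpOp_transport hqp hγ hA 0 hM fun z _ => hMA z

variable [Fact (1 ≤ q)]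

/-- Multiplication by a bounded function. -/
def mulLp (hγ : 0 ≤ γ) {M : E d × E d → ℝ} (hM : Measurable M) {A : ℝ} (hA : 0 ≤ A)
    (hMA : ∀ z, |M z| ≤ A) :
    Lp ℝ q (weightedMeasure d V₀ γ p) →L[ℝ] Lp ℝ q (weightedMeasure d V₀ γ p) :=
  opLp (isLpOp_mul hγ hM hA hMA)

theorem coeFn_mulLp (hγ : 0 ≤ γ) {M : E d × E d → ℝ} (hM : Measurable M) {A : ℝ} (hA : 0 ≤ A)
    (hMA : ∀ z, |M z| ≤ A) (f : Lp ℝ q (weightedMeasure d V₀ γ p)) :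
    mulLp hγ hM hA hMA f =ᵐ[phaseMeasure d V₀] fun z => M z * f z := by
  have := coeFn_opLp (isLpOp_mul hγ hM hA hMA) f
  rw [EventuallyEq, ae_weighted] at this
  filter_upwards [this] with z hz
  rw [mulLp, hz, transportOp]
  simp

theorem norm_mulLp_le (hγ : 0 ≤ γ) {M : E d × E d → ℝ} (hM : Measurable M) {A : ℝ} (hA : 0 ≤ A)
    (hMA : ∀ z, |M z| ≤ A) : ‖mulLp (q := q) (p := p) (V₀ := V₀) hγ hM hA hMA‖ ≤ A :=
  (norm_opLp_le _).trans (by simp)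

theorem abs_turningKernel_le (hχ : χ ∈ Ioo (0 : ℝ) 1) (x v : E d) : |turningKernel χ x v| ≤ 2 := by
  have := turningKernel_bounds hχ x v
  rw [abs_le]; constructor <;> linarith [hχ.1, hχ.2]

variable (q p) in
/-- Multiplication by the turning kernel. -/
def turningMul (hγ : 0 ≤ γ) (hχ : χ ∈ Ioo (0 : ℝ) 1) :
    Lp ℝ q (weightedMeasure d V₀ γ p) →L[ℝ] Lp ℝ q (weightedMeasure d V₀ γ p) :=
  mulLp hγ (measurable_turningKernel (χ := χ)) zero_le_two fun _ => abs_turningKernel_le hχ _ _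

theorem tendsto_dampingSlope_mul (hd : 1 ≤ d) (hγ : 0 ≤ γ) (hχ : χ ∈ Ioo (0 : ℝ) 1)
    (hm : ∀ t : ℝ≥0, Measurable (dampingSlope χ t : E d × E d → ℝ))
    (f : Lp ℝ q (weightedMeasure d V₀ γ p)) :
    Tendsto (fun t : ℝ≥0 => mulLp hγ (hm t) zero_le_two
      (fun z => abs_dampingSlope_le hχ t.coe_nonneg z) f) (𝓝[>] 0)
      (𝓝 (-turningMul q p hγ hχ f)) := by
  refine tendsto_Lp_of_eLpNorm_sub ?_
  have e : ∀ t : ℝ≥0, (fun z => mulLp hγ (hm t) zero_le_two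
      (fun z => abs_dampingSlope_le hχ t.coe_nonneg z) f z - (-turningMul q p hγ hχ f) z)
      =ᵐ[weightedMeasure d V₀ γ p]
      fun z => (dampingSlope χ t z + turningKernel χ z.1 z.2) * f z := fun t => by
    have h0 := Lp.coeFn_neg (turningMul q p hγ hχ f)
    rw [EventuallyEq, ae_weighted] at h0 ⊢
    filter_upwards [h0, coeFn_mulLp hγ (hm t) zero_le_two
      (fun z => abs_dampingSlope_le hχ t.coe_nonneg z) f, coeFn_mulLp hγ
      (measurable_turningKernel (χ := χ)) zero_le_two (fun _ => abs_turningKernel_le hχ _ _) f]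
      with z h1 h2 h3
    rw [h1, h2, Pi.neg_apply, turningMul, h3]
    ring
  refine (tendsto_congr fun t => eLpNorm_congr_ae (e t)).2 ?_
  refine tendsto_eLpNorm_zero_of_dominated hqp _ (fun z => 4 * |f z|) (fun t => ?_) ?_ ?_ ?_
  · exact ((hm t).add measurable_turningKernel).aestronglyMeasurable.mul (Lp.memLp f).1
  · exact (Lp.memLp f).abs.const_mul 4
  · refine Eventually.of_forall fun t => ae_of_all _ fun z => ?_
    rw [abs_mul]
    gcongr
    refine (abs_add_le _ _).trans ?_
    linarith [abs_turningKernel_le hχ z.1 z.2, abs_dampingSlope_le hχ t.coe_nonneg z]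
  · rw [ae_weighted]
    filter_upwards [ae_inner_ne_zero hd] with z hz
    simpa using ((tendsto_dampingSlope (χ := χ) hz).add_const (turningKernel χ z.1 z.2)).mul_const
      (f z)

/-- The damped semigroup is the free one times the damping factor, so their quotient difference is
multiplication by the damping slope, which tends strongly to `-K`. -/
theorem isSemigroupGeneratedBy_evol (hd : 1 ≤ d) (hγ : 0 ≤ γ) (hχ : χ ∈ Ioo (0 : ℝ) 1) :
    IsSemigroupGeneratedBy (fun f g : Lp ℝ q (weightedMeasure d V₀ γ p) =>
      IsFreeTransport V₀ f (g + turningMul q p hγ hχ f : Lp ℝ q (weightedMeasure d V₀ γ p)))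
      (evol q p hγ hχ.1.le 1) := by
  have hm : ∀ t : ℝ≥0, Measurable (dampingSlope χ t : E d × E d → ℝ) := fun t =>
    ((measurable_damping 1 t).sub_const 1).div_const _
  have := (isSemigroupGeneratedBy_free (q := q) (p := p) (d := d) (V₀ := V₀) hγ).of_perturbation
    (-turningMul q p hγ hχ) (evol_zero hγ hχ.1.le 1) (evol_add hγ hχ.1.le 1)
    (continuous_evol hγ hχ.1.le 1) (fun f => ?_)
  · simpa only [_root_.neg_apply, sub_neg_eq_add] using this
  set Q : ℝ≥0 → Lp ℝ q (weightedMeasure d V₀ γ p) →L[ℝ] Lp ℝ q (weightedMeasure d V₀ γ p) :=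
    fun t => mulLp hγ (hm t) zero_le_two (fun z => abs_dampingSlope_le hχ t.coe_nonneg z) with hQ
  -- `Q t` acts on the moving function; splitting off `f` leaves a term killed by the bound `2` and
  -- the strong continuity of free transport.
  have e : ∀ t : ℝ≥0, (t : ℝ)⁻¹ • (evol q p hγ hχ.1.le 1 t f - evol q p hγ le_rfl 0 t f)
      = Q t (evol q p hγ le_rfl 0 t f - f) + Q t f := by
    intro t
    rw [← map_add, sub_add_cancel]
    refine Lp.ext ?_
    have h1 := Lp.coeFn_smul (t : ℝ)⁻¹
      (evol q p hγ hχ.1.le 1 t f - evol q p hγ le_rfl 0 t f)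
    have h2 := Lp.coeFn_sub (evol q p hγ hχ.1.le 1 t f) (evol q p hγ le_rfl 0 t f)
    rw [EventuallyEq, ae_weighted] at h1 h2 ⊢
    filter_upwards [h1, h2, coeFn_evol hγ hχ.1.le 1 t f, coeFn_evol hγ le_rfl 0 t f,
      coeFn_mulLp hγ (hm t) zero_le_two (fun z => abs_dampingSlope_le hχ t.coe_nonneg z)
        (evol q p hγ le_rfl 0 t f)] with z a1 a2 a3 a4 a5
    rw [a1, Pi.smul_apply, a2, Pi.sub_apply, a3, hQ]
    simp only
    rw [a5, a4]
    simp only [transportOp, dampingSlope, smul_eq_mul]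
    have : damping 0 0 (t : ℝ) z = 1 := by simp [damping, collisionPotential]
    rw [this]
    ring
  have h1 : Tendsto (fun t : ℝ≥0 => Q t (evol q p hγ le_rfl 0 t f - f)) (𝓝[>] 0) (𝓝 0) := by
    have h2 := ((tendsto_iff_norm_sub_tendsto_zero.1
      (tendsto_evol_zero (V₀ := V₀) hγ le_rfl 0 f)).mono_left
        (nhdsWithin_le_nhds (s := Ioi 0))).const_mul 2
    rw [mul_zero] at h2
    exact squeeze_zero_norm (fun t => (Q t).le_of_opNorm_le (norm_mulLp_le hγ _ _ _) _) h2
  have h3 := h1.add (tendsto_dampingSlope_mul hd hγ hχ hm f)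
  rw [zero_add] at h3
  exact h3.congr fun t => (e t).symm

end Turning

/-! ## The space `X` -/

section Intersection

variable {d : ℕ} {V₀ γ χ : ℝ}

/-- Along a common subsequence, extracted twice, both components converge almost everywhere, so
equality passes to the limit. -/
theorem isClosed_X : IsClosed (X d V₀ γ : Set (WithLp 2 (L1m d V₀ γ × L2m d V₀ γ))) := by
  refine IsSeqClosed.isClosed fun u w hu hw => ?_
  have h1 : Tendsto (fun n => (u n).fst) atTop (𝓝 w.fst) :=
    ((WithLp.fstL 2 ℝ (L1m d V₀ γ) (L2m d V₀ γ)).continuous.tendsto w).comp hw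
  have h2 : Tendsto (fun n => (u n).snd) atTop (𝓝 w.snd) :=
    ((WithLp.sndL 2 ℝ (L1m d V₀ γ) (L2m d V₀ γ)).continuous.tendsto w).comp hw
  obtain ⟨n1, hn1, ha⟩ := (tendstoInMeasure_of_tendsto_Lp h1).exists_seq_tendsto_ae
  obtain ⟨n2, hn2, hb⟩ :=
    (tendstoInMeasure_of_tendsto_Lp (h2.comp hn1.tendsto_atTop)).exists_seq_tendsto_ae
  rw [ae_weighted] at ha hb
  have hall : ∀ᵐ z ∂phaseMeasure d V₀, ∀ n, (u n).fst z = (u n).snd z := ae_all_iff.2 hu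
  change ∀ᵐ z ∂phaseMeasure d V₀, w.fst z = w.snd z
  filter_upwards [ha, hb, hall] with z h3 h4 h5
  refine tendsto_nhds_unique (h3.comp hn2.tendsto_atTop) (h4.congr fun n => ?_)
  exact (h5 _).symm

instance : CompleteSpace (X d V₀ γ) := isClosed_X.completeSpace_coe

variable (d V₀ γ) in
/-- The first component. -/
def fstX : X d V₀ γ →L[ℝ] L1m d V₀ γ := (WithLp.fstL 2 ℝ _ _).comp (X d V₀ γ).subtypeL

variable (d V₀ γ) in
/-- The second component. -/
def sndX : X d V₀ γ →L[ℝ] L2m d V₀ γ := (WithLp.sndL 2 ℝ _ _).comp (X d V₀ γ).subtypeL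

theorem fstX_ae_eq_sndX (u : X d V₀ γ) :
    fstX d V₀ γ u =ᵐ[phaseMeasure d V₀] sndX d V₀ γ u := u.2

theorem norm_sq_X (u : X d V₀ γ) : ‖u‖ ^ 2 = ‖fstX d V₀ γ u‖ ^ 2 + ‖sndX d V₀ γ u‖ ^ 2 :=
  WithLp.prod_norm_sq_eq_of_L2 (u : WithLp 2 (L1m d V₀ γ × L2m d V₀ γ))

theorem norm_fstX_le (u : X d V₀ γ) : ‖fstX d V₀ γ u‖ ≤ ‖u‖ := by
  have := norm_sq_X u
  exact le_of_sq_le_sq (by nlinarith [norm_nonneg (sndX d V₀ γ u)]) (norm_nonneg _)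

theorem norm_sndX_le (u : X d V₀ γ) : ‖sndX d V₀ γ u‖ ≤ ‖u‖ := by
  have := norm_sq_X u
  exact le_of_sq_le_sq (by nlinarith [norm_nonneg (fstX d V₀ γ u)]) (norm_nonneg _)

theorem norm_X_le (u : X d V₀ γ) : ‖u‖ ≤ ‖fstX d V₀ γ u‖ + ‖sndX d V₀ γ u‖ := by
  have := norm_sq_X u
  refine le_of_sq_le_sq ?_ (by positivity)
  nlinarith [norm_nonneg (fstX d V₀ γ u), norm_nonneg (sndX d V₀ γ u)]

theorem tendsto_X_iff {ι : Type*} {l : Filter ι} {F : ι → X d V₀ γ} {u : X d V₀ γ} :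
    Tendsto F l (𝓝 u) ↔ Tendsto (fun i => fstX d V₀ γ (F i)) l (𝓝 (fstX d V₀ γ u)) ∧
      Tendsto (fun i => sndX d V₀ γ (F i)) l (𝓝 (sndX d V₀ γ u)) := by
  constructor
  · exact fun h => ⟨((fstX d V₀ γ).continuous.tendsto u).comp h,
      ((sndX d V₀ γ).continuous.tendsto u).comp h⟩
  · rintro ⟨h1, h2⟩
    rw [tendsto_iff_norm_sub_tendsto_zero] at h1 h2 ⊢
    have := h1.add h2
    rw [add_zero] at this
    refine squeeze_zero (fun _ => norm_nonneg _) (fun i => ?_) this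
    rw [← map_sub, ← map_sub]
    exact norm_X_le _

theorem ext_X {u w : X d V₀ γ} (h1 : fstX d V₀ γ u = fstX d V₀ γ w)
    (h2 : sndX d V₀ γ u = sndX d V₀ γ w) : u = w := by
  rw [← sub_eq_zero, ← norm_le_zero_iff]
  refine (norm_X_le _).trans ?_
  rw [map_sub, map_sub, h1, h2]
  simp

variable {Op : (E d × E d → ℝ) → E d × E d → ℝ} {C : ℝ}

/-- The element of `X` with given components. -/
def mkX (f : L1m d V₀ γ) (g : L2m d V₀ γ) (h : f =ᵐ[phaseMeasure d V₀] g) : X d V₀ γ :=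
  ⟨WithLp.toLp 2 (f, g), h⟩

theorem fstX_mkX (f : L1m d V₀ γ) (g : L2m d V₀ γ) (h : f =ᵐ[phaseMeasure d V₀] g) :
    fstX d V₀ γ (mkX f g h) = f := rfl

theorem sndX_mkX (f : L1m d V₀ γ) (g : L2m d V₀ γ) (h : f =ᵐ[phaseMeasure d V₀] g) :
    sndX d V₀ γ (mkX f g h) = g := rfl

theorem opLp_ae_eq (h1 : IsLpOp Op C 1 (weightedMeasure d V₀ γ 1))
    (h2 : IsLpOp Op C 2 (weightedMeasure d V₀ γ 2)) (u : X d V₀ γ) :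
    opLp h1 (fstX d V₀ γ u) =ᵐ[phaseMeasure d V₀] opLp h2 (sndX d V₀ γ u) := by
  have a1 := coeFn_opLp h1 (fstX d V₀ γ u)
  have a2 := coeFn_opLp h2 (sndX d V₀ γ u)
  have a3 := h1.congr (fstX d V₀ γ u) (sndX d V₀ γ u)
  rw [EventuallyEq, ae_weighted] at a1 a2
  rw [EventuallyEq, EventuallyEq, ae_weighted] at a3
  filter_upwards [a1, a2, a3 (fstX_ae_eq_sndX u)] with z b1 b2 b3
  rw [b1, b2, b3]

/-- The bounded operator on `X` given by an operator on functions. -/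
def opX (h1 : IsLpOp Op C 1 (weightedMeasure d V₀ γ 1))
    (h2 : IsLpOp Op C 2 (weightedMeasure d V₀ γ 2)) : X d V₀ γ →L[ℝ] X d V₀ γ :=
  LinearMap.mkContinuous
    { toFun := fun u => mkX (opLp h1 (fstX d V₀ γ u)) (opLp h2 (sndX d V₀ γ u))
        (opLp_ae_eq h1 h2 u)
      map_add' := fun u w => by
        apply ext_X
        · simp only [map_add, fstX_mkX]
        · simp only [map_add, sndX_mkX]
      map_smul' := fun c u => by
        apply ext_X
        · simp only [map_smul, fstX_mkX, RingHom.id_apply]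
        · simp only [map_smul, sndX_mkX, RingHom.id_apply] }
    C (fun u => by
      refine le_of_sq_le_sq ?_ (mul_nonneg h1.nonneg (norm_nonneg u))
      simp only [LinearMap.coe_mk, AddHom.coe_mk]
      rw [norm_sq_X, mul_pow, norm_sq_X u, fstX_mkX, sndX_mkX]
      have b1 := (opLp h1).le_of_opNorm_le (norm_opLp_le h1) (fstX d V₀ γ u)
      have b2 := (opLp h2).le_of_opNorm_le (norm_opLp_le h2) (sndX d V₀ γ u)
      have b3 := pow_le_pow_left₀ (norm_nonneg _) b1 2
      have b4 := pow_le_pow_left₀ (norm_nonneg _) b2 2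
      rw [mul_pow] at b3 b4
      rw [mul_add]
      exact add_le_add b3 b4)

theorem norm_opX_le (h1 : IsLpOp Op C 1 (weightedMeasure d V₀ γ 1))
    (h2 : IsLpOp Op C 2 (weightedMeasure d V₀ γ 2)) : ‖opX h1 h2‖ ≤ C :=
  LinearMap.mkContinuous_norm_le _ h1.nonneg _

/-- The damped transport semigroup on `X`. -/
def evolX (hγ : 0 ≤ γ) (hχ : 0 ≤ χ) (c : ℝ) (t : ℝ≥0) : X d V₀ γ →L[ℝ] X d V₀ γ :=
  opX (isLpOp_damping 1 1 hγ hχ c t) (isLpOp_damping 2 2 hγ hχ c t)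

theorem fstX_evolX (hγ : 0 ≤ γ) (hχ : 0 ≤ χ) (c : ℝ) (t : ℝ≥0) (u : X d V₀ γ) :
    fstX d V₀ γ (evolX hγ hχ c t u) = evol 1 1 hγ hχ c t (fstX d V₀ γ u) := rfl

theorem sndX_evolX (hγ : 0 ≤ γ) (hχ : 0 ≤ χ) (c : ℝ) (t : ℝ≥0) (u : X d V₀ γ) :
    sndX d V₀ γ (evolX hγ hχ c t u) = evol 2 2 hγ hχ c t (sndX d V₀ γ u) := rfl

theorem norm_evolX_le (hγ : 0 ≤ γ) (hχ : 0 ≤ χ) (c : ℝ) (t : ℝ≥0) :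
    ‖evolX (d := d) (V₀ := V₀) hγ hχ c t‖ ≤ Real.exp (-(c - χ - γ * V₀) * t) := by
  refine (norm_opX_le _ _).trans (le_of_eq ?_)
  rw [← Real.exp_add, abs_of_nonneg t.coe_nonneg]
  congr 1; ring

theorem IsFreeTransport.congr {f f' h h' : E d × E d → ℝ} (H : IsFreeTransport V₀ f h)
    (hf : f =ᵐ[phaseMeasure d V₀] f') (hh : h =ᵐ[phaseMeasure d V₀] h') :
    IsFreeTransport V₀ f' h' := by
  intro η hη
  have h1 : ∫ z, h z * η z ∂phaseMeasure d V₀ = ∫ z, h' z * η z ∂phaseMeasure d V₀ :=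
    integral_congr_ae (hh.mul (ae_eq_refl η))
  have h2 : ∫ z, f z * streamDeriv η z ∂phaseMeasure d V₀
      = ∫ z, f' z * streamDeriv η z ∂phaseMeasure d V₀ :=
    integral_congr_ae (hf.mul (ae_eq_refl (streamDeriv η)))
  rw [← h1, ← h2]
  exact H η hη

theorem isFreeTransport_congr {f f' h h' : E d × E d → ℝ}
    (hf : f =ᵐ[phaseMeasure d V₀] f') (hh : h =ᵐ[phaseMeasure d V₀] h') :
    IsFreeTransport V₀ f h ↔ IsFreeTransport V₀ f' h' :=
  ⟨fun H => H.congr hf hh, fun H => H.congr hf.symm hh.symm⟩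

theorem coeFn_turningMul {q : ℝ≥0∞} {p : ℕ} [IsNatExponent q p] [Fact (1 ≤ q)] (hγ : 0 ≤ γ)
    (hχ : χ ∈ Ioo (0 : ℝ) 1) (f : Lp ℝ q (weightedMeasure d V₀ γ p)) :
    turningMul q p hγ hχ f =ᵐ[phaseMeasure d V₀] fun z => turningKernel χ z.1 z.2 * f z :=
  coeFn_mulLp hγ (measurable_turningKernel (χ := χ)) zero_le_two
    (fun _ => abs_turningKernel_le hχ _ _) f

theorem coeFn_add_turningMul {q : ℝ≥0∞} {p : ℕ} [IsNatExponent q p] [Fact (1 ≤ q)] (hγ : 0 ≤ γ)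
    (hχ : χ ∈ Ioo (0 : ℝ) 1) (f g : Lp ℝ q (weightedMeasure d V₀ γ p)) :
    ((g + turningMul q p hγ hχ f : Lp ℝ q (weightedMeasure d V₀ γ p)) : E d × E d → ℝ)
      =ᵐ[phaseMeasure d V₀] fun z => g z + turningKernel χ z.1 z.2 * f z := by
  have h1 := Lp.coeFn_add g (turningMul q p hγ hχ f)
  rw [EventuallyEq, ae_weighted] at h1
  filter_upwards [h1, coeFn_turningMul hγ hχ f] with z a1 a2
  rw [a1, Pi.add_apply, a2]

theorem isSemigroupGeneratedBy_evolX (hd : 1 ≤ d) (hγ : 0 ≤ γ) (hχ : χ ∈ Ioo (0 : ℝ) 1) :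
    IsSemigroupGeneratedBy (fun f g : X d V₀ γ => IsFreeTransport V₀ (fstX d V₀ γ f)
      (fstX d V₀ γ g + turningMul 1 1 hγ hχ (fstX d V₀ γ f) : L1m d V₀ γ))
      (evolX hγ hχ.1.le 1) := by
  have H1 := isSemigroupGeneratedBy_evol (d := d) (V₀ := V₀) (q := 1) (p := 1) hd hγ hχ
  have H2 := isSemigroupGeneratedBy_evol (d := d) (V₀ := V₀) (q := 2) (p := 2) hd hγ hχ
  refine ⟨?_, ?_, ?_, ?_⟩
  · ext1 u
    refine ext_X ?_ ?_
    · rw [fstX_evolX, H1.map_zero]; rfl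
    · rw [sndX_evolX, H2.map_zero]; rfl
  · intro s t
    ext1 u
    refine ext_X ?_ ?_
    · rw [ContinuousLinearMap.comp_apply, fstX_evolX, fstX_evolX, fstX_evolX, H1.map_add]; rfl
    · rw [ContinuousLinearMap.comp_apply, sndX_evolX, sndX_evolX, sndX_evolX, H2.map_add]; rfl
  · intro u
    rw [continuous_iff_continuousAt]
    intro t
    rw [ContinuousAt, tendsto_X_iff]
    exact ⟨(H1.continuous (fstX d V₀ γ u)).tendsto t, (H2.continuous (sndX d V₀ γ u)).tendsto t⟩
  · intro f g
    rw [tendsto_X_iff]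
    have e1 := H1.generator (fstX d V₀ γ f) (fstX d V₀ γ g)
    have e2 := H2.generator (sndX d V₀ γ f) (sndX d V₀ γ g)
    simp only [map_smul, map_sub, fstX_evolX, sndX_evolX]
    rw [← e1, ← e2]
    -- The distributional equation sees only almost everywhere classes, so the equation in `L²`
    -- follows from the one in `L¹`.
    refine (and_iff_left_of_imp fun H => ?_).symm
    refine H.congr (fstX_ae_eq_sndX f) ?_
    filter_upwards [coeFn_add_turningMul hγ hχ (fstX d V₀ γ f) (fstX d V₀ γ g),
      coeFn_add_turningMul hγ hχ (sndX d V₀ γ f) (sndX d V₀ γ g), fstX_ae_eq_sndX f,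
      fstX_ae_eq_sndX g] with z a1 a2 a3 a4
    rw [a1, a2, a3, a4]

end Intersection

/-! ## Generation of the perturbed semigroups -/

section Collision

variable {d : ℕ} {V₀ γ χ : ℝ} {q : ℝ≥0∞} {p : ℕ}

/-- The kernel is bounded by `A` on the velocity ball and measurable. -/
structure IsBoundedKernel (V₀ A : ℝ) (κ : E d → E d → ℝ) : Prop where
  nonneg : 0 ≤ A
  aesm : AEStronglyMeasurable (fun z : E d × E d => κ z.1 z.2) (phaseMeasure d V₀)
  bound : ∀ x v, ‖v‖ < V₀ → |κ x v| ≤ A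

theorem isBoundedKernel_turning (hχ : χ ∈ Ioo (0 : ℝ) 1) :
    IsBoundedKernel V₀ 2 (turningKernel χ : E d → E d → ℝ) :=
  ⟨zero_le_two, measurable_turningKernel.aestronglyMeasurable,
    fun x v _ => abs_turningKernel_le hχ x v⟩

/-- The part of the turning kernel left after subtraction of `κ`. -/
def remainderKernel (χ : ℝ) (κ : E d → E d → ℝ) (x v : E d) : ℝ := turningKernel χ x v - κ x v

theorem IsBoundedKernel.remainder (hχ : χ ∈ Ioo (0 : ℝ) 1) {κ : E d → E d → ℝ}
    (hκ : IsBoundedKernel V₀ 2 κ) : IsBoundedKernel V₀ 4 (remainderKernel χ κ) where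
  nonneg := by norm_num
  aesm := measurable_turningKernel.aestronglyMeasurable.sub hκ.aesm
  bound := fun x v hv => by
    refine (abs_sub _ _).trans ?_
    linarith [hκ.bound x v hv, abs_turningKernel_le hχ x v]

variable (hV₀ : volume (Metric.ball (0 : E d) V₀) = 1)

variable [hqp : IsNatExponent q p] [Fact (1 ≤ q)]

variable (q p γ) in
/-- Averaging on the weighted space. -/
def averageLp {A : ℝ} {κ : E d → E d → ℝ} (hκ : IsBoundedKernel V₀ A κ) :
    Lp ℝ q (weightedMeasure d V₀ γ p) →L[ℝ] Lp ℝ q (weightedMeasure d V₀ γ p) :=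
  opLp (isLpOp_average hV₀ hqp hκ.nonneg hκ.aesm hκ.bound)

theorem coeFn_averageLp {A : ℝ} {κ : E d → E d → ℝ} (hκ : IsBoundedKernel V₀ A κ)
    (f : Lp ℝ q (weightedMeasure d V₀ γ p)) :
    averageLp γ q p hV₀ hκ f =ᵐ[phaseMeasure d V₀] average V₀ κ f := by
  have := coeFn_opLp (isLpOp_average hV₀ hqp hκ.nonneg hκ.aesm hκ.bound) f
  rwa [EventuallyEq, ae_weighted] at this

theorem norm_averageLp_le {A : ℝ} {κ : E d → E d → ℝ} (hκ : IsBoundedKernel V₀ A κ) :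
    ‖averageLp γ q p hV₀ hκ‖ ≤ A := norm_opLp_le _

variable (γ) in
/-- Averaging on `X`. -/
def averageX {A : ℝ} {κ : E d → E d → ℝ} (hκ : IsBoundedKernel V₀ A κ) :
    X d V₀ γ →L[ℝ] X d V₀ γ :=
  opX (isLpOp_average hV₀ inferInstance hκ.nonneg hκ.aesm hκ.bound)
    (isLpOp_average hV₀ inferInstance hκ.nonneg hκ.aesm hκ.bound)

theorem fstX_averageX {A : ℝ} {κ : E d → E d → ℝ} (hκ : IsBoundedKernel V₀ A κ) (u : X d V₀ γ) :
    fstX d V₀ γ (averageX γ hV₀ hκ u) = averageLp γ 1 1 hV₀ hκ (fstX d V₀ γ u) := rfl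

theorem coeFn_generator (hγ : 0 ≤ γ) (hχ : χ ∈ Ioo (0 : ℝ) 1) {A : ℝ} {κ : E d → E d → ℝ}
    (hκ : IsBoundedKernel V₀ A κ) (f g : Lp ℝ q (weightedMeasure d V₀ γ p)) :
    ((g - averageLp γ q p hV₀ hκ f + turningMul q p hγ hχ f :
      Lp ℝ q (weightedMeasure d V₀ γ p)) : E d × E d → ℝ) =ᵐ[phaseMeasure d V₀]
      fun z => g z - average V₀ κ f z + turningKernel χ z.1 z.2 * f z := by
  have h1 := Lp.coeFn_sub g (averageLp γ q p hV₀ hκ f)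
  rw [EventuallyEq, ae_weighted] at h1
  filter_upwards [h1, coeFn_add_turningMul hγ hχ f (g - averageLp γ q p hV₀ hκ f),
    coeFn_averageLp hV₀ hκ f] with z a1 a2 a3
  rw [a2, a1, Pi.sub_apply, a3]

/-- The unit volume of the ball lets the loss term `K f` leave the integral over `v'`. What remains
is a bounded perturbation of damped transport, whatever kernel `κ` is subtracted. -/
theorem isL_iff (hγ : 0 ≤ γ) (hχ : χ ∈ Ioo (0 : ℝ) 1) {κ : E d → E d → ℝ}
    (hκ : IsBoundedKernel V₀ 2 κ) (f g : Lp ℝ q (weightedMeasure d V₀ γ p)) :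
    IsL V₀ χ f (average V₀ κ f + g) ↔ IsFreeTransport V₀ f
      (g - averageLp γ q p hV₀ (hκ.remainder hχ) f + turningMul q p hγ hχ f :
        Lp ℝ q (weightedMeasure d V₀ γ p)) := by
  have := isProbabilityMeasure_velMeasure hV₀
  rw [isFreeTransport_congr (ae_eq_refl _) (coeFn_generator hV₀ hγ hχ (hκ.remainder hχ) f g)]
  refine forall₂_congr fun η hη => ?_
  have hf := Lp.memLp f
  have hT := isBoundedKernel_turning (d := d) (V₀ := V₀) hχ
  have i1 := ae_integrable_kernel_mul hqp hκ.aesm hκ.bound hf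
  have i2 := ae_integrable_kernel_mul hqp hT.aesm hT.bound hf
  have mT : MemLp (fun z => turningKernel χ z.1 z.2 * f z) q (weightedMeasure d V₀ γ p) := by
    refine (Lp.memLp (turningMul q p hγ hχ f)).ae_eq ?_
    rw [EventuallyEq, ae_weighted]
    exact coeFn_turningMul hγ hχ f
  have mκ := (isLpOp_average hV₀ hqp hκ.nonneg hκ.aesm hκ.bound).memLp hf
  have mA := (isLpOp_average hV₀ hqp hT.nonneg hT.aesm hT.bound).memLp hf
  have I : ∀ {F : E d × E d → ℝ}, MemLp F q (weightedMeasure d V₀ γ p) →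
      Integrable (fun z => F z * η z) (phaseMeasure d V₀) := fun hF =>
    integrable_mul_compact hγ hF hη.smooth.continuous hη.compact
  have e1 : ∫ z, (average V₀ κ f + g) z * η z ∂phaseMeasure d V₀
      = ∫ z, average V₀ κ f z * η z ∂phaseMeasure d V₀ + ∫ z, g z * η z ∂phaseMeasure d V₀ := by
    rw [← integral_add (I mκ) (I (Lp.memLp g))]
    simp only [Pi.add_apply, add_mul]
  have e2 : ∫ z, (∫ v' in Metric.ball 0 V₀,
        (turningKernel χ z.1 v' * f (z.1, v') - turningKernel χ z.1 z.2 * f z)) * η z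
        ∂phaseMeasure d V₀ = ∫ z, average V₀ (turningKernel χ) f z * η z ∂phaseMeasure d V₀
        - ∫ z, turningKernel χ z.1 z.2 * f z * η z ∂phaseMeasure d V₀ := by
    rw [← integral_sub (I mA) (I mT)]
    refine integral_congr_ae ?_
    filter_upwards [ae_fst i2] with z hz
    rw [integral_sub hz (integrable_const _)]
    simp only [integral_const, probReal_univ, one_smul, average]
    ring
  have e3 : ∫ z, (g z - average V₀ (remainderKernel χ κ) f z + turningKernel χ z.1 z.2 * f z) * η z
      ∂phaseMeasure d V₀ = ∫ z, g z * η z ∂phaseMeasure d V₀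
        - ∫ z, average V₀ (turningKernel χ) f z * η z ∂phaseMeasure d V₀
        + ∫ z, average V₀ κ f z * η z ∂phaseMeasure d V₀
        + ∫ z, turningKernel χ z.1 z.2 * f z * η z ∂phaseMeasure d V₀ := by
    rw [← integral_sub' (I (Lp.memLp g)) (I mA),
      ← integral_add' ((I (Lp.memLp g)).sub (I mA)) (I mκ),
      ← integral_add' (((I (Lp.memLp g)).sub (I mA)).add (I mκ)) (I mT)]
    refine integral_congr_ae ?_
    filter_upwards [ae_fst i1, ae_fst i2] with z h1 h2
    have : average V₀ (remainderKernel χ κ) f z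
        = average V₀ (turningKernel χ) f z - average V₀ κ f z := by
      simp only [average, remainderKernel, sub_mul]
      exact integral_sub h2 h1
    rw [this]
    simp only [Pi.add_apply, Pi.sub_apply]
    ring
  rw [e1, e2, e3]
  simp only [streamDeriv]
  constructor <;> intro h <;> linarith

theorem norm_le_one_of_le_exp {b : ℝ} (hb : 0 ≤ b) {x : ℝ} {t : ℝ≥0} (h : x ≤ Real.exp (-b * t)) :
    x ≤ 1 :=
  h.trans (Real.exp_le_one_iff.2 (by nlinarith [t.coe_nonneg]))

/-- The condition `hb` says that damping beats the growth of the weight, so the unperturbed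
semigroup is a contraction. -/
theorem exists_semigroup_Lp (hd : 1 ≤ d) (hγ : 0 ≤ γ) (hχ : χ ∈ Ioo (0 : ℝ) 1)
    (hb : 0 ≤ 1 - χ - γ * V₀) {κ : E d → E d → ℝ} (hκ : IsBoundedKernel V₀ 2 κ) :
    ∃ S : ℝ≥0 → Lp ℝ q (weightedMeasure d V₀ γ p) →L[ℝ] Lp ℝ q (weightedMeasure d V₀ γ p),
      IsSemigroupGeneratedBy (fun f g : Lp ℝ q (weightedMeasure d V₀ γ p) =>
        IsL V₀ χ f (average V₀ κ f + g)) S ∧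
      ∀ f, Tendsto (fun t : ℝ≥0 => (t : ℝ)⁻¹ • (S t f - evol q p hγ hχ.1.le 1 t f)) (𝓝[>] 0)
        (𝓝 (averageLp γ q p hV₀ (hκ.remainder hχ) f)) := by
  obtain ⟨S, h1, -, h3⟩ := exists_perturbation
    (isSemigroupGeneratedBy_evol (d := d) (V₀ := V₀) (q := q) (p := p) hd hγ hχ)
    (fun t => norm_le_one_of_le_exp hb (norm_evol_le hγ hχ.1.le 1 t))
    (averageLp γ q p hV₀ (hκ.remainder hχ))
  refine ⟨S, ?_, h3⟩
  convert h1 using 3 with f g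
  exact isL_iff hV₀ hγ hχ hκ f g

theorem exists_semigroup_X (hd : 1 ≤ d) (hγ : 0 ≤ γ) (hχ : χ ∈ Ioo (0 : ℝ) 1)
    (hb : 0 ≤ 1 - χ - γ * V₀) {κ : E d → E d → ℝ} (hκ : IsBoundedKernel V₀ 2 κ) :
    ∃ S : ℝ≥0 → X d V₀ γ →L[ℝ] X d V₀ γ,
      IsSemigroupGeneratedBy (fun f g : X d V₀ γ =>
        IsL V₀ χ f.1.fst (average V₀ κ f.1.fst + g.1.fst)) S ∧
      (∀ f, IsMild (evolX hγ hχ.1.le 1) (averageX γ hV₀ (hκ.remainder hχ)) f (fun t => S t f)) ∧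
      ∀ f, Tendsto (fun t : ℝ≥0 => (t : ℝ)⁻¹ • (S t f - evolX hγ hχ.1.le 1 t f)) (𝓝[>] 0)
        (𝓝 (averageX γ hV₀ (hκ.remainder hχ) f)) := by
  obtain ⟨S, h1, h2, h3⟩ := exists_perturbation
    (isSemigroupGeneratedBy_evolX (d := d) (V₀ := V₀) hd hγ hχ)
    (fun t => norm_le_one_of_le_exp hb (norm_evolX_le hγ hχ.1.le 1 t))
    (averageX γ hV₀ (hκ.remainder hχ))
  refine ⟨S, ?_, h2, h3⟩
  convert h1 using 3 with f g
  exact isL_iff hV₀ hγ hχ hκ (fstX d V₀ γ f) (fstX d V₀ γ g)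

end Collision

/-! ## Lyapunov weights and decay in `L^1(m)` -/

section Lyapunov

variable {d : ℕ} {V₀ γ χ : ℝ}

theorem integrable_weight_mul (f : L1m d V₀ γ) :
    Integrable (fun z => weight γ z.1 * f z) (phaseMeasure d V₀) :=
  memLp_one_iff_integrable.1 ((memLp_weighted_iff inferInstance).1 (Lp.memLp f))

theorem norm_L1m (f : L1m d V₀ γ) : ‖f‖ = ∫ z, weight γ z.1 * |f z| ∂phaseMeasure d V₀ := by
  rw [Lp.norm_def, eLpNorm_weighted inferInstance, eLpNorm_one_eq_lintegral_enorm,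
    ← integral_norm_eq_lintegral_enorm (integrable_weight_mul f).1]
  refine integral_congr_ae (ae_of_all _ fun z => ?_)
  simp only [norm_mul, Real.norm_eq_abs, abs_of_pos (weight_pos (γ := γ) z.1)]

theorem integrable_of_le_weight {F : E d × E d → ℝ} (f : L1m d V₀ γ) (B : ℝ)
    (hF : AEStronglyMeasurable F (phaseMeasure d V₀))
    (h : ∀ᵐ z ∂phaseMeasure d V₀, |F z| ≤ B * (weight γ z.1 * |f z|)) :
    Integrable F (phaseMeasure d V₀) := by
  refine ((integrable_weight_mul f).norm.const_mul B).mono' hF ?_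
  filter_upwards [h] with z hz
  refine hz.trans (le_of_eq ?_)
  rw [norm_mul, Real.norm_eq_abs, Real.norm_eq_abs, abs_of_pos (weight_pos (γ := γ) z.1)]

theorem aesm_L1m (f : L1m d V₀ γ) : AEStronglyMeasurable f (phaseMeasure d V₀) :=
  aesm_weighted_iff.1 (Lp.memLp f).1

/-- A weight which decays at rate `a` along the dynamics of the transport operator with collision
gain kernel `κ`. -/
structure IsLyapunov (V₀ γ χ a C : ℝ) (κ : E d → E d → ℝ) (w : E d × E d → ℝ) : Prop where
  measurable : Measurable w
  lower : ∀ z, ‖z.2‖ < V₀ → 1 / 2 * weight γ z.1 ≤ w z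
  upper : ∀ z, ‖z.2‖ < V₀ → w z ≤ C * weight γ z.1
  super : ∃ h₀ > 0, ∃ D : ℝ, ∀ h : ℝ, 0 < h → h < h₀ → ∀ z : E d × E d, ‖z.2‖ < V₀ →
    damping 1 χ h (flow h z) * w (flow h z) ≤ w z
      + h * (a * w z - |κ z.1 z.2| * ∫ v in Metric.ball 0 V₀, w (z.1, v))
      + D * h ^ 2 * weight γ z.1

variable {a C A : ℝ} {κ : E d → E d → ℝ} {w : E d × E d → ℝ}

/-- The norm associated to the weight `w`. -/
def wnorm (w : E d × E d → ℝ) (f : L1m d V₀ γ) : ℝ := ∫ z, |f z| * w z ∂phaseMeasure d V₀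

namespace IsLyapunov

variable (hw : IsLyapunov V₀ γ χ a C κ w)

include hw

theorem nonneg {z : E d × E d} (hz : ‖z.2‖ < V₀) : 0 ≤ w z :=
  le_trans (by have := weight_pos (γ := γ) z.1; positivity) (hw.lower z hz)

theorem integrable (f : L1m d V₀ γ) :
    Integrable (fun z => |f z| * w z) (phaseMeasure d V₀) := by
  refine integrable_of_le_weight f C ((aesm_L1m f).norm.mul hw.measurable.aestronglyMeasurable) ?_
  filter_upwards [ae_velocity_lt] with z hz
  rw [abs_mul, abs_abs, abs_of_nonneg (hw.nonneg hz)]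
  calc |f z| * w z ≤ |f z| * (C * weight γ z.1) := by gcongr; exact hw.upper z hz
    _ = _ := by ring

theorem wnorm_le (f : L1m d V₀ γ) : wnorm w f ≤ C * ‖f‖ := by
  rw [norm_L1m, ← integral_const_mul]
  refine integral_mono_ae (hw.integrable f) ?_ ?_
  · refine ((integrable_weight_mul f).norm.const_mul C).congr (ae_of_all _ fun z => ?_)
    simp only [norm_mul, Real.norm_eq_abs, abs_of_pos (weight_pos (γ := γ) z.1)]
  · filter_upwards [ae_velocity_lt] with z hz
    calc |f z| * w z ≤ |f z| * (C * weight γ z.1) := by gcongr; exact hw.upper z hz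
      _ = _ := by ring

theorem le_wnorm (f : L1m d V₀ γ) : 1 / 2 * ‖f‖ ≤ wnorm w f := by
  rw [norm_L1m, ← integral_const_mul]
  refine integral_mono_ae ?_ (hw.integrable f) ?_
  · refine ((integrable_weight_mul f).norm.const_mul (1 / 2)).congr (ae_of_all _ fun z => ?_)
    simp only [norm_mul, Real.norm_eq_abs, abs_of_pos (weight_pos (γ := γ) z.1)]
  · filter_upwards [ae_velocity_lt] with z hz
    calc _ = |f z| * (1 / 2 * weight γ z.1) := by ring
      _ ≤ _ := by gcongr; exact hw.lower z hz

theorem wnorm_add_le (f g : L1m d V₀ γ) : wnorm w (f + g) ≤ wnorm w f + wnorm w g := by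
  rw [wnorm, wnorm, wnorm, ← integral_add (hw.integrable f) (hw.integrable g)]
  refine integral_mono_ae (hw.integrable _) ((hw.integrable f).add (hw.integrable g)) ?_
  have h := Lp.coeFn_add f g
  rw [EventuallyEq, ae_weighted] at h
  filter_upwards [ae_velocity_lt, h] with z hz h1
  rw [h1, Pi.add_apply, ← add_mul]
  exact mul_le_mul_of_nonneg_right (abs_add_le _ _) (hw.nonneg hz)

omit hw in
theorem wnorm_smul (c : ℝ) (f : L1m d V₀ γ) : wnorm w (c • f) = |c| * wnorm w f := by
  rw [wnorm, wnorm, ← integral_const_mul]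
  refine integral_congr_ae ?_
  have h := Lp.coeFn_smul c f
  rw [EventuallyEq, ae_weighted] at h
  filter_upwards [h] with z h1
  rw [h1, Pi.smul_apply, smul_eq_mul, abs_mul, mul_assoc]

theorem continuous_wnorm : Continuous (wnorm w : L1m d V₀ γ → ℝ) := by
  have key : ∀ f g : L1m d V₀ γ, wnorm w f - wnorm w g ≤ C * ‖f - g‖ := fun f g => by
    have h1 := hw.wnorm_add_le g (f - g)
    rw [add_sub_cancel] at h1
    linarith [hw.wnorm_le (f - g)]
  refine (LipschitzWith.of_dist_le_mul (K := C.toNNReal) fun f g => ?_).continuous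
  have h3 : C * ‖f - g‖ ≤ C.toNNReal * ‖f - g‖ := by
    gcongr; exact Real.le_coe_toNNReal C
  rw [dist_eq_norm, dist_eq_norm, Real.norm_eq_abs, abs_le]
  have h1 := key f g
  have h2 := key g f
  rw [norm_sub_rev] at h2
  constructor <;> linarith

omit hw in
-- The invariant change of variables along the flow transfers the evolution of `f` to the weight.
theorem wnorm_evol (hγ : 0 ≤ γ) (hχ : 0 ≤ χ) (h : ℝ≥0) (f : L1m d V₀ γ) :
    wnorm w (evol 1 1 hγ hχ 1 h f)
      = ∫ z, |f z| * (damping 1 χ h (flow h z) * w (flow h z)) ∂phaseMeasure d V₀ := by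
  rw [wnorm, ← integral_flow h]
  refine integral_congr_ae ?_
  filter_upwards [ae_flow h (coeFn_evol hγ hχ 1 h f)] with z hz
  rw [hz, transportOp, flow_add, abs_mul, abs_of_pos (damping_pos _ _ _)]
  simp only [neg_add_cancel, flow_zero]
  ring

variable (hV₀ : volume (Metric.ball (0 : E d) V₀) = 1) (hκ : IsBoundedKernel V₀ A κ)

theorem integrable_fiber (x : E d) : Integrable (fun v => w (x, v)) (velMeasure d V₀) := by
  refine Integrable.of_bound (hw.measurable.comp measurable_prodMk_left).aestronglyMeasurable
    (C * weight γ x) ?_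
  filter_upwards [ae_restrict_mem measurableSet_ball] with v hv
  have hv' : ‖v‖ < V₀ := by simpa using hv
  rw [Real.norm_eq_abs, abs_of_nonneg (hw.nonneg (z := (x, v)) hv')]
  exact hw.upper (x, v) hv'

theorem fiber_nonneg (x : E d) : 0 ≤ ∫ v in Metric.ball 0 V₀, w (x, v) := by
  refine integral_nonneg_of_ae ?_
  filter_upwards [ae_restrict_mem measurableSet_ball] with v hv
  exact hw.nonneg (z := (x, v)) (by simpa using hv)

include hV₀ in
theorem fiber_le (x : E d) : ∫ v in Metric.ball 0 V₀, w (x, v) ≤ C * weight γ x := by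
  have := isProbabilityMeasure_velMeasure hV₀
  calc ∫ v in Metric.ball 0 V₀, w (x, v) ≤ ∫ _ in Metric.ball (0 : E d) V₀, C * weight γ x := by
        refine integral_mono_ae (hw.integrable_fiber x) (integrable_const _) ?_
        filter_upwards [ae_restrict_mem measurableSet_ball] with v hv
        exact hw.upper (x, v) (by simpa using hv)
    _ = _ := by simp only [integral_const, probReal_univ, smul_eq_mul, one_mul]

theorem measurable_fiber : Measurable fun x : E d => ∫ v in Metric.ball 0 V₀, w (x, v) :=
  hw.measurable.stronglyMeasurable.integral_prod_right'.measurable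

include hκ hV₀ in
theorem integrable_gain (f : L1m d V₀ γ) : Integrable (fun z => |f z| * (|κ z.1 z.2| *
    ∫ v in Metric.ball 0 V₀, w (z.1, v))) (phaseMeasure d V₀) := by
  refine integrable_of_le_weight f (A * C) ((aesm_L1m f).norm.mul (hκ.aesm.norm.mul
    (hw.measurable_fiber.comp measurable_fst).aestronglyMeasurable)) ?_
  filter_upwards [ae_velocity_lt] with z hz
  rw [abs_mul, abs_mul, abs_abs, abs_abs, abs_of_nonneg (hw.fiber_nonneg z.1)]
  calc |f z| * (|κ z.1 z.2| * ∫ v in Metric.ball 0 V₀, w (z.1, v))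
      ≤ |f z| * (A * (C * weight γ z.1)) := by
        have := hκ.nonneg
        gcongr
        · exact hw.fiber_nonneg z.1
        · exact hκ.bound _ _ hz
        · exact hw.fiber_le hV₀ z.1
    _ = _ := by ring

/-- The average does not depend on `v`, so on each fibre it factors out of the integral against `w`;
this is the dual form of the gain term. -/
theorem wnorm_average_le (f : L1m d V₀ γ) : wnorm w (averageLp γ 1 1 hV₀ hκ f)
    ≤ ∫ z, |f z| * (|κ z.1 z.2| * ∫ v in Metric.ball 0 V₀, w (z.1, v)) ∂phaseMeasure d V₀ := by
  have i1 := hw.integrable (averageLp γ 1 1 hV₀ hκ f)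
  have i2 := hw.integrable_gain hV₀ hκ f
  have h1 : (fun z => |averageLp γ 1 1 hV₀ hκ f z| * w z) =ᵐ[phaseMeasure d V₀]
      fun z => |average V₀ κ f z| * w z := by
    filter_upwards [coeFn_averageLp hV₀ hκ f] with z hz
    rw [hz]
  rw [wnorm, integral_congr_ae h1]
  replace i1 := i1.congr h1
  unfold phaseMeasure at i1 i2 ⊢
  rw [integral_prod _ i1, integral_prod _ i2]
  refine integral_mono_ae i1.integral_prod_left i2.integral_prod_left ?_
  refine ae_of_all _ fun x => ?_
  have e : ∀ v : E d, average V₀ κ f (x, v) = average V₀ κ f (x, 0) := fun _ => rfl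
  simp only [e]
  rw [integral_const_mul]
  have e2 : ∫ v in Metric.ball 0 V₀, |f (x, v)| * (|κ x v| * ∫ v' in Metric.ball 0 V₀, w (x, v'))
      = (∫ v in Metric.ball 0 V₀, |κ x v * f (x, v)|) * ∫ v' in Metric.ball 0 V₀, w (x, v') := by
    rw [← integral_mul_const]
    refine integral_congr_ae (ae_of_all _ fun v => ?_)
    simp only [abs_mul]
    ring
  rw [e2]
  exact mul_le_mul_of_nonneg_right (abs_integral_le_integral_abs) (hw.fiber_nonneg x)

/-- The supersolution inequality is used over a finite step with error `O(h²)`, so `w` need not be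
differentiable where `x·v` changes sign. -/
theorem wnorm_step (hγ : 0 ≤ γ) (hχ : 0 ≤ χ) : ∃ h₀ > 0, ∃ D : ℝ, ∀ h : ℝ≥0, 0 < h → h < h₀ →
    ∀ f : L1m d V₀ γ, wnorm w (evol 1 1 hγ hχ 1 h f) + h * wnorm w (averageLp γ 1 1 hV₀ hκ f)
      ≤ wnorm w f + h * (a * wnorm w f) + D * h ^ 2 * ‖f‖ := by
  obtain ⟨h₀, hh₀, D, hD⟩ := hw.super
  refine ⟨h₀.toNNReal, by simpa using hh₀, D, fun h hh hhh f => ?_⟩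
  have hh' : (0 : ℝ) < h := by exact_mod_cast hh
  have hhh' : (h : ℝ) < h₀ := by
    have : (h : ℝ) < h₀.toNNReal := by exact_mod_cast hhh
    rwa [Real.coe_toNNReal _ hh₀.le] at this
  have i0 := hw.integrable f
  have i1 := hw.integrable_gain hV₀ hκ f
  have i2 : Integrable (fun z => weight γ z.1 * |f z|) (phaseMeasure d V₀) := by
    refine (integrable_weight_mul f).norm.congr (ae_of_all _ fun z => ?_)
    simp only [norm_mul, Real.norm_eq_abs, abs_of_pos (weight_pos (γ := γ) z.1)]
  have h1 : wnorm w (evol 1 1 hγ hχ 1 h f) ≤ ∫ z, ((1 + h * a) * (|f z| * w z)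
      - h * (|f z| * (|κ z.1 z.2| * ∫ v in Metric.ball 0 V₀, w (z.1, v)))
      + D * h ^ 2 * (weight γ z.1 * |f z|)) ∂phaseMeasure d V₀ := by
    rw [wnorm_evol]
    refine integral_mono_of_nonneg ?_
      (((i0.const_mul _).sub (i1.const_mul _)).add (i2.const_mul _)) ?_
    · filter_upwards [ae_velocity_lt] with z hz
      exact mul_nonneg (abs_nonneg _) (mul_nonneg (damping_pos _ _ _).le (hw.nonneg hz))
    · filter_upwards [ae_velocity_lt] with z hz
      have := mul_le_mul_of_nonneg_left (hD h hh' hhh' z hz) (abs_nonneg (f z))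
      refine this.trans (le_of_eq ?_)
      ring
  have i3 := (i0.const_mul (1 + h * a)).sub (i1.const_mul (h : ℝ))
  rw [integral_add (f := fun z => (1 + h * a) * (|f z| * w z)
      - h * (|f z| * (|κ z.1 z.2| * ∫ v in Metric.ball 0 V₀, w (z.1, v)))) i3 (i2.const_mul _),
    integral_sub (i0.const_mul _) (i1.const_mul _), integral_const_mul, integral_const_mul,
    integral_const_mul, ← norm_L1m] at h1
  have h2 := mul_le_mul_of_nonneg_left (hw.wnorm_average_le hV₀ hκ f) hh'.le
  change _ ≤ (1 + h * a) * wnorm w f - _ + _ at h1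
  linarith

/-- The right difference quotients of `t ↦ wnorm w (u t)` are asymptotically at most `a` times its
value, and Gronwall's lemma applies. Working with a curve rather than a semigroup also covers the
`L¹` component of a semigroup on `X`. -/
theorem wnorm_le_exp (hγ : 0 ≤ γ) (hχ : 0 ≤ χ) {u : ℝ≥0 → L1m d V₀ γ} (hu : Continuous u)
    (hgen : ∀ t, Tendsto (fun h : ℝ≥0 => (h : ℝ)⁻¹ • (u (h + t) - evol 1 1 hγ hχ 1 h (u t)))
      (𝓝[>] 0) (𝓝 (averageLp γ 1 1 hV₀ hκ (u t)))) (t : ℝ≥0) :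
    wnorm w (u t) ≤ wnorm w (u 0) * Real.exp (a * t) := by
  obtain ⟨h₀, hh₀, D, hstep⟩ := hw.wnorm_step hV₀ hκ hγ hχ
  set n : ℝ → ℝ := fun s => wnorm w (u s.toNNReal) with hn
  have hnc : Continuous n := hw.continuous_wnorm.comp (hu.comp continuous_real_toNNReal)
  have key : ∀ s ∈ Icc (0 : ℝ) t, n s ≤ gronwallBound (n 0) a 0 (s - 0) := by
    refine le_gronwallBound_of_liminf_deriv_right_le (f' := fun s => a * n s) hnc.continuousOn
      ?_ le_rfl (fun s _ => by simp)
    intro s hs r hr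
    set v := u s.toNNReal with hv
    have hbound : ∀ h : ℝ≥0, 0 < h → h < h₀ → (h : ℝ)⁻¹ * (n (s + h) - n s) ≤ a * n s
        + D * h * ‖v‖ + C * ‖(h : ℝ)⁻¹ • (u (h + s.toNNReal) - evol 1 1 hγ hχ 1 h v)
          - averageLp γ 1 1 hV₀ hκ v‖ := by
      intro h hh hhh
      have hh' : (0 : ℝ) < h := by exact_mod_cast hh
      set ρ := (h : ℝ)⁻¹ • (u (h + s.toNNReal) - evol 1 1 hγ hχ 1 h v)
          - averageLp γ 1 1 hV₀ hκ v with hρ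
      -- First order splitting of one step; `ρ` tends to `0` by `hgen`.
      have e : u (h + s.toNNReal) = evol 1 1 hγ hχ 1 h v + (h : ℝ) • averageLp γ 1 1 hV₀ hκ v
          + (h : ℝ) • ρ := by
        rw [hρ, smul_sub, smul_smul, mul_inv_cancel₀ hh'.ne', one_smul]; abel
      have e2 : n (s + h) = wnorm w (u (h + s.toNNReal)) := by
        rw [hn]
        beta_reduce
        rw [Real.toNNReal_add hs.1 h.coe_nonneg, Real.toNNReal_coe, add_comm]
      have h1 := (hw.wnorm_add_le (evol 1 1 hγ hχ 1 h v + (h : ℝ) • averageLp γ 1 1 hV₀ hκ v)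
        ((h : ℝ) • ρ)).trans (add_le_add_left (hw.wnorm_add_le _ _) _)
      rw [← e, wnorm_smul, wnorm_smul, abs_of_pos hh'] at h1
      have h2 := hstep h hh hhh v
      have h3 := mul_le_mul_of_nonneg_left (hw.wnorm_le ρ) hh'.le
      rw [e2, inv_mul_le_iff₀ hh']
      change _ - wnorm w v ≤ h * (a * wnorm w v + _ + _)
      nlinarith
    have hlim : Tendsto (fun h : ℝ≥0 => a * n s
        + D * h * ‖v‖ + C * ‖(h : ℝ)⁻¹ • (u (h + s.toNNReal) - evol 1 1 hγ hχ 1 h v)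
          - averageLp γ 1 1 hV₀ hκ v‖) (𝓝[>] 0) (𝓝 (a * n s)) := by
      have h1 := (tendsto_iff_norm_sub_tendsto_zero.1 (hgen s.toNNReal)).const_mul C
      have h2 : Tendsto (fun h : ℝ≥0 => a * n s + D * h * ‖v‖) (𝓝[>] 0) (𝓝 (a * n s)) := by
        have : Continuous fun h : ℝ≥0 => a * n s + D * h * ‖v‖ := by fun_prop
        simpa using (this.tendsto 0).mono_left (nhdsWithin_le_nhds (s := Ioi 0))
      simpa using h2.add h1
    have hev : ∀ᶠ h : ℝ≥0 in 𝓝[>] 0, (h : ℝ)⁻¹ * (n (s + h) - n s) < r := by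
      filter_upwards [hlim.eventually_lt_const hr, self_mem_nhdsWithin,
        nhdsWithin_le_nhds (gt_mem_nhds hh₀)] with h h1 h2 h3
      exact (hbound h h2 h3).trans_lt h1
    have hmap : Tendsto (fun h : ℝ≥0 => s + (h : ℝ)) (𝓝[>] 0) (𝓝[>] s) := by
      refine tendsto_nhdsWithin_iff.2 ⟨?_, ?_⟩
      · have : Continuous fun h : ℝ≥0 => s + (h : ℝ) := by fun_prop
        simpa using (this.tendsto 0).mono_left (nhdsWithin_le_nhds (s := Ioi 0))
      · filter_upwards [self_mem_nhdsWithin] with h hh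
        have : (0 : ℝ) < h := by exact_mod_cast hh
        simpa using this
    refine hmap.frequently (hev.frequently.mono fun h hh => ?_)
    simpa using hh
  have := key t ⟨t.coe_nonneg, le_rfl⟩
  rw [gronwallBound_ε0, sub_zero, hn] at this
  simpa using this

theorem norm_le_exp (hγ : 0 ≤ γ) (hχ : 0 ≤ χ) {u : ℝ≥0 → L1m d V₀ γ} (hu : Continuous u)
    (hgen : ∀ t, Tendsto (fun h : ℝ≥0 => (h : ℝ)⁻¹ • (u (h + t) - evol 1 1 hγ hχ 1 h (u t)))
      (𝓝[>] 0) (𝓝 (averageLp γ 1 1 hV₀ hκ (u t)))) (t : ℝ≥0) :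
    ‖u t‖ ≤ 2 * C * Real.exp (a * t) * ‖u 0‖ := by
  have h1 := hw.wnorm_le_exp hV₀ hκ hγ hχ hu hgen t
  have h2 := hw.le_wnorm (u t)
  have h3 := mul_le_mul_of_nonneg_right (hw.wnorm_le (u 0)) (Real.exp_nonneg (a * t))
  linarith

end IsLyapunov

end Lyapunov

/-! ### The weight along trajectories, and the corrector -/

section Weight

variable {d : ℕ} {V₀ γ χ : ℝ}

/-- The rate of change of the Japanese bracket of the position along the flow. -/
def radialSpeed (z : E d × E d) : ℝ := inner ℝ z.1 z.2 / √(1 + ‖z.1‖ ^ 2)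

theorem abs_inner_le_japanese (z : E d × E d) :
    |inner ℝ z.1 z.2| ≤ √(1 + ‖z.1‖ ^ 2) * ‖z.2‖ :=
  (abs_real_inner_le_norm _ _).trans (by gcongr; exact norm_le_japanese _)

theorem abs_radialSpeed_le (z : E d × E d) : |radialSpeed z| ≤ ‖z.2‖ := by
  have h := one_le_japanese z.1
  rw [radialSpeed, abs_div, abs_of_pos (by linarith : 0 < √(1 + ‖z.1‖ ^ 2)),
    div_le_iff₀ (by linarith), mul_comm]
  exact abs_inner_le_japanese z

/-- The square of the new bracket is an explicit quadratic in `h`; `2jj' ≤ j² + j'²` and `j ≥ 1`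
convert it into a bound on the bracket itself. -/
theorem japanese_flow_le (h : ℝ) (z : E d × E d) :
    √(1 + ‖(flow h z).1‖ ^ 2)
      ≤ √(1 + ‖z.1‖ ^ 2) + h * radialSpeed z + h ^ 2 * ‖z.2‖ ^ 2 / 2 := by
  have hj := one_le_japanese z.1
  have hsq : √(1 + ‖z.1‖ ^ 2) ^ 2 = 1 + ‖z.1‖ ^ 2 := Real.sq_sqrt (by positivity)
  have hsq' : √(1 + ‖(flow h z).1‖ ^ 2) ^ 2 = 1 + ‖(flow h z).1‖ ^ 2 :=
    Real.sq_sqrt (by positivity)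
  have hs : radialSpeed z * √(1 + ‖z.1‖ ^ 2) = inner ℝ z.1 z.2 :=
    div_mul_cancel₀ _ (by linarith)
  have hn : ‖(flow h z).1‖ ^ 2 = ‖z.1‖ ^ 2 + 2 * (h * inner ℝ z.1 z.2) + h ^ 2 * ‖z.2‖ ^ 2 := by
    rw [flow, norm_add_sq_real, inner_smul_right, norm_smul, mul_pow, Real.norm_eq_abs, sq_abs]
  set j := √(1 + ‖z.1‖ ^ 2)
  set j' := √(1 + ‖(flow h z).1‖ ^ 2)
  rw [hn, ← hs] at hsq'
  have h0 : 0 ≤ h ^ 2 * ‖z.2‖ ^ 2 := by positivity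
  have h1 : 0 ≤ (j' - j) ^ 2 := sq_nonneg _
  have h2 : j * j' ≤ j * (j + h * radialSpeed z + h ^ 2 * ‖z.2‖ ^ 2 / 2) := by nlinarith
  exact le_of_mul_le_mul_left h2 (by linarith)

theorem le_japanese_flow {h : ℝ} (hh : 0 ≤ h) (z : E d × E d) :
    √(1 + ‖z.1‖ ^ 2) ≤ √(1 + ‖(flow h z).1‖ ^ 2) + h * ‖z.2‖ := by
  have := japanese_add_le (z.1 + h • z.2) (-(h • z.2))
  rwa [add_neg_cancel_right, norm_neg, norm_smul, Real.norm_eq_abs, abs_of_nonneg hh] at this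

/-- The gain of `1/⟨x⟩` in the first order term is what makes this variation negligible for `|x| ≥
R`. -/
theorem abs_radialSpeed_flow_sub_le {h : ℝ} (hh : 0 ≤ h) (z : E d × E d) :
    |radialSpeed (flow h z) - radialSpeed z|
      ≤ 2 * h * ‖z.2‖ ^ 2 / √(1 + ‖z.1‖ ^ 2) + 2 * h ^ 2 * ‖z.2‖ ^ 3 := by
  have hj := one_le_japanese z.1
  have hj' := one_le_japanese (flow h z).1
  have h1 := le_japanese_flow hh z
  have h2 := japanese_add_le z.1 (h • z.2)
  rw [norm_smul, Real.norm_eq_abs, abs_of_nonneg hh] at h2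
  change √(1 + ‖(flow h z).1‖ ^ 2) ≤ _ at h2
  have hr := abs_inner_le_japanese z
  rw [radialSpeed, radialSpeed, inner_flow]
  set j := √(1 + ‖z.1‖ ^ 2)
  set j' := √(1 + ‖(flow h z).1‖ ^ 2)
  set r : ℝ := inner ℝ z.1 z.2
  have hv := norm_nonneg z.2
  have e1 : (r + h * ‖z.2‖ ^ 2) / j' - r / j = (h * ‖z.2‖ ^ 2 * j + r * (j - j')) / (j * j') := by
    field_simp; ring
  have hjj : |j - j'| ≤ h * ‖z.2‖ := abs_le.2 ⟨by linarith, by linarith⟩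
  rw [e1, abs_div, abs_of_pos (by positivity : 0 < j * j')]
  have e2 : |h * ‖z.2‖ ^ 2 * j + r * (j - j')| ≤ 2 * h * ‖z.2‖ ^ 2 * j := by
    refine (abs_add_le _ _).trans ?_
    rw [abs_mul r, abs_of_nonneg (by positivity : 0 ≤ h * ‖z.2‖ ^ 2 * j)]
    have : |r| * |j - j'| ≤ j * ‖z.2‖ * (h * ‖z.2‖) := by gcongr
    nlinarith
  have e3 : 2 * h * ‖z.2‖ ^ 2 * j / (j * j') ≤ 2 * h * ‖z.2‖ ^ 2 / j + 2 * h ^ 2 * ‖z.2‖ ^ 3 := by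
    rw [div_add' _ _ _ (by positivity), div_le_div_iff₀ (by positivity) (by positivity)]
    have h3 : 0 ≤ 2 * h * ‖z.2‖ ^ 2 * j := by positivity
    have h4 : j ≤ j' * (1 + h * ‖z.2‖ * j) := by
      nlinarith [mul_nonneg hh hv, mul_nonneg (mul_nonneg hh hv) (by nlinarith : 0 ≤ j * j' - 1)]
    calc _ = 2 * h * ‖z.2‖ ^ 2 * j * j := by ring
      _ ≤ 2 * h * ‖z.2‖ ^ 2 * j * (j' * (1 + h * ‖z.2‖ * j)) := by gcongr
      _ = _ := by ring
  exact (div_le_div_of_nonneg_right e2 (by positivity)).trans e3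

/-- Convexity of the absolute value, with `sign` as a subgradient: the bound holds even when `x·v`
changes sign during the step. -/
theorem damping_flow_le (hχ : 0 ≤ χ) (h : ℝ) (z : E d × E d) :
    damping 1 χ h (flow h z) ≤ Real.exp (-h * turningKernel χ z.1 z.2) := by
  rw [damping, flow_add, neg_add_cancel, flow_zero, collisionPotential_flow, collisionPotential,
    turningKernel]
  refine Real.exp_le_exp.2 ?_
  set r : ℝ := inner ℝ z.1 z.2
  rcases eq_or_ne z.2 0 with h0 | h0
  · have : r = 0 := by simp [r, h0]
    simp [this, h0]
  have hv : 0 < ‖z.2‖ ^ 2 := by have := norm_pos_iff.2 h0; positivity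
  have h1 : |r| + h * ‖z.2‖ ^ 2 * Real.sign r ≤ |r + h * ‖z.2‖ ^ 2| := by
    rcases lt_trichotomy r 0 with hr | hr | hr
    · rw [Real.sign_of_neg hr, abs_of_neg hr]
      linarith [neg_abs_le (r + h * ‖z.2‖ ^ 2)]
    · rw [hr, Real.sign_zero, abs_zero, mul_zero, zero_add]
      exact abs_nonneg _
    · rw [Real.sign_of_pos hr, abs_of_pos hr]
      linarith [le_abs_self (r + h * ‖z.2‖ ^ 2)]
  have h2 : χ * |r| / ‖z.2‖ ^ 2 + χ * h * Real.sign r ≤ χ * |r + h * ‖z.2‖ ^ 2| / ‖z.2‖ ^ 2 := by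
    rw [div_add' _ _ _ hv.ne']
    gcongr
    nlinarith [mul_le_mul_of_nonneg_left h1 hχ]
  linarith

/-- The solution `p` of `K p = s`, where `K = 1 + χ sign s`. -/
def corrector (χ s : ℝ) : ℝ := (s - χ * |s|) / (1 - χ ^ 2)

/-- This identity cancels the first order growth `γs` of `m` against the loss term acting on the
correction `γp`. -/
theorem turningKernel_mul_corrector (hχ : χ ∈ Ioo (0 : ℝ) 1) (z : E d × E d) :
    turningKernel χ z.1 z.2 * corrector χ (radialSpeed z) = radialSpeed z := by
  have h1 : 1 - χ ^ 2 ≠ 0 := by nlinarith [hχ.1, hχ.2]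
  have hj := one_le_japanese z.1
  rw [turningKernel, corrector]
  have hs : Real.sign (inner ℝ z.1 z.2) * |radialSpeed z| = radialSpeed z ∧
      Real.sign (inner ℝ z.1 z.2) * radialSpeed z = |radialSpeed z| := by
    rw [radialSpeed, abs_div, abs_of_pos (by linarith : 0 < √(1 + ‖z.1‖ ^ 2))]
    rcases lt_trichotomy (inner ℝ z.1 z.2 : ℝ) 0 with hr | hr | hr
    · rw [Real.sign_of_neg hr, abs_of_neg hr]; constructor <;> ring
    · simp [hr]
    · rw [Real.sign_of_pos hr, abs_of_pos hr]; constructor <;> ring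
  rw [mul_div_assoc', div_eq_iff h1]
  linear_combination χ * hs.2 - χ ^ 2 * hs.1

theorem abs_corrector_sub_le (hχ : χ ∈ Ioo (0 : ℝ) 1) (s t : ℝ) :
    |corrector χ s - corrector χ t| ≤ |s - t| / (1 - χ) := by
  have h1 : 0 < 1 - χ ^ 2 := by nlinarith [hχ.1, hχ.2]
  have h2 : 0 < 1 - χ := by linarith [hχ.2]
  rw [corrector, corrector, ← sub_div, abs_div, abs_of_pos h1, div_le_div_iff₀ h1 h2]
  have h3 : |s - χ * |s| - (t - χ * |t|)| ≤ |s - t| * (1 + χ) := by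
    have h4 := abs_abs_sub_abs_le_abs_sub s t
    have h5 : s - χ * |s| - (t - χ * |t|) = (s - t) - χ * (|s| - |t|) := by ring
    rw [h5]
    refine (abs_sub _ _).trans ?_
    rw [abs_mul, abs_of_pos hχ.1]
    nlinarith [hχ.1]
  nlinarith

theorem abs_corrector_le (hχ : χ ∈ Ioo (0 : ℝ) 1) (s : ℝ) :
    |corrector χ s| ≤ |s| / (1 - χ) := by
  simpa [corrector] using abs_corrector_sub_le hχ s 0

/-- The truncation of the real line to `[-1, 1]`. -/
def clip (s : ℝ) : ℝ := max (-1) (min 1 s)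

theorem abs_clip_le (s : ℝ) : |clip s| ≤ 1 :=
  abs_le.2 ⟨le_max_left _ _, max_le (by norm_num) (min_le_left _ _)⟩

theorem clip_mono : Monotone clip := fun _ _ h => max_le_max_left _ (min_le_min_left _ h)

theorem clip_of_abs_le {s : ℝ} (h : |s| ≤ 1) : clip s = s := by
  rw [clip, min_eq_right (abs_le.1 h).2, max_eq_right (abs_le.1 h).1]

theorem continuous_clip : Continuous clip := by unfold clip; fun_prop

theorem setIntegral_ball_comp_neg (f : E d → ℝ) :
    ∫ v in Metric.ball (0 : E d) V₀, f (-v) = ∫ v in Metric.ball (0 : E d) V₀, f v := by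
  rw [← integral_indicator Metric.isOpen_ball.measurableSet,
    ← integral_indicator Metric.isOpen_ball.measurableSet, ← integral_neg_eq_self]
  refine integral_congr_ae (ae_of_all _ fun v => ?_)
  simp [indicator]

theorem setIntegral_ball_inner (x : E d) :
    ∫ v in Metric.ball (0 : E d) V₀, (inner ℝ x v : ℝ) = 0 := by
  have h := setIntegral_ball_comp_neg (V₀ := V₀) (fun v => (inner ℝ x v : ℝ))
  simp only [inner_neg_right, integral_neg] at h
  linarith

theorem integrable_ball_of_continuous {f : E d → ℝ} (hf : Continuous f) :
    Integrable f (volume.restrict (Metric.ball (0 : E d) V₀)) :=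
  (hf.continuousOn.integrableOn_compact (isCompact_closedBall 0 V₀)).mono_set
    Metric.ball_subset_closedBall

/-- On the ball of radius `V₀/4` about the point at distance `V₀/2` in the direction of `x` one has
`x·v ≥ V₀|x|/4`. -/
theorem exists_le_setIntegral_abs_inner (d : ℕ) {V₀ : ℝ} (hV : 0 < V₀) :
    ∃ c > 0, ∀ x : E d, c * ‖x‖ ≤ ∫ v in Metric.ball (0 : E d) V₀, |(inner ℝ x v : ℝ)| := by
  refine ⟨V₀ / 4 * volume.real (Metric.ball (0 : E d) (V₀ / 4)), mul_pos (by positivity)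
    (ENNReal.toReal_pos (Metric.measure_ball_pos _ _ (by positivity)).ne' measure_ball_lt_top.ne),
    fun x => ?_⟩
  rcases eq_or_ne x 0 with rfl | hx
  · simp
  have hx' := norm_pos_iff.2 hx
  set y : E d := (V₀ / (2 * ‖x‖)) • x
  have hy : ‖y‖ = V₀ / 2 := by
    rw [norm_smul, Real.norm_of_nonneg (by positivity)]; field_simp
  have hxy : (inner ℝ x y : ℝ) = V₀ / 2 * ‖x‖ := by
    rw [inner_smul_right, real_inner_self_eq_norm_sq]; field_simp
  have hsub : Metric.ball y (V₀ / 4) ⊆ Metric.ball (0 : E d) V₀ := fun v hv => by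
    rw [mem_ball_zero_iff]
    rw [mem_ball_iff_norm] at hv
    have := norm_le_insert' v y
    linarith
  have hi : IntegrableOn (fun v : E d => |(inner ℝ x v : ℝ)|) (Metric.ball (0 : E d) V₀) :=
    integrable_ball_of_continuous (by fun_prop)
  calc V₀ / 4 * volume.real (Metric.ball (0 : E d) (V₀ / 4)) * ‖x‖
      = ∫ v in Metric.ball y (V₀ / 4), V₀ / 4 * ‖x‖ := by
        rw [setIntegral_const, smul_eq_mul, measureReal_def, measureReal_def,
          Measure.addHaar_ball_center volume y]
        ring
    _ ≤ ∫ v in Metric.ball y (V₀ / 4), |(inner ℝ x v : ℝ)| := by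
        refine setIntegral_mono_on (integrableOn_const measure_ball_lt_top.ne) (hi.mono_set hsub)
          Metric.isOpen_ball.measurableSet fun v hv => le_trans ?_ (le_abs_self _)
        rw [mem_ball_iff_norm] at hv
        have h1 := (abs_le.1 (abs_real_inner_le_norm x (v - y))).1
        rw [inner_sub_right, hxy] at h1
        nlinarith
    _ ≤ _ := setIntegral_mono_set hi (ae_of_all _ fun _ => abs_nonneg _) hsub.eventuallyLE

end Weight

/-! ### The Lyapunov weight -/

section Weight

variable {d : ℕ} {V₀ γ χ N ε σ : ℝ} {Bd : Set (E d)}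

/-- The velocity dependent factor of the Lyapunov weight. -/
def lyapunovFactor (χ γ N ε σ : ℝ) (Bd : Set (E d)) (z : E d × E d) : ℝ :=
  1 + γ * corrector χ (radialSpeed z) + Bd.indicator (fun _ => N) z.2
    - ε * clip (inner ℝ z.1 z.2 / (2 * σ))

/-- The Lyapunov weight. -/
def lyapunovWeight (χ γ N ε σ : ℝ) (Bd : Set (E d)) (z : E d × E d) : ℝ :=
  weight γ z.1 * lyapunovFactor χ γ N ε σ Bd z

theorem continuous_radialSpeed : Continuous (radialSpeed : E d × E d → ℝ) := by
  unfold radialSpeed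
  exact Continuous.div (by fun_prop) (by fun_prop) fun z => by
    have := one_le_japanese z.1; positivity

theorem continuous_corrector (χ : ℝ) : Continuous (corrector χ) := by
  unfold corrector; fun_prop

theorem measurable_lyapunovFactor (hB : MeasurableSet Bd) :
    Measurable (lyapunovFactor χ γ N ε σ Bd) := by
  have h1 : Measurable fun z : E d × E d => corrector χ (radialSpeed z) :=
    ((continuous_corrector χ).comp continuous_radialSpeed).measurable
  have h2 : Measurable fun z : E d × E d => clip (inner ℝ z.1 z.2 / (2 * σ)) :=
    (continuous_clip.comp (by fun_prop)).measurable
  have h3 : Measurable fun z : E d × E d => Bd.indicator (fun _ => N) z.2 :=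
    (measurable_const.indicator hB).comp measurable_snd
  exact (((h1.const_mul γ).const_add 1).add h3).sub (h2.const_mul ε)

theorem measurable_lyapunovWeight (hB : MeasurableSet Bd) :
    Measurable (lyapunovWeight χ γ N ε σ Bd) :=
  measurable_weight_fst.mul (measurable_lyapunovFactor hB)

theorem abs_mul_corrector_le (hχ : χ ∈ Ioo (0 : ℝ) 1) (hγ : 0 ≤ γ)
    (h2 : γ * V₀ / (1 - χ) ≤ 1 / 4) {z : E d × E d} (hz : ‖z.2‖ < V₀) :
    |γ * corrector χ (radialSpeed z)| ≤ 1 / 4 := by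
  have h3 : 0 < 1 - χ := by linarith [hχ.2]
  rw [abs_mul, abs_of_nonneg hγ]
  calc γ * |corrector χ (radialSpeed z)| ≤ γ * (V₀ / (1 - χ)) := by
        gcongr
        refine (abs_corrector_le hχ _).trans ?_
        gcongr
        exact (abs_radialSpeed_le z).trans hz.le
    _ ≤ 1 / 4 := by rwa [← mul_div_assoc]

theorem abs_lyapunovFactor_sub_le (hχ : χ ∈ Ioo (0 : ℝ) 1) (hγ : 0 ≤ γ) (hε : 0 ≤ ε)
    (hε' : ε ≤ 1 / 4)
    (h2 : γ * V₀ / (1 - χ) ≤ 1 / 4) {z : E d × E d} (hz : ‖z.2‖ < V₀) :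
    |lyapunovFactor χ γ N ε σ Bd z - 1 - Bd.indicator (fun _ => N) z.2| ≤ 1 / 2 := by
  have h1 := abs_le.1 (abs_mul_corrector_le hχ hγ h2 hz)
  have h3 := abs_le.1 (abs_clip_le (inner ℝ z.1 z.2 / (2 * σ)))
  rw [lyapunovFactor, abs_le]
  constructor <;> nlinarith

/-- The odd part of the corrector averages to zero, leaving the negative even part `-χ|s|/(1-χ²)`.
This is the only source of confinement at infinity. -/
theorem setIntegral_corrector (x : E d) :
    ∫ v in Metric.ball (0 : E d) V₀, corrector χ (radialSpeed (x, v))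
      = -(χ / (1 - χ ^ 2)
        * ((∫ v in Metric.ball (0 : E d) V₀, |(inner ℝ x v : ℝ)|) / √(1 + ‖x‖ ^ 2))) := by
  have hj := one_le_japanese x
  have h1 : ∀ v : E d, corrector χ (radialSpeed (x, v)) = (1 / (1 - χ ^ 2) / √(1 + ‖x‖ ^ 2))
      * inner ℝ x v - χ * (1 / (1 - χ ^ 2) / √(1 + ‖x‖ ^ 2)) * |(inner ℝ x v : ℝ)| := fun v => by
    rw [corrector, radialSpeed, abs_div, abs_of_pos (by linarith : 0 < √(1 + ‖x‖ ^ 2))]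
    ring
  simp_rw [h1]
  rw [integral_sub ((integrable_ball_of_continuous (by fun_prop)).const_mul _)
    ((integrable_ball_of_continuous (by fun_prop)).const_mul _), integral_const_mul,
    integral_const_mul, setIntegral_ball_inner]
  ring

theorem setIntegral_lyapunovFactor_le (hV₀ : volume (Metric.ball (0 : E d) V₀) = 1)
    (hχ : χ ∈ Ioo (0 : ℝ) 1) (hγ : 0 ≤ γ) (hε : 0 ≤ ε) (hB : MeasurableSet Bd) {c₀ : ℝ} (x : E d)
    (hc₀ : c₀ * ‖x‖ ≤ ∫ v in Metric.ball (0 : E d) V₀, |(inner ℝ x v : ℝ)|) :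
    ∫ v in Metric.ball (0 : E d) V₀, lyapunovFactor χ γ N ε σ Bd (x, v)
      ≤ 1 - γ * (χ / (1 - χ ^ 2) * (c₀ * ‖x‖ / √(1 + ‖x‖ ^ 2)))
        + N * volume.real (Bd ∩ Metric.ball 0 V₀) + ε := by
  have : IsProbabilityMeasure (volume.restrict (Metric.ball (0 : E d) V₀)) :=
    isProbabilityMeasure_velMeasure hV₀
  have hj := one_le_japanese x
  have i1 : Integrable (fun v : E d => corrector χ (radialSpeed (x, v)))
      (volume.restrict (Metric.ball (0 : E d) V₀)) :=
    integrable_ball_of_continuous (((continuous_corrector χ).comp continuous_radialSpeed).comp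
      (by fun_prop))
  have i2 : Integrable (Bd.indicator fun _ => N) (volume.restrict (Metric.ball (0 : E d) V₀)) :=
    (integrable_const N).indicator hB
  have i3 : Integrable (fun v : E d => clip (inner ℝ x v / (2 * σ)))
      (volume.restrict (Metric.ball (0 : E d) V₀)) :=
    integrable_ball_of_continuous (continuous_clip.comp (by fun_prop))
  have h1 : ∫ v in Metric.ball (0 : E d) V₀, lyapunovFactor χ γ N ε σ Bd (x, v)
      = 1 + γ * (∫ v in Metric.ball (0 : E d) V₀, corrector χ (radialSpeed (x, v)))
        + (∫ v in Metric.ball (0 : E d) V₀, Bd.indicator (fun _ => N) v)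
        - ε * ∫ v in Metric.ball (0 : E d) V₀, clip (inner ℝ x v / (2 * σ)) := by
    unfold lyapunovFactor
    rw [integral_sub (f := fun v => 1 + γ * corrector χ (radialSpeed (x, v))
        + Bd.indicator (fun _ => N) v) (((integrable_const 1).add (i1.const_mul γ)).add i2)
        (i3.const_mul ε),
      integral_add (f := fun v => 1 + γ * corrector χ (radialSpeed (x, v)))
        ((integrable_const 1).add (i1.const_mul γ)) i2,
      integral_add (integrable_const 1) (i1.const_mul γ), integral_const_mul, integral_const_mul]
    simp
  have h2 : ∫ v in Metric.ball (0 : E d) V₀, Bd.indicator (fun _ => N) v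
      = N * volume.real (Bd ∩ Metric.ball 0 V₀) := by
    rw [integral_indicator_const _ hB, measureReal_restrict_apply hB, smul_eq_mul, mul_comm]
  have h3 : -1 ≤ ∫ v in Metric.ball (0 : E d) V₀, clip (inner ℝ x v / (2 * σ)) := by
    have := integral_mono (integrable_const (-1)) i3 fun v => (abs_le.1 (abs_clip_le _)).1
    simpa using this
  rw [h1, h2, setIntegral_corrector]
  have h4 : c₀ * ‖x‖ / √(1 + ‖x‖ ^ 2)
      ≤ (∫ v in Metric.ball (0 : E d) V₀, |(inner ℝ x v : ℝ)|) / √(1 + ‖x‖ ^ 2) := by gcongr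
  have h5 : 0 ≤ χ / (1 - χ ^ 2) := div_nonneg hχ.1.le (by nlinarith [hχ.1, hχ.2])
  have h6 := mul_le_mul_of_nonneg_left (mul_le_mul_of_nonneg_left h4 h5) hγ
  nlinarith

/-- The rate of change of the Lyapunov factor along the flow, up to sign changes. -/
def lyapunovDrift (V₀ χ γ ε σ : ℝ) (z : E d × E d) : ℝ :=
  γ * (2 * V₀ ^ 2 / √(1 + ‖z.1‖ ^ 2) / (1 - χ))
    - (if |(inner ℝ z.1 z.2 : ℝ)| ≤ σ then ε * (‖z.2‖ ^ 2 / (2 * σ)) else 0)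

/-- The indicator is constant along the flow because `v` is, and the clipped term is monotone
because `x·v` increases. Starting in `|x·v| ≤ σ`, a step with `hV₀² ≤ σ` keeps `x·v/2σ` in the
linear range of `clip`. -/
theorem lyapunovFactor_flow_le (hχ : χ ∈ Ioo (0 : ℝ) 1) (hγ : 0 ≤ γ) (hε : 0 ≤ ε) (hσ : 0 < σ)
    {h : ℝ} (hh : 0 ≤ h) (hσh : h * V₀ ^ 2 ≤ σ) {z : E d × E d} (hz : ‖z.2‖ < V₀) :
    lyapunovFactor χ γ N ε σ Bd (flow h z) ≤ lyapunovFactor χ γ N ε σ Bd z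
      + h * lyapunovDrift V₀ χ γ ε σ z + 2 * γ * V₀ ^ 3 / (1 - χ) * h ^ 2 := by
  have hj := one_le_japanese z.1
  have h3 : 0 < 1 - χ := by linarith [hχ.2]
  have hv := norm_nonneg z.2
  have h1 : corrector χ (radialSpeed (flow h z)) - corrector χ (radialSpeed z)
      ≤ (2 * h * V₀ ^ 2 / √(1 + ‖z.1‖ ^ 2) + 2 * h ^ 2 * V₀ ^ 3) / (1 - χ) := by
    refine (le_abs_self _).trans ((abs_corrector_sub_le hχ _ _).trans ?_)
    gcongr
    refine (abs_radialSpeed_flow_sub_le hh z).trans ?_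
    gcongr
  have h4 : (if |(inner ℝ z.1 z.2 : ℝ)| ≤ σ then h * (‖z.2‖ ^ 2 / (2 * σ)) else 0)
      ≤ clip (inner ℝ (flow h z).1 z.2 / (2 * σ)) - clip (inner ℝ z.1 z.2 / (2 * σ)) := by
    have e1 : (inner ℝ (flow h z).1 z.2 : ℝ) = inner ℝ z.1 z.2 + h * ‖z.2‖ ^ 2 := inner_flow h z
    have h5 : h * ‖z.2‖ ^ 2 ≤ σ := le_trans (by gcongr) hσh
    have h6 : 0 ≤ h * ‖z.2‖ ^ 2 := by positivity
    rw [e1]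
    split_ifs with hr
    · rw [abs_le] at hr
      have a1 : |(inner ℝ z.1 z.2 + h * ‖z.2‖ ^ 2) / (2 * σ)| ≤ 1 := by
        rw [abs_div, abs_of_pos (by positivity : 0 < 2 * σ), div_le_one (by positivity), abs_le]
        constructor <;> linarith
      have a2 : |inner ℝ z.1 z.2 / (2 * σ)| ≤ 1 := by
        rw [abs_div, abs_of_pos (by positivity : 0 < 2 * σ), div_le_one (by positivity), abs_le]
        constructor <;> linarith
      rw [clip_of_abs_le a1, clip_of_abs_le a2]
      exact le_of_eq (by ring)
    · refine sub_nonneg.2 (clip_mono ?_)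
      gcongr
      linarith
  have h7 := mul_le_mul_of_nonneg_left h1 hγ
  have h8 := mul_le_mul_of_nonneg_left h4 hε
  have h9 : ε * (if |(inner ℝ z.1 z.2 : ℝ)| ≤ σ then h * (‖z.2‖ ^ 2 / (2 * σ)) else 0)
      = h * (if |(inner ℝ z.1 z.2 : ℝ)| ≤ σ then ε * (‖z.2‖ ^ 2 / (2 * σ)) else 0) := by
    split_ifs <;> ring
  rw [h9] at h8
  have h10 : γ * ((2 * h * V₀ ^ 2 / √(1 + ‖z.1‖ ^ 2) + 2 * h ^ 2 * V₀ ^ 3) / (1 - χ))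
      = h * (γ * (2 * V₀ ^ 2 / √(1 + ‖z.1‖ ^ 2) / (1 - χ)))
        + 2 * γ * V₀ ^ 3 / (1 - χ) * h ^ 2 := by
    ring
  rw [h10] at h7
  rw [lyapunovFactor, lyapunovFactor, lyapunovDrift, flow_snd]
  linarith

/-- The exponent `u = hβ + h²/2` satisfies `|u| ≤ 4h ≤ 1`, so `exp u ≤ 1 + u + u²` with `u² ≤ 16h²`;
hence `17 ≥ 16 + 1/2`. -/
theorem mul_weight_flow_le (hχ : χ ∈ Ioo (0 : ℝ) 1) (hγ : 0 ≤ γ) (h1 : γ * V₀ ≤ 1) {h : ℝ}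
    (hh : 0 ≤ h) (hh' : h ≤ 1 / 4) (h1' : γ * V₀ ^ 2 ≤ 1) {z : E d × E d} (hz : ‖z.2‖ < V₀) :
    damping 1 χ h (flow h z) * weight γ (flow h z).1 ≤ weight γ z.1
      * (1 + h * (γ * radialSpeed z - turningKernel χ z.1 z.2) + 17 * h ^ 2) := by
  have hK := turningKernel_bounds hχ z.1 z.2
  have hs := abs_le.1 ((abs_radialSpeed_le z).trans hz.le)
  have hv := norm_nonneg z.2
  set β := γ * radialSpeed z - turningKernel χ z.1 z.2 with hβ
  have hβ' : |β| ≤ 3 := by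
    rw [abs_le]; constructor <;> nlinarith [hχ.1, hχ.2]
  have hvV : ‖z.2‖ ^ 2 ≤ V₀ ^ 2 := by gcongr
  have h2 : damping 1 χ h (flow h z) * weight γ (flow h z).1
      ≤ weight γ z.1 * Real.exp (h * β + h ^ 2 / 2) := by
    refine (mul_le_mul_of_nonneg_right (damping_flow_le hχ.1.le h z)
      (weight_pos _).le).trans ?_
    rw [weight, weight, ← Real.exp_add, ← Real.exp_add]
    refine Real.exp_le_exp.2 ?_
    have h3 := mul_le_mul_of_nonneg_left (japanese_flow_le h z) hγ
    have h4 : γ * (h ^ 2 * ‖z.2‖ ^ 2 / 2) ≤ h ^ 2 / 2 := by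
      have : γ * ‖z.2‖ ^ 2 ≤ 1 := le_trans (by gcongr) h1'
      nlinarith [sq_nonneg h]
    rw [hβ]
    nlinarith
  refine h2.trans (mul_le_mul_of_nonneg_left ?_ (weight_pos _).le)
  have h5 : |h * β + h ^ 2 / 2| ≤ 4 * h := by
    rw [abs_le] at hβ' ⊢
    constructor <;> nlinarith
  have h6 := (abs_le.1 (Real.abs_exp_sub_one_sub_id_le (h5.trans (by linarith)))).2
  have h7 : (h * β + h ^ 2 / 2) ^ 2 ≤ (4 * h) ^ 2 := sq_le_sq' (abs_le.1 h5).1 (abs_le.1 h5).2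
  nlinarith

theorem mul_le_quadratic {A T β θ τ D Θ M h : ℝ} (hA : 0 ≤ A) (hA' : A ≤ 1 + h * β + 17 * h ^ 2)
    (hT : 0 ≤ T) (hT' : T ≤ θ + h * τ + D * h ^ 2) (hβ : |β| ≤ 3) (hτ : |τ| ≤ M) (hθ : θ ≤ Θ)
    (hD : 0 ≤ D) (hh : 0 ≤ h) (hh' : h ≤ 1) :
    A * T ≤ θ + h * (β * θ + τ) + (17 * Θ + 20 * M + 21 * D) * h ^ 2 := by
  have h1 : A * T ≤ (1 + h * β + 17 * h ^ 2) * (θ + h * τ + D * h ^ 2) :=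
    mul_le_mul hA' hT' hT (hA.trans hA')
  have h2 : β * τ ≤ 3 * M := by
    refine (le_abs_self _).trans ?_
    rw [abs_mul]
    gcongr
  have h3 := le_abs_self β
  have h4 := le_abs_self τ
  have hM : 0 ≤ M := (abs_nonneg _).trans hτ
  have e1 : h * (β * D) ≤ 3 * D := by
    have : β * D ≤ 3 * D := by gcongr; linarith
    nlinarith
  have e2 : h * (17 * τ) ≤ 17 * M := by nlinarith
  have e3 : h ^ 2 * (17 * D) ≤ 17 * D :=
    mul_le_of_le_one_left (by positivity) (pow_le_one₀ hh hh')
  have e4 : h ^ 2 * (17 * θ + β * τ + D + h * (β * D) + h * (17 * τ) + h ^ 2 * (17 * D))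
      ≤ h ^ 2 * (17 * Θ + 20 * M + 21 * D) := by
    exact mul_le_mul_of_nonneg_left (by linarith) (sq_nonneg h)
  refine h1.trans (le_trans (le_of_eq ?_) (add_le_add_right e4 (θ + h * (β * θ + τ))) |>.trans
    (le_of_eq ?_)) <;> ring

theorem lyapunovDrift_le (hε : 0 ≤ ε) (hσ : 0 < σ)
    (z : E d × E d) :
    lyapunovDrift V₀ χ γ ε σ z ≤ γ * (2 * V₀ ^ 2 / √(1 + ‖z.1‖ ^ 2) / (1 - χ)) := by
  have : 0 ≤ if |(inner ℝ z.1 z.2 : ℝ)| ≤ σ then ε * (‖z.2‖ ^ 2 / (2 * σ)) else 0 := by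
    split_ifs <;> positivity
  rw [lyapunovDrift]
  linarith

theorem drift_bound_le (hχ : χ ∈ Ioo (0 : ℝ) 1) (hγ : 0 ≤ γ) (x : E d) :
    γ * (2 * V₀ ^ 2 / √(1 + ‖x‖ ^ 2) / (1 - χ)) ≤ γ * (2 * V₀ ^ 2 / (1 - χ)) := by
  have h3 : 0 < 1 - χ := by linarith [hχ.2]
  have hj := one_le_japanese x
  gcongr
  exact div_le_self (by positivity) hj

theorem abs_lyapunovDrift_le (hχ : χ ∈ Ioo (0 : ℝ) 1) (hγ : 0 ≤ γ) (hε : 0 ≤ ε) (hσ : 0 < σ)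
    {z : E d × E d} (hz : ‖z.2‖ < V₀) :
    |lyapunovDrift V₀ χ γ ε σ z| ≤ γ * (2 * V₀ ^ 2 / (1 - χ)) + ε * (V₀ ^ 2 / (2 * σ)) := by
  have h3 : 0 < 1 - χ := by linarith [hχ.2]
  have h1 := drift_bound_le (V₀ := V₀) hχ hγ z.1
  have h0 : 0 ≤ γ * (2 * V₀ ^ 2 / √(1 + ‖z.1‖ ^ 2) / (1 - χ)) := by positivity
  have h2 : (if |(inner ℝ z.1 z.2 : ℝ)| ≤ σ then ε * (‖z.2‖ ^ 2 / (2 * σ)) else 0)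
      ≤ ε * (V₀ ^ 2 / (2 * σ)) := by
    split_ifs
    · gcongr
    · positivity
  have h4 : 0 ≤ if |(inner ℝ z.1 z.2 : ℝ)| ≤ σ then ε * (‖z.2‖ ^ 2 / (2 * σ)) else 0 := by
    split_ifs <;> positivity
  have h5 : 0 ≤ ε * (V₀ ^ 2 / (2 * σ)) := by positivity
  rw [lyapunovDrift, abs_le]
  constructor <;> linarith

/-- Smallness conditions on the exponent `γ` of the weight, where `c₀` is a lower bound of the mean
of `|e · v|` over the velocity ball, for unit vectors `e`. -/
structure IsSmallExponent (V₀ χ c₀ γ : ℝ) : Prop where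
  pos : 0 < γ
  speed : γ * V₀ ≤ (1 - χ) / 2
  corrector : γ * V₀ / (1 - χ) ≤ 1 / 4
  drift : γ * (2 * V₀ ^ 2 / (1 - χ)) ≤ (1 - χ) / 8
  quadratic : γ * (V₀ ^ 2 / (1 - χ)) ≤ χ * c₀ / (8 * (1 + χ))
  rate : γ * (χ * c₀ / (8 * (1 + χ))) ≤ (1 - χ) / 2

/-- At the point `z` the gain kernel `κ` is either dominated by the turning kernel and supported far
from the origin, or compensated by one of the two corrections of the Lyapunov weight. -/
def IsControlled (χ R N ε σ : ℝ) (Bd : Set (E d)) (κ : E d → E d → ℝ) (z : E d × E d) : Prop :=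
  (z.2 ∉ Bd ∧ |κ z.1 z.2| ≤ turningKernel χ z.1 z.2 ∧ (‖z.1‖ < R → κ z.1 z.2 = 0)) ∨
  (z.2 ∈ Bd ∧ 36 / (1 - χ) ≤ N) ∨
  (|(inner ℝ z.1 z.2 : ℝ)| ≤ σ ∧ 9 ≤ ε * (‖z.2‖ ^ 2 / (2 * σ)))

variable {c₀ R : ℝ} {κ : E d → E d → ℝ}

/-- The infinitesimal supersolution inequality, divided by `m`, with `M` standing for the velocity
mean of the factor. Each alternative in `IsControlled` supplies a different mechanism against the
gain `|κ| M`. -/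
theorem super_of_isControlled (hχ : χ ∈ Ioo (0 : ℝ) 1) (hγ : IsSmallExponent V₀ χ c₀ γ)
    (hc₀ : 0 ≤ c₀) (hε : 0 ≤ ε) (hN : 0 ≤ N) (hσ : 0 < σ) {μ M : ℝ} (hμ : 0 ≤ μ)
    (hsmall : 5 * ε + 2 * (N * μ) ≤ γ * (χ * c₀ / (8 * (1 + χ)))) (hR : 1 ≤ R)
    (hR' : 2 * V₀ ^ 2 / (1 - χ) ≤ χ * c₀ / (8 * (1 + χ)) * R) {z : E d × E d} (hz : ‖z.2‖ < V₀)
    (hκ : |κ z.1 z.2| ≤ 4) (hM : 0 ≤ M)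
    (hM' : M ≤ 1 - γ * (χ / (1 - χ ^ 2) * (c₀ * ‖z.1‖ / √(1 + ‖z.1‖ ^ 2))) + N * μ + ε)
    (hz' : IsControlled χ R N ε σ Bd κ z) :
    (γ * radialSpeed z - turningKernel χ z.1 z.2) * lyapunovFactor χ γ N ε σ Bd z
      + lyapunovDrift V₀ χ γ ε σ z + |κ z.1 z.2| * M
      ≤ -(γ * (χ * c₀ / (8 * (1 + χ))) / 2) * lyapunovFactor χ γ N ε σ Bd z := by
  have h0 := hγ.pos
  have h3 : 0 < 1 - χ := by linarith [hχ.2]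
  have h4 : 0 < 1 - χ ^ 2 := by nlinarith [hχ.1]
  have hV : 0 ≤ V₀ := (norm_nonneg _).trans hz.le
  have hj := one_le_japanese z.1
  have hjn := norm_le_japanese z.1
  have hK := turningKernel_bounds hχ z.1 z.2
  have hs := abs_le.1 ((abs_radialSpeed_le z).trans hz.le)
  have hKp := turningKernel_mul_corrector hχ z
  have hp := abs_corrector_le hχ (radialSpeed z)
  have hτ := lyapunovDrift_le (V₀ := V₀) (χ := χ) (γ := γ) hε hσ z
  have hτ' := hτ.trans ((drift_bound_le hχ h0.le z.1).trans hγ.drift)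
  have hq := hγ.quadratic
  have hr := hγ.rate
  have hNμ : 0 ≤ N * μ := mul_nonneg hN hμ
  have hε' : ε ≤ 1 / 4 := by linarith [hχ.1]
  have hθ := abs_le.1 (abs_lyapunovFactor_sub_le (Bd := Bd) (N := N) (σ := σ) hχ h0.le hε hε'
    hγ.corrector hz)
  have hcl := abs_le.1 (abs_clip_le (inner ℝ z.1 z.2 / (2 * σ)))
  have hind : 0 ≤ Bd.indicator (fun _ => N) z.2 := indicator_nonneg (fun _ _ => hN) _
  have hθdef : lyapunovFactor χ γ N ε σ Bd z = 1 + γ * corrector χ (radialSpeed z)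
    + Bd.indicator (fun _ => N) z.2 - ε * clip (inner ℝ z.1 z.2 / (2 * σ)) := rfl
  have hQ : 0 ≤ χ / (1 - χ ^ 2) * (c₀ * ‖z.1‖ / √(1 + ‖z.1‖ ^ 2)) := by
    have := hχ.1; positivity
  have hM2 : M ≤ 2 := by linarith [hχ.1, mul_nonneg h0.le hQ]
  have hκM : |κ z.1 z.2| * M ≤ 4 * 2 := mul_le_mul hκ hM2 hM (by norm_num)
  have hc : 0 ≤ χ * c₀ / (8 * (1 + χ)) := by have := hχ.1; positivity
  have hQ' : 1 ≤ ‖z.1‖ → 4 * (χ * c₀ / (8 * (1 + χ)))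
      ≤ (1 - χ) * (χ / (1 - χ ^ 2) * (c₀ * ‖z.1‖ / √(1 + ‖z.1‖ ^ 2))) := fun hx => by
    have e1 : 1 / 2 ≤ ‖z.1‖ / √(1 + ‖z.1‖ ^ 2) := by
      rw [div_le_div_iff₀ (by norm_num) (by linarith), one_mul]
      refine Real.sqrt_le_iff.2 ⟨by linarith, by nlinarith⟩
    have e2 : (1 - χ) * (χ / (1 - χ ^ 2) * (c₀ * ‖z.1‖ / √(1 + ‖z.1‖ ^ 2)))
        = χ * c₀ / (1 + χ) * (‖z.1‖ / √(1 + ‖z.1‖ ^ 2)) := by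
      have : 1 - χ ^ 2 = (1 - χ) * (1 + χ) := by ring
      have h6 : 1 + χ ≠ 0 := by linarith [hχ.1]
      rw [this]; field_simp
    have e3 : 4 * (χ * c₀ / (8 * (1 + χ))) = χ * c₀ / (1 + χ) * (1 / 2) := by
      have h6 : 1 + χ ≠ 0 := by linarith [hχ.1]
      field_simp; ring
    rw [e2, e3]
    have := hχ.1
    gcongr
  set c := χ * c₀ / (8 * (1 + χ))
  set θ := lyapunovFactor χ γ N ε σ Bd z
  set K := turningKernel χ z.1 z.2
  set s := radialSpeed z
  set τ := lyapunovDrift V₀ χ γ ε σ z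
  set p := corrector χ s
  set cl := clip (inner ℝ z.1 z.2 / (2 * σ))
  set Q := χ / (1 - χ ^ 2) * (c₀ * ‖z.1‖ / √(1 + ‖z.1‖ ^ 2))
  have hθ0 : 1 / 2 ≤ θ := by linarith
  have hγs : |γ * s| ≤ γ * V₀ := by
    rw [abs_mul, abs_of_pos h0]; exact mul_le_mul_of_nonneg_left (abs_le.2 hs) h0.le
  have hγs' := abs_le.1 hγs
  have hsp := hγ.speed
  have hβ : γ * s - K ≤ -((1 - χ) / 2) := by linarith
  have hβθ : (γ * s - K) * θ ≤ -((1 - χ) / 2) * θ := by gcongr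
  have hβ3 : |γ * s - K| ≤ 3 := by
    rw [abs_le]; constructor <;> linarith [hχ.1, hχ.2]
  have haθ : γ * c / 2 * θ ≤ (1 - χ) / 4 * θ :=
    mul_le_mul_of_nonneg_right (by linarith) (by linarith)
  rcases hz' with ⟨hB, hκK, hin⟩ | ⟨hB, hN'⟩ | ⟨hr, hε9⟩
  · rw [indicator_of_notMem hB] at hθ hθdef
    rcases lt_or_ge ‖z.1‖ R with hx | hx
    · rw [hin hx, abs_zero, zero_mul]
      have : (1 - χ) * (1 / 2) ≤ (1 - χ) * θ := by gcongr
      linarith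
    · have e1 : |κ z.1 z.2| * M ≤ K * (1 - γ * Q + N * μ + ε) := by
        refine mul_le_mul hκK hM' hM (by linarith)
      have e2 : γ * (2 * V₀ ^ 2 / √(1 + ‖z.1‖ ^ 2) / (1 - χ)) ≤ γ * c := by
        gcongr
        rw [div_right_comm, div_le_iff₀ (by linarith)]
        exact hR'.trans (by gcongr; linarith)
      have e3 : γ * (γ * (s * p)) ≤ γ * c := by
        gcongr
        refine le_trans ?_ hq
        gcongr
        refine (le_abs_self _).trans ?_
        rw [abs_mul, sq, mul_div_assoc]
        have : |s| ≤ V₀ := abs_le.2 hs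
        gcongr
        exact hp.trans (by gcongr)
      have e4 : (γ * s - K) * (-(ε * cl)) ≤ 3 * ε := by
        refine (le_abs_self _).trans ?_
        rw [abs_mul, abs_neg, abs_mul, abs_of_nonneg hε]
        have : ε * |cl| ≤ ε := mul_le_of_le_one_right hε (abs_le.2 hcl)
        exact mul_le_mul hβ3 this (by positivity) (by norm_num)
      have e5 : K * (N * μ + ε) ≤ 2 * (N * μ + ε) := by
        gcongr; linarith [hχ.2]
      have e6 : γ * (4 * c) ≤ K * (γ * Q) := by
        have := hQ' (hR.trans hx)
        have h7 : (1 - χ) * (γ * Q) ≤ K * (γ * Q) := by gcongr; exact hK.1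
        have h8 := mul_le_mul_of_nonneg_left this h0.le
        linarith
      have e7 : (γ * s - K) * θ = γ * s - K + γ * (γ * (s * p)) - γ * s
          + (γ * s - K) * (-(ε * cl)) := by
        rw [hθdef, ← hKp]; ring
      have e8 : γ * c / 2 * θ ≤ γ * c / 2 * 2 := by gcongr; linarith
      rw [e7]
      linarith
  · rw [indicator_of_mem hB] at hθ
    -- On `Bd` the factor is at least `N`, so `(1-χ)θ/4 ≥ 9` exceeds the gain, at most `8`, plus the
    -- drift.
    rw [div_le_iff₀ h3] at hN'
    have : N * (1 - χ) ≤ θ * (1 - χ) := by gcongr; linarith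
    linarith [hχ.1]
  · have e1 : τ ≤ (1 - χ) / 8 - 9 := by
      have := (drift_bound_le (V₀ := V₀) hχ h0.le z.1).trans hγ.drift
      simp only [τ, lyapunovDrift, if_pos hr]
      linarith
    have : 0 ≤ (1 - χ) * θ := by positivity
    linarith [hχ.1]

theorem isLyapunov_lyapunovWeight (hV₀ : volume (Metric.ball (0 : E d) V₀) = 1)
    (hχ : χ ∈ Ioo (0 : ℝ) 1) (hγ : IsSmallExponent V₀ χ c₀ γ) (hc₀ : 0 ≤ c₀)
    (hc₀' : ∀ x : E d, c₀ * ‖x‖ ≤ ∫ v in Metric.ball (0 : E d) V₀, |(inner ℝ x v : ℝ)|)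
    (hε : 0 ≤ ε) (hN : 0 ≤ N) (hσ : 0 < σ) (hB : MeasurableSet Bd)
    (hsmall : 5 * ε + 2 * (N * volume.real (Bd ∩ Metric.ball 0 V₀))
      ≤ γ * (χ * c₀ / (8 * (1 + χ)))) (hR : 1 ≤ R)
    (hR' : 2 * V₀ ^ 2 / (1 - χ) ≤ χ * c₀ / (8 * (1 + χ)) * R)
    (hκ : ∀ z : E d × E d, ‖z.2‖ < V₀ → |κ z.1 z.2| ≤ 4)
    (hcon : ∀ z : E d × E d, ‖z.2‖ < V₀ → IsControlled χ R N ε σ Bd κ z) :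
    IsLyapunov V₀ γ χ (-(γ * (χ * c₀ / (8 * (1 + χ))) / 2)) (2 + N) κ
      (lyapunovWeight χ γ N ε σ Bd) := by
  have h0 := hγ.pos
  have h3 : 0 < 1 - χ := by linarith [hχ.2]
  have hNμ : 0 ≤ N * volume.real (Bd ∩ Metric.ball 0 V₀) := by positivity
  have hε' : ε ≤ 1 / 4 := by linarith [hχ.1, hγ.rate]
  have hθ := fun (z : E d × E d) (hz : ‖z.2‖ < V₀) => abs_le.1 (abs_lyapunovFactor_sub_le
    (Bd := Bd) (N := N) (σ := σ) hχ h0.le hε hε' hγ.corrector hz)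
  have hind : ∀ v, 0 ≤ Bd.indicator (fun _ => N) v := fun v =>
    indicator_nonneg (fun _ _ => hN) _
  have hind' : ∀ v, Bd.indicator (fun _ => N) v ≤ N := fun v =>
    indicator_le_self' (fun _ _ => hN) v
  have hθ1 : ∀ z : E d × E d, ‖z.2‖ < V₀ → 1 / 2 ≤ lyapunovFactor χ γ N ε σ Bd z :=
    fun z hz => by linarith [(hθ z hz).1, hind z.2]
  have hθ2 : ∀ z : E d × E d, ‖z.2‖ < V₀ → lyapunovFactor χ γ N ε σ Bd z ≤ 2 + N :=
    fun z hz => by linarith [(hθ z hz).2, hind' z.2]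
  -- The step bound `1/4` serves `mul_weight_flow_le`, the other one the clipping; the quadratic
  -- constant is that of `mul_le_quadratic`.
  refine ⟨measurable_lyapunovWeight hB, fun z hz => ?_, fun z hz => ?_, min (1 / 4)
    (σ / (V₀ ^ 2 + 1)), by positivity, 17 * (2 + N) + 20 * (γ * (2 * V₀ ^ 2 / (1 - χ))
      + ε * (V₀ ^ 2 / (2 * σ))) + 21 * (2 * γ * V₀ ^ 3 / (1 - χ)), fun h hh hh' z hz => ?_⟩
  · rw [lyapunovWeight, mul_comm]
    exact mul_le_mul_of_nonneg_left (hθ1 z hz) (weight_pos _).le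
  · rw [lyapunovWeight, mul_comm]
    exact mul_le_mul_of_nonneg_right (hθ2 z hz) (weight_pos _).le
  have hV : 0 ≤ V₀ := (norm_nonneg _).trans hz.le
  have hm := weight_pos (γ := γ) z.1
  have hh4 : h ≤ 1 / 4 := hh'.le.trans (min_le_left _ _)
  have hhσ : h * V₀ ^ 2 ≤ σ := by
    have := hh'.le.trans (min_le_right _ _)
    rw [le_div_iff₀ (by positivity)] at this
    linarith
  have hs := abs_le.1 ((abs_radialSpeed_le z).trans hz.le)
  have hK := turningKernel_bounds hχ z.1 z.2
  have hβ3 : |γ * radialSpeed z - turningKernel χ z.1 z.2| ≤ 3 := by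
    rw [abs_le]; constructor <;> nlinarith [hγ.speed, hχ.1]
  have hVV : γ * V₀ ^ 2 ≤ 1 := by
    have h6 := hγ.drift
    have h7 : γ * V₀ ^ 2 ≤ γ * (2 * V₀ ^ 2 / (1 - χ)) := by
      gcongr
      rw [le_div_iff₀ h3]
      nlinarith [sq_nonneg V₀, hχ.1]
    linarith [hχ.1]
  have h1 := mul_weight_flow_le hχ h0.le (by linarith [hγ.speed, hχ.1]) hh.le hh4 hVV hz
  have h2 := lyapunovFactor_flow_le (N := N) (Bd := Bd) hχ h0.le hε hσ hh.le hhσ hz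
  have h4 : 0 ≤ damping 1 χ h (flow h z) * weight γ (flow h z).1 / weight γ z.1 := by
    have := damping_pos (χ := χ) 1 h (flow h z)
    have := weight_pos (γ := γ) (flow h z).1
    positivity
  have h5 := mul_le_quadratic h4 (by rw [div_le_iff₀ hm]; linarith)
    (le_trans (by norm_num) (hθ1 (flow h z) hz)) h2 hβ3
    (abs_lyapunovDrift_le hχ h0.le hε hσ hz) (hθ2 z hz) (by positivity) hh.le (by linarith)
  have h6 := super_of_isControlled hχ hγ hc₀ hε hN hσ measureReal_nonneg hsmall hR hR' hz (hκ z hz)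
    (setIntegral_nonneg Metric.isOpen_ball.measurableSet fun v hv =>
      le_trans (by norm_num) (hθ1 (z.1, v) (mem_ball_zero_iff.1 hv)))
    (setIntegral_lyapunovFactor_le hV₀ hχ h0.le hε hB z.1 (hc₀' z.1)) (hcon z hz)
  have h7 : ∫ v in Metric.ball 0 V₀, lyapunovWeight χ γ N ε σ Bd (z.1, v)
      = weight γ z.1 * ∫ v in Metric.ball 0 V₀, lyapunovFactor χ γ N ε σ Bd (z.1, v) := by
    rw [← integral_const_mul]; rfl
  rw [h7, lyapunovWeight, lyapunovWeight]
  have h8 := mul_le_mul_of_nonneg_left h5 hm.le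
  have h9 := mul_le_mul_of_nonneg_left h6 (mul_nonneg hh.le hm.le)
  have h10 : weight γ z.1 * (damping 1 χ h (flow h z) * weight γ (flow h z).1 / weight γ z.1
      * lyapunovFactor χ γ N ε σ Bd (flow h z)) = damping 1 χ h (flow h z)
      * (weight γ (flow h z).1 * lyapunovFactor χ γ N ε σ Bd (flow h z)) := by
    field_simp
  rw [h10] at h8
  nlinarith

end Weight

/-! ## Velocity averaging and decay in `L^2(m)` -/

section Smoothing

variable {d : ℕ} {V₀ γ χ : ℝ} (hV₀ : volume (Metric.ball (0 : E d) V₀) = 1)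

include hV₀

theorem lintegral_phase_fst {F : E d → ℝ≥0∞} (hF : Measurable F) :
    ∫⁻ z, F z.1 ∂phaseMeasure d V₀ = ∫⁻ x, F x := by
  have : IsProbabilityMeasure (volume.restrict (Metric.ball (0 : E d) V₀)) :=
    isProbabilityMeasure_velMeasure hV₀
  exact (measurePreserving_fst (μ := (volume : Measure (E d)))
    (ν := volume.restrict (Metric.ball (0 : E d) V₀))).lintegral_comp hF

omit hV₀ in
-- The substitution `y = x - s v` trades velocity for position, with Jacobian `s^(-d)`.
theorem lintegral_comp_sub_smul {h : E d → ℝ≥0∞} (hh : Measurable h) {s : ℝ} (hs : 0 < s)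
    (x : E d) : ∫⁻ v, h (x - s • v) = ENNReal.ofReal (s ^ d)⁻¹ * ∫⁻ y, h y := by
  have h1 := lintegral_map (μ := (volume : Measure (E d))) (f := fun y => h (x - y))
    (g := fun v => s • v) (by fun_prop) (by fun_prop)
  rw [← h1, Measure.map_addHaar_smul volume hs.ne', lintegral_smul_measure,
    lintegral_sub_left_eq_self, finrank_euclideanSpace_fin, abs_of_pos (by positivity), smul_eq_mul]

/-- Averaging in velocity turns free transport of integrable macroscopic densities into square
integrable densities. -/
theorem lintegral_velocity_average_sq_le {h : E d → ℝ≥0∞} (hh : Measurable h) {s : ℝ}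
    (hs : 0 < s) :
    ∫⁻ z, (∫⁻ v in Metric.ball 0 V₀, h (z.1 - s • v)) ^ 2 ∂phaseMeasure d V₀
      ≤ ENNReal.ofReal (s ^ d)⁻¹ * (∫⁻ y, h y) ^ 2 := by
  have hm : Measurable fun z : E d × E d => h (z.1 - s • z.2) := by fun_prop
  have hJ : Measurable fun x : E d => ∫⁻ v in Metric.ball 0 V₀, h (x - s • v) :=
    hm.lintegral_prod_right'
  rw [lintegral_phase_fst hV₀ (F := fun x => (∫⁻ v in Metric.ball 0 V₀, h (x - s • v)) ^ 2)
    (hJ.pow_const 2)]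
  have h1 : ∫⁻ x : E d, ∫⁻ v in Metric.ball 0 V₀, h (x - s • v) = ∫⁻ y, h y := by
    rw [lintegral_lintegral_swap hm.aemeasurable]
    simp_rw [lintegral_sub_right_eq_self h]
    rw [lintegral_const, Measure.restrict_apply_univ, hV₀, mul_one]
  -- One factor is bounded uniformly in `x` by the substitution, the other is integrated: `L²` from
  -- `L^∞` and `L¹`.
  calc ∫⁻ x : E d, (∫⁻ v in Metric.ball 0 V₀, h (x - s • v)) ^ 2
      ≤ ∫⁻ x : E d, (ENNReal.ofReal (s ^ d)⁻¹ * ∫⁻ y, h y)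
          * ∫⁻ v in Metric.ball 0 V₀, h (x - s • v) := by
        refine lintegral_mono fun x => ?_
        rw [sq]
        refine mul_le_mul_left ?_ _
        rw [← lintegral_comp_sub_smul hh hs x]
        exact setLIntegral_le_lintegral _ _
    _ = _ := by
        rw [lintegral_const_mul _ hJ, h1, sq, mul_assoc]

/-- Kernel, damping and weight ratio are bounded pointwise, which reduces to the unweighted estimate
for `h = |mρ|`. The datum must not depend on `v`, hence the averaging that precedes transport in
`norm_sndX_smoothing_le`. -/
theorem norm_averageLp_evol_sq_le (hγ : 0 ≤ γ) (hχ : 0 ≤ χ) {A : ℝ} {κ : E d → E d → ℝ}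
    (hκ : IsBoundedKernel V₀ A κ) {s : ℝ≥0} (hs : 0 < s) {ρ : E d → ℝ} (hρ : Measurable ρ)
    {f : L1m d V₀ γ} {g : L2m d V₀ γ} (hf : f =ᵐ[phaseMeasure d V₀] fun z => ρ z.1)
    (hg : g =ᵐ[phaseMeasure d V₀] fun z => ρ z.1) :
    ‖averageLp γ 2 2 hV₀ hκ (evol 2 2 hγ hχ 1 s g)‖ ^ 2
      ≤ ((s : ℝ) ^ d)⁻¹ * (A * Real.exp (-(1 - χ - γ * V₀) * s) * ‖f‖) ^ 2 := by
  set B := A * Real.exp (-(1 - χ - γ * V₀) * s)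
  have hB : 0 ≤ B := mul_nonneg hκ.nonneg (Real.exp_nonneg _)
  set h : E d → ℝ≥0∞ := fun x => ‖weight γ x * ρ x‖ₑ
  have hh : Measurable h := (continuous_weight.measurable.mul hρ).enorm
  have hfn : ‖f‖ₑ = ∫⁻ y, h y := by
    rw [Lp.enorm_def, eLpNorm_weighted inferInstance, eLpNorm_one_eq_lintegral_enorm,
      ← lintegral_phase_fst hV₀ hh]
    refine lintegral_congr_ae ?_
    filter_upwards [hf] with z hz
    rw [hz]
  have hT : evol 2 2 hγ hχ 1 s g =ᵐ[phaseMeasure d V₀]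
      transportOp s (damping 1 χ s) fun z => ρ z.1 := by
    filter_upwards [coeFn_evol hγ hχ 1 s g, ae_flow (-s) hg] with z h1 h2
    rw [h1, transportOp, transportOp, h2]
  have hpt : ∀ᵐ z ∂phaseMeasure d V₀,
      ‖weight γ z.1 * averageLp γ 2 2 hV₀ hκ (evol 2 2 hγ hχ 1 s g) z‖ₑ
        ≤ ENNReal.ofReal B * ∫⁻ v in Metric.ball 0 V₀, h (z.1 - (s : ℝ) • v) := by
    filter_upwards [coeFn_averageLp hV₀ hκ (evol 2 2 hγ hχ 1 s g), average_congr (κ := κ) hT]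
      with z h1 h2
    rw [h1, h2, average, ← integral_const_mul, ← lintegral_const_mul _ (by fun_prop)]
    refine (enorm_integral_le_lintegral_enorm _).trans
      (setLIntegral_mono' measurableSet_ball fun v hv => ?_)
    rw [mem_ball_zero_iff] at hv
    have e1 := hκ.bound z.1 v hv
    have e2 := damping_le hχ 1 s.coe_nonneg (z.1, v)
    have e3 := (damping_pos (χ := χ) 1 s (z.1, v)).le
    have e4 := weight_add_le hγ (z.1 - (s : ℝ) • v) ((s : ℝ) • v)
    have e5 : Real.exp (γ * ‖(s : ℝ) • v‖) ≤ Real.exp (γ * V₀ * s) := by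
      refine Real.exp_le_exp.2 ?_
      rw [norm_smul, Real.norm_of_nonneg s.coe_nonneg, mul_assoc, mul_comm V₀]
      gcongr
    rw [sub_add_cancel] at e4
    have hw := (weight_pos (γ := γ) (z.1 - (s : ℝ) • v)).le
    simp only [h, ← ofReal_norm]
    rw [← ENNReal.ofReal_mul hB]
    refine ENNReal.ofReal_le_ofReal ?_
    have e6 : (flow (-s) (z.1, v)).1 = z.1 - (s : ℝ) • v := by
      simp [flow, sub_eq_add_neg]
    rw [transportOp, e6, norm_mul, norm_mul, norm_mul, norm_mul, Real.norm_of_nonneg e3,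
      Real.norm_of_nonneg (weight_pos _).le, Real.norm_of_nonneg hw, Real.norm_eq_abs (κ _ _)]
    have e7 : Real.exp (γ * V₀ * s) * Real.exp (-(1 - χ) * s)
        = Real.exp (-(1 - χ - γ * V₀) * s) := by
      rw [← Real.exp_add]; congr 1; ring
    calc weight γ z.1 * (|κ z.1 v| * (damping 1 χ s (z.1, v) * ‖ρ (z.1 - (s : ℝ) • v)‖))
        ≤ Real.exp (γ * V₀ * s) * weight γ (z.1 - (s : ℝ) • v)
          * (A * (Real.exp (-(1 - χ) * s) * ‖ρ (z.1 - (s : ℝ) • v)‖)) := by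
          have := e4.trans (mul_le_mul_of_nonneg_right e5 hw)
          have := hκ.nonneg
          gcongr
      _ = _ := by simp only [B]; rw [← e7]; ring
  have hmain : ‖averageLp γ 2 2 hV₀ hκ (evol 2 2 hγ hχ 1 s g)‖ₑ ^ 2
      ≤ ENNReal.ofReal ((s : ℝ) ^ d)⁻¹ * (ENNReal.ofReal B * ‖f‖ₑ) ^ 2 := by
    rw [Lp.enorm_def, eLpNorm_weighted inferInstance, eLpNorm_pow_eq_lintegral inferInstance, hfn,
      mul_pow, mul_left_comm]
    calc _ ≤ ∫⁻ z, (ENNReal.ofReal B * ∫⁻ v in Metric.ball 0 V₀, h (z.1 - (s : ℝ) • v)) ^ 2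
          ∂phaseMeasure d V₀ := by
          refine lintegral_mono_ae ?_
          filter_upwards [hpt] with z hz
          gcongr
      _ = ENNReal.ofReal B ^ 2 * ∫⁻ z, (∫⁻ v in Metric.ball 0 V₀, h (z.1 - (s : ℝ) • v)) ^ 2
          ∂phaseMeasure d V₀ := by
          simp_rw [mul_pow]
          rw [lintegral_const_mul' _ _ (by simp)]
      _ ≤ _ := by
          gcongr
          exact lintegral_velocity_average_sq_le hV₀ hh (by exact_mod_cast hs)
  rw [← ofReal_norm, ← ofReal_norm, ← ENNReal.ofReal_mul hB,
    ← ENNReal.ofReal_pow (norm_nonneg _), ← ENNReal.ofReal_pow (by positivity),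
    ← ENNReal.ofReal_mul (by positivity)] at hmain
  exact (ENNReal.ofReal_le_ofReal_iff (by positivity)).1 hmain

theorem exists_measurable_density {A : ℝ} {κ : E d → E d → ℝ} (hκ : IsBoundedKernel V₀ A κ)
    (u : X d V₀ γ) : ∃ ρ : E d → ℝ, Measurable ρ ∧
      fstX d V₀ γ (averageX γ hV₀ hκ u) =ᵐ[phaseMeasure d V₀] fun z => ρ z.1 := by
  have h1 : AEStronglyMeasurable
      (fun x => ∫ v' in Metric.ball 0 V₀, κ x v' * fstX d V₀ γ u (x, v'))
      (volume : Measure (E d)) :=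
    (hκ.aesm.mul (aesm_L1m (fstX d V₀ γ u))).integral_prod_right'
  refine ⟨h1.mk _, h1.stronglyMeasurable_mk.measurable, ?_⟩
  filter_upwards [coeFn_averageLp hV₀ hκ (fstX d V₀ γ u), ae_fst h1.ae_eq_mk] with z h2 h3
  rw [fstX_averageX, h2, average, h3]

theorem norm_sndX_smoothing_le (hγ : 0 ≤ γ) (hχ : 0 ≤ χ) {A : ℝ} {κ : E d → E d → ℝ}
    (hκ : IsBoundedKernel V₀ A κ) {ε : ℝ} (hε : 0 < ε) (hε' : ε ≤ 1) {s : ℝ≥0} (hs : ε ≤ s)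
    (u : X d V₀ γ) :
    ‖sndX d V₀ γ (averageX γ hV₀ hκ (evolX hγ hχ 1 s (averageX γ hV₀ hκ u)))‖
      ≤ A ^ 2 / ε ^ d * Real.exp (-(1 - χ - γ * V₀) * s) * ‖fstX d V₀ γ u‖ := by
  obtain ⟨ρ, hρ, h1⟩ := exists_measurable_density hV₀ hκ u
  have h2 : sndX d V₀ γ (averageX γ hV₀ hκ u) =ᵐ[phaseMeasure d V₀] fun z => ρ z.1 :=
    (EventuallyEq.symm (fstX_ae_eq_sndX _)).trans h1
  have h3 := norm_averageLp_evol_sq_le hV₀ hγ hχ hκ (s := s) (by exact_mod_cast hε.trans_le hs)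
    hρ h1 h2
  have h4 : ‖fstX d V₀ γ (averageX γ hV₀ hκ u)‖ ≤ A * ‖fstX d V₀ γ u‖ :=
    (averageLp γ 1 1 hV₀ hκ).le_of_opNorm_le (norm_averageLp_le hV₀ hκ) _
  have hA := hκ.nonneg
  have hs0 : (0 : ℝ) < s := hε.trans_le hs
  -- Wasteful, using `ε ≤ 1`, so that no fractional power appears after the square root.
  have h5 : ((s : ℝ) ^ d)⁻¹ ≤ ((ε ^ d)⁻¹) ^ 2 := by
    have e1 : ((s : ℝ) ^ d)⁻¹ ≤ (ε ^ d)⁻¹ := by gcongr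
    have e2 : 1 ≤ (ε ^ d)⁻¹ := (one_le_inv₀ (by positivity)).2 (pow_le_one₀ hε.le hε')
    nlinarith
  refine le_of_sq_le_sq (h3.trans ?_) (by positivity)
  calc _ ≤ ((ε ^ d)⁻¹) ^ 2
        * (A * Real.exp (-(1 - χ - γ * V₀) * s) * (A * ‖fstX d V₀ γ u‖)) ^ 2 := by gcongr
    _ = _ := by ring

end Smoothing

/-! ### Duhamel's formula and absorption of the short lags -/

section Decay

variable {d : ℕ} {V₀ γ χ : ℝ} (hV₀ : volume (Metric.ball (0 : E d) V₀) = 1)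

theorem norm_sndX_evolX_le (hγ : 0 ≤ γ) (hχ : 0 ≤ χ) (t : ℝ≥0) (f : X d V₀ γ) :
    ‖sndX d V₀ γ (evolX hγ hχ 1 t f)‖ ≤ Real.exp (-(1 - χ - γ * V₀) * t) * ‖sndX d V₀ γ f‖ :=
  (evol 2 2 hγ hχ 1 t).le_of_opNorm_le (norm_evol_le hγ hχ 1 t) _

theorem norm_sndX_averageX_le {A : ℝ} {κ : E d → E d → ℝ} (hκ : IsBoundedKernel V₀ A κ)
    (f : X d V₀ γ) : ‖sndX d V₀ γ (averageX γ hV₀ hκ f)‖ ≤ A * ‖sndX d V₀ γ f‖ :=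
  (averageLp γ 2 2 hV₀ hκ).le_of_opNorm_le (norm_averageLp_le hV₀ hκ) _

theorem exp_mul_exp_eq {a b s t : ℝ} : Real.exp (-b * (t - s)) * Real.exp (a * s)
    = Real.exp (a * t) * Real.exp (-(b + a) * (t - s)) := by
  rw [← Real.exp_add, ← Real.exp_add]; congr 1; ring

theorem norm_apply_mild_le {Z Y : Type*} [NormedAddCommGroup Z] [NormedSpace ℝ Z] [CompleteSpace Z]
    [NormedAddCommGroup Y] [NormedSpace ℝ Y] {S : ℝ≥0 → Z →L[ℝ] Z} {G : Z → Z → Prop}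
    (hS : IsSemigroupGeneratedBy G S) {B : Z →L[ℝ] Z} {f : Z} {u : ℝ≥0 → Z} (hu : Continuous u)
    (hm : IsMild S B f u) (L : Z →L[ℝ] Y) [CompleteSpace Y] {t : ℝ≥0} {c : ℝ} {g : ℝ → ℝ}
    (hc : ‖L (S t f)‖ ≤ c) (hg : Continuous g)
    (h : ∀ r s : ℝ≥0, r + s = t → ‖L (S r (B (u s)))‖ ≤ g s) :
    ‖L (u t)‖ ≤ c + ∫ s in (0 : ℝ)..t, g s := by
  have hi : IntervalIntegrable (fun s : ℝ => S (t - s : ℝ).toNNReal (B (u s.toNNReal))) volume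
      0 t := by
    have := (continuous_convolution_integrand hS B 0 hu).comp
      (Continuous.prodMk_right (t : ℝ))
    simp only [Function.comp_def, neg_zero, zero_mul, Real.exp_zero, one_smul] at this
    exact this.intervalIntegrable _ _
  rw [hm t, map_add, ← L.intervalIntegral_comp_comm hi]
  refine (norm_add_le _ _).trans (add_le_add hc ?_)
  refine intervalIntegral.norm_integral_le_of_norm_le t.coe_nonneg (ae_of_all _ fun s hs => ?_)
    (hg.intervalIntegrable _ _)
  have h1 := h (t - s : ℝ).toNNReal s.toNNReal (by
    rw [← Real.toNNReal_add (by linarith [hs.2]) hs.1.le, sub_add_cancel, Real.toNNReal_coe])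
  rwa [Real.coe_toNNReal s hs.1.le] at h1

/-- The averaged solution `y` is bounded first. Its Duhamel integral is split by the lag: beyond
`1/32` two averages smooth `L¹` into `L²` and the decay `h1` applies; below `1/32` the bound by `M`
itself carries a small factor. A second use of Duhamel's formula then controls `u`. -/
theorem norm_sndX_le_exp (hγ : 0 ≤ γ) (hχ : χ ∈ Ioo (0 : ℝ) 1) (hd : 1 ≤ d) {κ : E d → E d → ℝ}
    (hκ : IsBoundedKernel V₀ 4 κ) {a C : ℝ} (ha : 0 < 1 - χ - γ * V₀ + a) (hC : 0 ≤ C)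
    {f : X d V₀ γ} {u : ℝ≥0 → X d V₀ γ} (hu : Continuous u)
    (hm : IsMild (evolX hγ hχ.1.le 1) (averageX γ hV₀ hκ) f u)
    (h1 : ∀ t, ‖fstX d V₀ γ (u t)‖ ≤ C * Real.exp (a * t) * ‖f‖) (t : ℝ≥0) :
    ‖sndX d V₀ γ (u t)‖ ≤ (1 + 2 * (4 + 4 ^ 2 / (1 / 32) ^ d * C / (1 - χ - γ * V₀ + a))
      / (1 - χ - γ * V₀ + a)) * Real.exp (a * t) * ‖f‖ := by
  set b := 1 - χ - γ * V₀ with hb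
  have hS := isSemigroupGeneratedBy_evolX (d := d) (V₀ := V₀) hd hγ hχ
  set C₃ := 4 ^ 2 / (1 / 32) ^ d * C
  have hC₃ : 0 ≤ C₃ := by positivity
  set y : ℝ≥0 → L2m d V₀ γ := fun t => sndX d V₀ γ (averageX γ hV₀ hκ (u t)) with hy
  have hyc : Continuous fun t : ℝ≥0 => Real.exp (-(a * t)) * ‖y t‖ := by fun_prop
  -- Evaluating at a maximum point makes `M` finite and lets `M / 2` be absorbed; the resulting
  -- bound does not depend on `t`.
  obtain ⟨r, hr, hmax⟩ := (isCompact_Icc (a := (0 : ℝ≥0)) (b := t)).exists_isMaxOn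
    ⟨0, by simp⟩ hyc.continuousOn
  set M := Real.exp (-(a * r)) * ‖y r‖ with hM
  have hM0 : 0 ≤ M := by positivity
  have hyM : ∀ s : ℝ≥0, s ≤ t → ‖y s‖ ≤ M * Real.exp (a * s) := fun s hs => by
    have h2 : Real.exp (-(a * s)) * ‖y s‖ ≤ M := hmax ⟨zero_le, hs⟩
    calc ‖y s‖ = Real.exp (-(a * s)) * ‖y s‖ * Real.exp (a * s) := by
          rw [mul_right_comm, ← Real.exp_add, neg_add_cancel, Real.exp_zero, one_mul]
      _ ≤ _ := by gcongr
  have hcoe : ∀ {q s r : ℝ≥0}, q + s = r → (q : ℝ) = r - s := fun h => by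
    rw [← h]; push_cast; ring
  have hyr : ‖y r‖ ≤ 4 * (Real.exp (a * r) * ‖f‖) + ∫ s in (0 : ℝ)..r, Real.exp (a * r)
      * (4 * M * Real.exp 1 * Real.exp (-32 * (r - s))
        + C₃ * ‖f‖ * Real.exp (-(b + a) * (r - s))) := by
    refine norm_apply_mild_le hS hu hm ((sndX d V₀ γ).comp (averageX γ hV₀ hκ)) ?_
      (by fun_prop) fun q s hqs => ?_
    · refine (norm_sndX_averageX_le hV₀ hκ _).trans ?_
      gcongr
      refine (norm_sndX_evolX_le hγ hχ.1.le r f).trans ?_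
      gcongr
      · linarith
      · exact norm_sndX_le f
    · have hq := hcoe hqs
      have hst : s ≤ t := le_trans (by rw [← hqs]; exact le_add_self) hr.2
      have hn : 0 ≤ C₃ * ‖f‖ * Real.exp (-(b + a) * (r - s)) := by positivity
      have hn' : 0 ≤ 4 * M * Real.exp 1 * Real.exp (-32 * (r - s)) := by positivity
      rcases le_total (1 / 32 : ℝ) q with h32 | h32
      · have h2 := norm_sndX_smoothing_le hV₀ hγ hχ.1.le hκ (by norm_num) (by norm_num) h32 (u s)
        refine h2.trans ?_
        calc _ ≤ 4 ^ 2 / (1 / 32) ^ d * Real.exp (-b * q) * (C * Real.exp (a * s) * ‖f‖) := by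
              gcongr; exact h1 s
          _ = C₃ * ‖f‖ * (Real.exp (-b * (r - s)) * Real.exp (a * s)) := by
              rw [hq]; simp only [C₃]; ring
          _ = Real.exp (a * r) * (C₃ * ‖f‖ * Real.exp (-(b + a) * (r - s))) := by
              rw [exp_mul_exp_eq]; ring
          _ ≤ _ := by gcongr; linarith
      · calc _ ≤ 4 * (Real.exp (-b * q) * (M * Real.exp (a * s))) := by
              refine (norm_sndX_averageX_le hV₀ hκ _).trans ?_
              gcongr
              refine (norm_sndX_evolX_le hγ hχ.1.le q _).trans ?_
              gcongr
              exact hyM s hst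
          _ = Real.exp (a * r) * (4 * M * Real.exp (-(b + a) * (r - s))) := by
              rw [hq]
              linear_combination (4 * M) * exp_mul_exp_eq (a := a) (b := b) (s := s) (t := r)
          -- `exp (1 - 32 q)` is a continuous majorant of the indicator of `q ≤ 1/32`; its integral
          -- is at most `e/32`, so the short lags contribute at most `4Me/32 ≤ M/2`.
          _ ≤ Real.exp (a * r) * (4 * M * Real.exp 1 * Real.exp (-32 * (r - s))) := by
              rw [mul_assoc (4 * M), ← Real.exp_add, ← hq]
              gcongr
              nlinarith [q.coe_nonneg]
          _ ≤ _ := by gcongr; linarith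
  have hint : ∫ s in (0 : ℝ)..r, Real.exp (a * r) * (4 * M * Real.exp 1 * Real.exp (-32 * (r - s))
      + C₃ * ‖f‖ * Real.exp (-(b + a) * (r - s)))
      ≤ Real.exp (a * r) * (4 * M * Real.exp 1 * (1 / 32) + C₃ * ‖f‖ * (1 / (b + a))) := by
    rw [intervalIntegral.integral_const_mul, intervalIntegral.integral_add
      (Continuous.intervalIntegrable (by fun_prop) _ _)
      (Continuous.intervalIntegrable (by fun_prop) _ _), intervalIntegral.integral_const_mul,
      intervalIntegral.integral_const_mul]
    gcongr
    · exact integral_exp_neg_le (by norm_num) _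
    · exact integral_exp_neg_le ha _
  have hMle : M ≤ 2 * (4 + C₃ / (b + a)) * ‖f‖ := by
    have h2 : M ≤ 4 * ‖f‖ + (4 * M * Real.exp 1 * (1 / 32) + C₃ * ‖f‖ * (1 / (b + a))) := by
      have h3 : ‖y r‖ ≤ Real.exp (a * r)
          * (4 * ‖f‖ + (4 * M * Real.exp 1 * (1 / 32) + C₃ * ‖f‖ * (1 / (b + a)))) := by
        linarith
      refine (mul_le_mul_of_nonneg_left h3 (Real.exp_nonneg (-(a * r)))).trans (le_of_eq ?_)
      rw [← mul_assoc, ← Real.exp_add, neg_add_cancel, Real.exp_zero, one_mul]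
    have he : 4 * M * Real.exp 1 * (1 / 32) ≤ M / 2 := by
      nlinarith [Real.exp_one_lt_d9]
    have e : C₃ * ‖f‖ * (1 / (b + a)) = C₃ / (b + a) * ‖f‖ := by ring
    linarith
  have hut : ‖sndX d V₀ γ (u t)‖ ≤ Real.exp (a * t) * ‖f‖ + ∫ s in (0 : ℝ)..t, Real.exp (a * t)
      * (M * Real.exp (-(b + a) * (t - s))) := by
    refine norm_apply_mild_le hS hu hm (sndX d V₀ γ) ?_ (by fun_prop) fun q s hqs => ?_
    · refine (norm_sndX_evolX_le hγ hχ.1.le t f).trans ?_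
      gcongr
      · linarith
      · exact norm_sndX_le f
    · have hst : s ≤ t := by rw [← hqs]; exact le_add_self
      calc _ ≤ Real.exp (-b * q) * (M * Real.exp (a * s)) := by
            refine (norm_sndX_evolX_le hγ hχ.1.le q _).trans ?_
            gcongr
            exact hyM s hst
        _ = _ := by rw [hcoe hqs, mul_left_comm, exp_mul_exp_eq]; ring
  rw [intervalIntegral.integral_const_mul, intervalIntegral.integral_const_mul] at hut
  have h2 := integral_exp_neg_le ha t
  calc _ ≤ Real.exp (a * t) * ‖f‖ + Real.exp (a * t)
        * (2 * (4 + C₃ / (b + a)) * ‖f‖ * (1 / (b + a))) := by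
        refine hut.trans (add_le_add_right (mul_le_mul_of_nonneg_left (mul_le_mul hMle h2
          (intervalIntegral.integral_nonneg t.coe_nonneg fun _ _ => Real.exp_nonneg _)
          (hM0.trans hMle)) (Real.exp_nonneg _)) _)
    _ = _ := by ring

end Decay

/-! ### Generation together with decay, given a Lyapunov weight -/

section Generation

variable {d : ℕ} {V₀ γ χ : ℝ} (hV₀ : volume (Metric.ball (0 : E d) V₀) = 1)

include hV₀

theorem exists_semigroup_Lp_of_isLyapunov (hd : 1 ≤ d) (hγ : 0 ≤ γ) (hχ : χ ∈ Ioo (0 : ℝ) 1)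
    (hb : 0 ≤ 1 - χ - γ * V₀) {κ : E d → E d → ℝ} (hκ : IsBoundedKernel V₀ 2 κ) {a C : ℝ}
    {w : E d × E d → ℝ} (hw : IsLyapunov V₀ γ χ a C (remainderKernel χ κ) w) (hC : 0 ≤ C) :
    ∃ S : ℝ≥0 → L1m d V₀ γ →L[ℝ] L1m d V₀ γ,
      IsSemigroupGeneratedBy (fun f g : L1m d V₀ γ => IsL V₀ χ f (average V₀ κ f + g)) S ∧
      ∀ t : ℝ≥0, ‖S t‖ ≤ 2 * C * Real.exp (a * t) := by
  obtain ⟨S, hS, hS'⟩ := exists_semigroup_Lp (q := 1) (p := 1) hV₀ hd hγ hχ hb hκ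
  refine ⟨S, hS, fun t => ContinuousLinearMap.opNorm_le_bound _ (by positivity) fun f => ?_⟩
  have h := hw.norm_le_exp hV₀ (hκ.remainder hχ) hγ hχ.1.le (hS.continuous f) (fun t => by
    simp only [hS.map_add, ContinuousLinearMap.comp_apply]
    exact hS' (S t f)) t
  simpa [hS.map_zero] using h

theorem exists_semigroup_X_of_isLyapunov (hd : 1 ≤ d) (hγ : 0 ≤ γ) (hχ : χ ∈ Ioo (0 : ℝ) 1)
    (hb : 0 ≤ 1 - χ - γ * V₀) {κ : E d → E d → ℝ} (hκ : IsBoundedKernel V₀ 2 κ) {a C : ℝ}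
    {w : E d × E d → ℝ} (hw : IsLyapunov V₀ γ χ a C (remainderKernel χ κ) w) (hC : 0 ≤ C)
    (ha : 0 < 1 - χ - γ * V₀ + a) :
    ∃ S : ℝ≥0 → X d V₀ γ →L[ℝ] X d V₀ γ,
      IsSemigroupGeneratedBy (fun f g : X d V₀ γ =>
        IsL V₀ χ f.1.fst (average V₀ κ f.1.fst + g.1.fst)) S ∧
      ∃ D > 0, ∀ t : ℝ≥0, ‖S t‖ ≤ D * Real.exp (a * t) := by
  obtain ⟨S, hS, hm, hS'⟩ := exists_semigroup_X hV₀ hd hγ hχ hb hκ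
  -- The first component satisfies the hypotheses of `norm_le_exp` directly, so it need not be
  -- identified with a semigroup on `L¹(m)`.
  have h1 : ∀ (f : X d V₀ γ) (t : ℝ≥0),
      ‖fstX d V₀ γ (S t f)‖ ≤ 2 * C * Real.exp (a * t) * ‖f‖ := fun f t => by
    have h := hw.norm_le_exp hV₀ (hκ.remainder hχ) hγ hχ.1.le
      (u := fun t => fstX d V₀ γ (S t f)) ((fstX d V₀ γ).continuous.comp (hS.continuous f))
      (fun t => by
        have := ((fstX d V₀ γ).continuous.tendsto _).comp (hS' (S t f))
        simpa only [Function.comp_def, map_smul, map_sub, hS.map_add,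
          ContinuousLinearMap.comp_apply, fstX_evolX, fstX_averageX] using this) t
    refine h.trans (mul_le_mul_of_nonneg_left ?_ (by positivity))
    simpa [hS.map_zero] using norm_fstX_le f
  refine ⟨S, hS, 2 * C + (1 + 2 * (4 + 4 ^ 2 / (1 / 32) ^ d * (2 * C) / (1 - χ - γ * V₀ + a))
      / (1 - χ - γ * V₀ + a)), by positivity,
    fun t => ContinuousLinearMap.opNorm_le_bound _ (by positivity) fun f => ?_⟩
  have h2 := norm_sndX_le_exp hV₀ hγ hχ hd (hκ.remainder hχ) ha (by positivity)
    (hS.continuous f) (hm f) (h1 f) t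
  refine (norm_X_le _).trans ((add_le_add (h1 f t) h2).trans (le_of_eq ?_))
  ring

end Generation

/-! ## The truncated kernels -/

section Kernels

variable {d : ℕ} {V₀ χ : ℝ} {ϕ ζ : ℝ → ℝ} {δ : ℝ}

namespace IsCutoffProfile

theorem exists_unit (hd : 1 ≤ d) : ∃ e : E d, ‖e‖ = 1 :=
  ⟨EuclideanSpace.single ⟨0, hd⟩ 1, by simp⟩

variable (hϕ : IsCutoffProfile d ϕ) (hd : 1 ≤ d)

include hϕ hd

theorem bounds {s : ℝ} (hs : 0 ≤ s) : (if s < 1 then 1 else 0) ≤ ϕ s ∧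
    ϕ s ≤ if s < 2 then 1 else 0 := by
  obtain ⟨e, he⟩ := exists_unit hd
  have hn : ‖s • e‖ = s := by rw [norm_smul, he, mul_one, Real.norm_of_nonneg hs]
  have h1 := hϕ.lower (s • e)
  have h2 := hϕ.upper (s • e)
  rw [hn] at h1 h2
  simpa [indicator, hn] using And.intro h1 h2

theorem nonneg {s : ℝ} (hs : 0 ≤ s) : 0 ≤ ϕ s :=
  le_trans (by split_ifs <;> norm_num) (hϕ.bounds hd hs).1

theorem le_one {s : ℝ} (hs : 0 ≤ s) : ϕ s ≤ 1 :=
  (hϕ.bounds hd hs).2.trans (by split_ifs <;> norm_num)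

theorem eq_one {s : ℝ} (hs : 0 ≤ s) (hs' : s < 1) : ϕ s = 1 :=
  le_antisymm (hϕ.le_one hd hs) (by simpa [hs'] using (hϕ.bounds hd hs).1)

theorem eq_zero {s : ℝ} (hs : 2 ≤ s) : ϕ s = 0 :=
  have h0 : 0 ≤ s := zero_le_two.trans hs
  le_antisymm ((hϕ.bounds hd h0).2.trans_eq (if_neg hs.not_gt)) (hϕ.nonneg hd h0)

/-- The profile is constrained only on `[0, ∞)`, through its radial extension; restricting that
extension to a ray recovers its continuity there. -/
theorem continuous_comp_max : Continuous fun s => ϕ (max s 0) := by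
  obtain ⟨e, he⟩ := exists_unit hd
  have h : (fun s => ϕ (max s 0)) = (fun x : E d => ϕ ‖x‖) ∘ fun s => max s 0 • e := by
    funext s
    simp only [Function.comp_apply, norm_smul, he, mul_one]
    rw [Real.norm_of_nonneg (le_max_right _ _)]
  rw [h]
  exact hϕ.smooth.continuous.comp (by fun_prop)

theorem measurable_cutoff {r : ℝ} (hr : 0 < r) : Measurable (cutoff ϕ r : E d → ℝ) := by
  have h : (cutoff ϕ r : E d → ℝ) = (fun s => ϕ (max s 0)) ∘ fun x : E d => ‖x‖ / r := by
    funext x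
    simp only [cutoff, Function.comp_apply]
    rw [max_eq_left (by positivity)]
  rw [h]
  exact ((hϕ.continuous_comp_max hd).comp (by fun_prop)).measurable

theorem cutoff_mem {r : ℝ} (hr : 0 < r) (x : E d) : 0 ≤ cutoff ϕ r x ∧ cutoff ϕ r x ≤ 1 :=
  ⟨hϕ.nonneg hd (by positivity), hϕ.le_one hd (by positivity)⟩

theorem abs_velocityCutoff_le (hδ : 0 < δ) {v : E d} (hv : ‖v‖ < V₀) :
    |velocityCutoff V₀ ϕ δ v| ≤ 1 := by
  have h1 : 0 ≤ (V₀ - ‖v‖) / δ := div_nonneg (by linarith) hδ.le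
  have h2 := hϕ.nonneg hd h1
  have h3 := hϕ.le_one hd h1
  have h4 := hϕ.cutoff_mem hd hδ v
  rw [velocityCutoff, abs_le]
  constructor <;> linarith

theorem isBoundedKernel_cutoff_mul (hχ : χ ∈ Ioo (0 : ℝ) 1) {R : ℝ} (hR : 0 < R) :
    IsBoundedKernel V₀ 2 (fun x v' : E d => cutoff ϕ R x * turningKernel χ x v') where
  nonneg := by norm_num
  aesm := (((hϕ.measurable_cutoff hd hR).comp measurable_fst).mul
    measurable_turningKernel).aestronglyMeasurable
  bound := fun x v _ => by
    have h1 := hϕ.cutoff_mem hd hR x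
    have h2 := abs_turningKernel_le hχ x v
    rw [abs_mul, abs_of_nonneg h1.1]
    nlinarith [abs_nonneg (turningKernel χ x v)]

end IsCutoffProfile

namespace IsRegularizedSign

variable (hζ : IsRegularizedSign δ ζ)

include hζ

theorem abs_le_one (s : ℝ) : |ζ s| ≤ 1 := by
  have h : ∀ s, ζ s ≤ 1 := fun s =>
    (hζ.mono (le_max_left s δ)).trans (hζ.eq_one _ (le_max_right _ _)).le
  have := h (-s)
  rw [hζ.odd] at this
  exact abs_le.2 ⟨by linarith, h s⟩

theorem eq_sign (hδ : 0 < δ) {s : ℝ} (hs : δ ≤ |s|) : ζ s = Real.sign s := by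
  rcases le_abs.1 hs with h | h
  · rw [hζ.eq_one s h, Real.sign_of_pos (hδ.trans_le h)]
  · have := hζ.eq_one _ h
    rw [hζ.odd] at this
    rw [Real.sign_of_neg (by linarith)]
    linarith

end IsRegularizedSign

theorem IsCutoffProfile.isBoundedKernel_truncated (hϕ : IsCutoffProfile d ϕ) (hd : 1 ≤ d)
    (hχ : χ ∈ Ioo (0 : ℝ) 1) {R δ₁ δ₂ δ₃ : ℝ} (hR : 0 < R) (hδ₁ : 0 < δ₁) (hδ₂ : 0 < δ₂)
    (hζ : IsRegularizedSign δ₃ ζ) :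
    IsBoundedKernel V₀ 2 (truncatedKernel V₀ χ ϕ R δ₁ δ₂ ζ : E d → E d → ℝ) where
  nonneg := by norm_num
  aesm := by
    have h1 : Measurable fun z : E d × E d => cutoff ϕ R z.1 - cutoff ϕ δ₂ z.1 :=
      ((hϕ.measurable_cutoff hd hR).sub (hϕ.measurable_cutoff hd hδ₂)).comp measurable_fst
    have h2 : Measurable fun z : E d × E d =>
        1 - ϕ (max ((V₀ - ‖z.2‖) / δ₁) 0) - cutoff ϕ δ₁ z.2 :=
      (((hϕ.continuous_comp_max hd).comp (g := fun s => ϕ (max s 0))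
        (f := fun z : E d × E d => (V₀ - ‖z.2‖) / δ₁) (by fun_prop)).measurable.const_sub 1).sub
        ((hϕ.measurable_cutoff hd hδ₁).comp measurable_snd)
    have h3 : Measurable fun z : E d × E d => 1 + χ * ζ (inner ℝ z.1 z.2) :=
      ((hζ.smooth.continuous.comp (continuous_fst.inner continuous_snd)).measurable.const_mul
        χ).const_add 1
    -- Truncating the argument of `ϕ` at `0` changes nothing on the velocity ball and avoids the
    -- uncontrolled negative arguments.
    refine ((h1.mul h2).mul h3).aestronglyMeasurable.congr ?_
    filter_upwards [ae_velocity_lt] with z hz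
    simp only [Pi.mul_apply, truncatedKernel, velocityCutoff]
    rw [max_eq_left (div_nonneg (by linarith) hδ₁.le)]
  bound := fun x v hv => by
    have h1 := hϕ.cutoff_mem hd hR x
    have h2 := hϕ.cutoff_mem hd hδ₂ x
    have h3 : |cutoff ϕ R x - cutoff ϕ δ₂ x| ≤ 1 := abs_le.2 ⟨by linarith, by linarith⟩
    have h4 : |velocityCutoff V₀ ϕ δ₁ v| ≤ 1 := hϕ.abs_velocityCutoff_le hd hδ₁ hv
    have h5 := abs_le.1 (hζ.abs_le_one (inner ℝ x v))
    have h6 : |1 + χ * ζ (inner ℝ x v)| ≤ 2 := by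
      rw [abs_le]; constructor <;> nlinarith [hχ.1, hχ.2]
    rw [truncatedKernel, abs_mul, abs_mul]
    refine (mul_le_mul (mul_le_mul h3 h4 (abs_nonneg _) one_pos.le) h6 (abs_nonneg _)
      (by norm_num)).trans (by norm_num)

/-- The velocities which are small or close to the boundary of the velocity ball. -/
def extremeVelocities (d : ℕ) (V₀ δ : ℝ) : Set (E d) := {v | ‖v‖ < 2 * δ ∨ V₀ - 2 * δ < ‖v‖}

theorem measurableSet_extremeVelocities : MeasurableSet (extremeVelocities d V₀ δ) :=
  (measurableSet_lt measurable_norm measurable_const).union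
    (measurableSet_lt measurable_const measurable_norm)

/-- These sets decrease, inside the open ball, to at most `{0}`, which is null since `d ≥ 1`. -/
theorem tendsto_extremeVelocities (hd : 1 ≤ d) :
    Tendsto (fun δ => volume.real (extremeVelocities d V₀ δ ∩ Metric.ball 0 V₀)) (𝓝[>] 0)
      (𝓝 0) := by
  have : Nonempty (Fin d) := ⟨⟨0, hd⟩⟩
  have h := tendsto_measure_biInter_gt (μ := (volume : Measure (E d)))
    (s := fun δ => extremeVelocities d V₀ δ ∩ Metric.ball 0 V₀) (a := (0 : ℝ))
    (fun δ _ => (measurableSet_extremeVelocities.inter measurableSet_ball).nullMeasurableSet)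
    (fun i j _ hij v hv => ⟨hv.1.imp (fun h => by linarith) (fun h => by linarith), hv.2⟩)
    ⟨1, one_pos, measure_inter_ne_top_of_right_ne_top measure_ball_lt_top.ne⟩
  have h0 : volume (⋂ δ > (0 : ℝ), extremeVelocities d V₀ δ ∩ Metric.ball 0 V₀) = 0 := by
    refine measure_mono_null (fun v hv => ?_) (measure_singleton (0 : E d))
    simp only [mem_iInter] at hv
    by_contra hne
    have h1 := norm_pos_iff.2 hne
    have h2 := mem_ball_zero_iff.1 (hv 1 one_pos).2
    have h3 : 0 < min ‖v‖ (V₀ - ‖v‖) / 2 := by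
      have := lt_min h1 (sub_pos.2 h2); positivity
    rcases (hv _ h3).1 with h4 | h4
    · linarith [min_le_left ‖v‖ (V₀ - ‖v‖)]
    · linarith [min_le_right ‖v‖ (V₀ - ‖v‖)]
  rw [h0] at h
  exact (ENNReal.tendsto_toReal (by simp)).comp h

variable {R N ε σ : ℝ}

theorem IsCutoffProfile.isControlled_cutoff_mul (hϕ : IsCutoffProfile d ϕ) (hd : 1 ≤ d)
    (hχ : χ ∈ Ioo (0 : ℝ) 1) (hR : 0 < R) (z : E d × E d) :
    IsControlled χ R N ε σ ∅
      (remainderKernel χ fun x v' : E d => cutoff ϕ R x * turningKernel χ x v') z := by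
  have h1 := hϕ.cutoff_mem hd hR z.1
  have h2 := (turningKernel_bounds hχ z.1 z.2).1
  have h3 : 0 ≤ turningKernel χ z.1 z.2 := by linarith [hχ.2]
  refine Or.inl ⟨notMem_empty _, ?_, fun hx => ?_⟩
  · rw [remainderKernel, abs_le]
    constructor <;> nlinarith
  · rw [remainderKernel, cutoff, hϕ.eq_one hd (by positivity) ((div_lt_one hR).2 hx), one_mul,
      sub_self]

/-- Away from extreme velocities and from the strip `|x·v| ≤ σ` no regularization is felt: the
velocity cutoff is `1`, `ζ` equals the sign, and `|x| ≥ σ/V₀ ≥ 2δ₂` kills `φ_{δ₂}`. The kernel is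
then that of `ℬ₁`. -/
theorem IsCutoffProfile.isControlled_truncated (hϕ : IsCutoffProfile d ϕ) (hd : 1 ≤ d)
    (hχ : χ ∈ Ioo (0 : ℝ) 1) (hR : 0 < R) {δ₁ δ₂ δ₃ : ℝ} (hδ₁ : 0 < δ₁) (hδ₂ : 0 < δ₂)
    (hδ₃ : 0 < δ₃) (hζ : IsRegularizedSign δ₃ ζ) (hN : 36 / (1 - χ) ≤ N) (hε : 0 ≤ ε) (hσ : 0 < σ)
    (h₁ : 9 * σ ≤ 2 * ε * δ₁ ^ 2) (h₂ : 2 * δ₂ * V₀ ≤ σ) (h₃ : δ₃ ≤ σ) {z : E d × E d}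
    (hz : ‖z.2‖ < V₀) :
    IsControlled χ R N ε σ (extremeVelocities d V₀ δ₁)
      (remainderKernel χ (truncatedKernel V₀ χ ϕ R δ₁ δ₂ ζ)) z := by
  by_cases hv : z.2 ∈ extremeVelocities d V₀ δ₁
  · exact Or.inr (Or.inl ⟨hv, hN⟩)
  have hv' := hv
  rw [extremeVelocities, mem_ofPred_eq, not_or, not_lt, not_lt] at hv'
  rcases le_or_gt |(inner ℝ z.1 z.2 : ℝ)| σ with hr | hr
  · refine Or.inr (Or.inr ⟨hr, ?_⟩)
    have h4 : (2 * δ₁) ^ 2 ≤ ‖z.2‖ ^ 2 := by gcongr; exact hv'.1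
    rw [mul_div_assoc', le_div_iff₀ (by positivity)]
    nlinarith
  have hx : 2 ≤ ‖z.1‖ / δ₂ := by
    rw [le_div_iff₀ hδ₂]
    have h4 := (abs_real_inner_le_norm z.1 z.2).trans
      (mul_le_mul_of_nonneg_left hz.le (norm_nonneg _))
    have hV : 0 < V₀ := (norm_nonneg _).trans_lt hz
    exact le_of_mul_le_mul_right (by linarith) hV
  have hκ : remainderKernel χ (truncatedKernel V₀ χ ϕ R δ₁ δ₂ ζ) z.1 z.2
      = remainderKernel χ (fun x v' : E d => cutoff ϕ R x * turningKernel χ x v') z.1 z.2 := by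
    simp only [remainderKernel, truncatedKernel, velocityCutoff]
    rw [hζ.eq_sign hδ₃ (h₃.trans hr.le), hϕ.eq_zero hd (s := (V₀ - ‖z.2‖) / δ₁)
      (by rw [le_div_iff₀ hδ₁]; linarith [hv'.2]), cutoff, cutoff, cutoff, hϕ.eq_zero hd hx,
      hϕ.eq_zero hd (s := ‖z.2‖ / δ₁) (by rw [le_div_iff₀ hδ₁]; linarith [hv'.1]), turningKernel]
    ring
  -- The empty set and the negative `σ` rule out the last two alternatives, so the first one must
  -- hold.
  have h5 := hϕ.isControlled_cutoff_mul (N := 0) (ε := 0) (σ := -1) hd hχ hR z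
  rcases h5 with h5 | h5 | h5
  · refine Or.inl ⟨hv, ?_⟩
    rw [hκ]
    exact h5.2
  · exact absurd h5.1 (notMem_empty _)
  · linarith [h5.1, abs_nonneg (inner ℝ z.1 z.2 : ℝ)]

/-- Every upper bound required has the form `γ k ≤ l` with `l > 0`. -/
theorem exists_isSmallExponent {c₀ : ℝ} (hχ : χ ∈ Ioo (0 : ℝ) 1) (hc₀ : 0 < c₀) :
    ∃ γs > 0, ∀ γ ∈ Ioo 0 γs, IsSmallExponent V₀ χ c₀ γ := by
  have h3 : 0 < 1 - χ := by linarith [hχ.2]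
  have hχ0 := hχ.1
  have key : ∀ k l : ℝ, 0 < l → ∀ᶠ γ in 𝓝[>] (0 : ℝ), γ * k ≤ l := fun k l hl => by
    have : Tendsto (fun γ : ℝ => γ * k) (𝓝[>] 0) (𝓝 (0 * k)) :=
      (tendsto_id.mul_const k).mono_left nhdsWithin_le_nhds
    rw [zero_mul] at this
    filter_upwards [this.eventually_lt_const hl] with γ h using h.le
  have h := (key V₀ ((1 - χ) / 2) (by positivity)).and
    ((key (V₀ / (1 - χ)) (1 / 4) (by positivity)).and
    ((key (2 * V₀ ^ 2 / (1 - χ)) ((1 - χ) / 8) (by positivity)).and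
    ((key (V₀ ^ 2 / (1 - χ)) (χ * c₀ / (8 * (1 + χ))) (by positivity)).and
    (key (χ * c₀ / (8 * (1 + χ))) ((1 - χ) / 2) (by positivity)))))
  obtain ⟨γs, h0, hs⟩ := mem_nhdsGT_iff_exists_Ioo_subset.1 h
  refine ⟨γs, h0, fun γ hγ => ?_⟩
  obtain ⟨a1, a2, a3, a4, a5⟩ := hs hγ
  exact ⟨hγ.1, a1, by rwa [mul_div_assoc], a3, a4, a5⟩

end Kernels

end RunTumble

end

/-! ### Choice of the parameters and conclusion -/

open RunTumble

theorem proposition4p1 (d : ℕ) (hd : 1 ≤ d) (V₀ : ℝ)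
    (hV₀ : volume (Metric.ball (0 : RunTumble.E d) V₀) = 1)
    (χ : ℝ) (hχ : χ ∈ Ioo (0 : ℝ) 1) (ϕ : ℝ → ℝ) (hϕ : RunTumble.IsCutoffProfile d ϕ) :
    ∃ γs : ℝ, 0 < γs ∧ ∀ γ ∈ Ioo (0 : ℝ) γs,
      ∃ as : ℝ, as < 0 ∧ ∃ R₀ : ℝ, 1 < R₀ ∧
        (∃ C : ℝ, 1 ≤ C ∧ ∀ R : ℝ, R₀ ≤ R →
          (∃ S, RunTumble.IsSB₁ d V₀ χ γ ϕ R S) ∧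
          ∀ S, RunTumble.IsSB₁ d V₀ χ γ ϕ R S →
            ∀ t : ℝ≥0, ‖S t‖ ≤ C * Real.exp (as * t)) ∧
        (∀ R : ℝ, R₀ ≤ R →
          ∃ b₁ ∈ Ioo (0 : ℝ) 1, ∀ δ₁ ∈ Ioo 0 b₁,
          ∃ b₂ ∈ Ioo (0 : ℝ) 1, ∀ δ₂ ∈ Ioo 0 b₂,
          ∃ b₃ ∈ Ioo (0 : ℝ) 1, ∀ δ₃ ∈ Ioo 0 b₃,
          ∀ ζ : ℝ → ℝ, RunTumble.IsRegularizedSign δ₃ ζ →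
            (∃ S, RunTumble.IsSB d V₀ χ γ ϕ R δ₁ δ₂ ζ S) ∧
            ∀ S, RunTumble.IsSB d V₀ χ γ ϕ R δ₁ δ₂ ζ S →
              ∀ a : ℝ, as < a → ∃ C : ℝ, 0 < C ∧
                ∀ t : ℝ≥0, ‖S t‖ ≤ C * Real.exp (a * t)) := by
  have hV : 0 < V₀ := by
    by_contra h
    rw [Metric.ball_eq_empty.2 (not_lt.1 h), measure_empty] at hV₀
    exact zero_ne_one hV₀
  have h3 : 0 < 1 - χ := by linarith [hχ.2]
  have hχ0 := hχ.1
  obtain ⟨c₀, hc₀, hc₀'⟩ := exists_le_setIntegral_abs_inner d hV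
  obtain ⟨γs, hγs, hsmall⟩ := exists_isSmallExponent (V₀ := V₀) hχ hc₀
  refine ⟨γs, hγs, fun γ hγ => ?_⟩
  have hγ' := hsmall γ hγ
  have hγ0 := hγ'.pos
  have hb : 0 ≤ 1 - χ - γ * V₀ := by linarith [hγ'.speed]
  set c := χ * c₀ / (8 * (1 + χ)) with hc
  have hc0 : 0 < c := by positivity
  have hγc : 0 < γ * c := mul_pos hγ0 hc0
  -- `R₀` is large enough for the drift to cost at most `γc` outside radius `R`. The constant `4` is
  -- `2(2 + N)` with `N = 0`.
  refine ⟨-(γ * c / 2), by linarith, max 2 (2 * V₀ ^ 2 / (1 - χ) / c),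
    lt_max_of_lt_left one_lt_two, ⟨4, by norm_num, fun R hR => ?_⟩, fun R hR => ?_⟩
  all_goals
    have hR2 : 2 ≤ R := (le_max_left _ _).trans hR
    have hRc : 2 * V₀ ^ 2 / (1 - χ) ≤ c * R := by
      have := (le_max_right _ _).trans hR
      rwa [div_le_iff₀ hc0, mul_comm R] at this
    have hR0 : 0 < R := by linarith
  · have hκ := hϕ.isBoundedKernel_cutoff_mul (V₀ := V₀) hd hχ hR0
    -- The remainder kernel `(1-φ_R)K` is dominated by `K` everywhere, so neither correction is
    -- needed and the constant is independent of `R`.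
    have hw := isLyapunov_lyapunovWeight (N := 0) (ε := 0) (σ := 1) (Bd := ∅) hV₀ hχ hγ' hc₀.le
      hc₀' le_rfl le_rfl one_pos MeasurableSet.empty (by simpa using hγc.le) (by linarith) hRc
      (fun z hz => (hκ.remainder hχ).bound z.1 z.2 hz)
      (fun z _ => hϕ.isControlled_cutoff_mul hd hχ hR0 z)
    obtain ⟨S, hS, hSt⟩ := exists_semigroup_Lp_of_isLyapunov hV₀ hd hγ0.le hχ hb hκ hw (by norm_num)
    refine ⟨⟨S, hS⟩, fun S' hS' t => ?_⟩
    rw [IsSemigroupGeneratedBy.unique hS' hS]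
    exact (hSt t).trans (le_of_eq (by rw [← hc, add_zero]; norm_num))
  set N := 36 / (1 - χ) with hN
  have hN0 : 0 < N := by positivity
  -- The budget `5ε + 2Nμ ≤ γc` is shared equally: the volume bound gives `2Nμ < γc/2`, and `ε =
  -- γc/10` below gives `5ε = γc/2`.
  obtain ⟨b, hb0, hb'⟩ := mem_nhdsGT_iff_exists_Ioo_subset.1
    ((tendsto_extremeVelocities (V₀ := V₀) hd).eventually_lt_const
      (by positivity : 0 < γ * c / (4 * N)))
  refine ⟨min b (1 / 2), ⟨lt_min hb0 (by norm_num), (min_le_right _ _).trans_lt (by norm_num)⟩,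
    fun δ₁ hδ₁ => ?_⟩
  have hvol := hb' ⟨hδ₁.1, hδ₁.2.trans_le (min_le_left _ _)⟩
  rw [mem_ofPred_eq, lt_div_iff₀ (by positivity)] at hvol
  have hδ₁0 := hδ₁.1
  set ε := γ * c / 10 with hε
  have hε0 : 0 < ε := by positivity
  -- Non-extreme velocities have `|v| ≥ 2δ₁`, so the slope `ε|v|²/2σ` is at least `10`, above the
  -- required `9`. The bounds on `δ₂` and `δ₃` are then dictated by `σ`.
  set σ := ε * δ₁ ^ 2 / 5 with hσ
  have hσ0 : 0 < σ := by positivity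
  refine ⟨min (σ / (2 * V₀)) (1 / 2), ⟨lt_min (by positivity) (by norm_num),
    (min_le_right _ _).trans_lt (by norm_num)⟩, fun δ₂ hδ₂ => ?_⟩
  have hδ₂' := hδ₂.2.le.trans (min_le_left _ _)
  rw [le_div_iff₀ (by positivity)] at hδ₂'
  refine ⟨min σ (1 / 2), ⟨lt_min hσ0 (by norm_num), (min_le_right _ _).trans_lt (by norm_num)⟩,
    fun δ₃ hδ₃ ζ hζ => ?_⟩
  have hκ := hϕ.isBoundedKernel_truncated (V₀ := V₀) hd hχ hR0 hδ₁0 hδ₂.1 hζ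
  have hw := isLyapunov_lyapunovWeight (N := N) (ε := ε) (σ := σ)
    (Bd := extremeVelocities d V₀ δ₁) hV₀ hχ hγ' hc₀.le hc₀' hε0.le hN0.le hσ0
    measurableSet_extremeVelocities (by linarith) (by linarith) hRc
    (fun z hz => (hκ.remainder hχ).bound z.1 z.2 hz)
    (fun z hz => hϕ.isControlled_truncated hd hχ hR0 hδ₁0 hδ₂.1 hδ₃.1 hζ hN.ge hε0.le hσ0
      (by rw [hσ]; nlinarith [mul_pos hε0 (pow_pos hδ₁0 2)]) (by linarith)
      (hδ₃.2.le.trans (min_le_left _ _)) hz)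
  obtain ⟨S, hS, D, hD, hSt⟩ := exists_semigroup_X_of_isLyapunov hV₀ hd hγ0.le hχ hb hκ hw
    (by positivity) (by linarith [hγ'.speed, hγ'.rate])
  refine ⟨⟨S, hS⟩, fun S' hS' a ha => ⟨D, hD, fun t => ?_⟩⟩
  rw [IsSemigroupGeneratedBy.unique hS' hS]
  -- The estimate holds at the rate `a*` itself, hence at every larger rate with the same constant.
  refine (hSt t).trans ?_
  gcongr
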